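/- Let $N$ be a positive integer and $\kappa>0$ (the result also holds trivially for $N=0$). Consider the Calogero Hamiltonian $$H_N=-\sum_{j=1}^N\frac{\partial^2}{\partial x_j^2}+\sum_{j=1}^N x_j^2+2\kappa(\kappa-1)\sum_{j<k}\frac{1}{(x_j-x_k)^2}$$ and its ground state $\Psi_0(x)=\prod_{j=1}^N e^{-x_j^2/2}\prod_{j<k}(x_k-x_j)^\kappa$ (principal powers). A symmetric polynomial $P$ is called a reduced eigenfunction of $H_N$ with eigenvalue $E$ if $\Psi=\Psi_0P$ is square integrable on $\mathbb{R}^N$, is smooth on the set of $x\in\mathbb{R}^N$ with pairwise distinct coordinates, and satisfies $H_N\Psi=E\Psi$ there (the case $P=0$ is not excluded). For $n\in\mathbb{Z}^N$ let symmetric polynomials $f_n$ with real coefficients in $x=(x_1,\dots,x_N)$ be defined by the expansion $$\frac{\prod_{j<k}(1-y_j/y_k)^\kappa}{\prod_{j,k}(1-x_j/y_k)^\kappa}=\sum_{n\in\mathbb{Z}^N}f_n(x)\,y^{-n},\qquad |y_N|>\cdots>|y_1|>\max_j|x_j|,$$ where $y^{-n}=y_1^{-n_1}\cdots y_N^{-n_N}$;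 this expansion determines the $f_n$ uniquely. For $m,n\in\mathbb{Z}^N$ write $|n|=n_1+\cdots+n_N$; write $m\preceq n$ if $m_j+\cdots+m_N\le n_j+\cdots+n_N$ for all $j=1,\dots,N$, and $m\prec n$ if $m\preceq n$ and $m\neq n$. Let $n_j^+=n_j+\kappa(N+1-j)$, let $e_1,\dots,e_N$ be the standard basis of $\mathbb{Z}^N$, let $\delta_n(m)$ be $1$ if $m=n$ and $0$ otherwise, and put $$E^\nu_{jk}=(1-\nu)e_j+(1+\nu)e_k,\qquad g_{jk}(\nu;m)=2\kappa(\kappa-1)\nu(1-\delta_{jk})-m_j^+(m_j^++1)\delta_{\nu0}\delta_{jk}.$$ **Theorem.** For $n\in\mathbb{Z}^N$ let $$P_n=f_n+\sum_m u_n(m)f_m,$$ where the sum is over $m\in\mathbb{Z}^N$ with $m\prec n$ and $|m|\le|n|-2$, and $$u_n(m)=\sum_{s=1}^\infty\frac{1}{4^s s!}\sum_{j_1\le k_1}\cdots\sum_{j_s\le k_s}\ \sum_{\nu_1,\dots,\nu_s=0}^\infty\delta_n\Bigl(m+\sum_{r=1}^sE^{\nu_r}_{j_rk_r}\Bigr)\prod_{r=1}^s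 g_{j_rk_r}\Bigl(\nu_r;\,n-\sum_{\ell=1}^rE^{\nu_\ell}_{j_\ell k_\ell}\Bigr).$$ Both sums have only finitely many nonzero terms. For every $n\in\mathbb{Z}^N$, $P_n$ is a reduced eigenfunction of $H_N$ (possibly zero) with eigenvalue $$E_n=2|n|+N\bigl(1+\kappa(N-1)\bigr).$$ Moreover, as $\lambda$ runs through all partitions of length at most $N$ (integer vectors with $\lambda_1\ge\cdots\ge\lambda_N\ge0$), the $P_\lambda$ form a basis of the space of symmetric polynomials in $N$ variables with real coefficients. In particular $P_\lambda\ne0$ for these $\lambda$. -/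

import Mathlib

open scoped ContDiff BigOperators

noncomputable section

namespace Calogero

/-- Integer vectors in `ℤ^N`.  The indices `1, …, N` become `0, …, N - 1`. -/
abbrev IntVec (N : ℕ) : Type := Fin N → ℤ

/-- `|n| = n_1 + ⋯ + n_N`. -/
def weight {N : ℕ} (n : IntVec N) : ℤ := ∑ j, n j

/-- `m ≼ n`: `m_j + ⋯ + m_N ≤ n_j + ⋯ + n_N` for every `j`. -/
def Preceq {N : ℕ} (m n : IntVec N) : Prop :=
  ∀ j : Fin N, ∑ i ∈ Finset.Ici j, m i ≤ ∑ i ∈ Finset.Ici j, n i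

/-- `m ≺ n`: `m ≼ n` and `m ≠ n`. -/
def Prec {N : ℕ} (m n : IntVec N) : Prop := Preceq m n ∧ m ≠ n

/-- `n_j^+ = n_j + κ (N + 1 - j)` for `j = 1, …, N`; with indices starting at `0` this is
`n_j + κ (N - j)`. -/
def shifted {N : ℕ} (κ : ℝ) (n : IntVec N) (j : Fin N) : ℝ :=
  (n j : ℝ) + κ * ((N : ℝ) - ((j : ℕ) : ℝ))

/-- The vector `E^ν_{jk} = (1 - ν) e_j + (1 + ν) e_k`. -/
def stepVec {N : ℕ} (j k : Fin N) (ν : ℕ) : IntVec N :=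
  (1 - (ν : ℤ)) • Pi.single j (1 : ℤ) + (1 + (ν : ℤ)) • Pi.single k (1 : ℤ)

/-- `g_{jk}(ν; m) = 2 κ (κ - 1) ν (1 - δ_{jk}) - m_j^+ (m_j^+ + 1) δ_{ν0} δ_{jk}`. -/
def g {N : ℕ} (κ : ℝ) (j k : Fin N) (ν : ℕ) (m : IntVec N) : ℝ :=
  2 * κ * (κ - 1) * (ν : ℝ) * (1 - if j = k then 1 else 0)
    - shifted κ m j * (shifted κ m j + 1) * (if ν = 0 then 1 else 0) * (if j = k then 1 else 0)

/-- One step `(j, k, ν)` of a chain: indices `j ≤ k` and `ν = 0, 1, 2, …`. -/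
abbrev Step (N : ℕ) : Type := {p : Fin N × Fin N // p.1 ≤ p.2} × ℕ

/-- The vector `E^ν_{jk}` of a step. -/
def Step.vec {N : ℕ} (t : Step N) : IntVec N := stepVec t.1.1.1 t.1.1.2 t.2

/-- The number `g_{jk}(ν; m)` of a step. -/
def Step.coeff {N : ℕ} (κ : ℝ) (t : Step N) (m : IntVec N) : ℝ :=
  g κ t.1.1.1 t.1.1.2 t.2 m

/-- The term of `u_n(m)` that belongs to the chain `c` of length `s`:
`1 / (4^s s!) * δ_n(m + ∑_r E_r) * ∏_r g_r(n - ∑_{ℓ ≤ r} E_ℓ)`. -/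
def chainTerm {N : ℕ} (κ : ℝ) (n m : IntVec N) (s : ℕ) (c : Fin s → Step N) : ℝ :=
  1 / ((4 : ℝ) ^ s * (s.factorial : ℝ)) *
    (if m + ∑ r, (c r).vec = n then 1 else 0) *
    ∏ r, (c r).coeff κ (n - ∑ l ∈ Finset.Iic r, (c l).vec)

/-- All chains of length `s ≥ 1`. -/
abbrev Chain (N : ℕ) : Type := Σ s : {s : ℕ // 1 ≤ s}, Fin s.1 → Step N

/-- The coefficient `u_n(m)`, a sum over all chains of length `s = 1, 2, 3, …`
(with finitely many nonzero terms). -/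
def u {N : ℕ} (κ : ℝ) (n m : IntVec N) : ℝ :=
  ∑ᶠ c : Chain N, chainTerm κ n m c.1.1 c.2

/-- The generating function
`∏_{j<k} (1 - y_j / y_k)^κ / ∏_{j,k} (1 - x_j / y_k)^κ` (principal powers). -/
def genFun {N : ℕ} (κ : ℝ) (x y : Fin N → ℂ) : ℂ :=
  (∏ p : Fin N × Fin N with p.1 < p.2, (1 - y p.1 / y p.2) ^ (κ : ℂ)) /
    ∏ j, ∏ k, (1 - x j / y k) ^ (κ : ℂ)

/-- `f` is the family of coefficients of the generating function: in the region
`|y_N| > ⋯ > |y_1| > max_j |x_j|` it equals the (unconditionally convergent) series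
`∑_n f_n(x) y^{-n}` over `n ∈ ℤ^N`. -/
def IsExpansion {N : ℕ} (κ : ℝ) (f : IntVec N → MvPolynomial (Fin N) ℝ) : Prop :=
  ∀ x y : Fin N → ℂ, StrictMono (fun k => ‖y k‖) → (∀ j k, ‖x j‖ < ‖y k‖) →
    HasSum (fun n : IntVec N => MvPolynomial.aeval x (f n) * ∏ k, y k ^ (-(n k)))
      (genFun κ x y)

/-- The `m` over which the sum defining `P_n` extends: `m ≺ n` and `|m| ≤ |n| - 2`. -/
abbrev Below {N : ℕ} (n : IntVec N) : Type :=
  {m : IntVec N // Prec m n ∧ weight m ≤ weight n - 2}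

/-- `P_n = f_n + ∑_m u_n(m) f_m` (the sum has finitely many nonzero terms). -/
def P {N : ℕ} (κ : ℝ) (f : IntVec N → MvPolynomial (Fin N) ℝ) (n : IntVec N) :
    MvPolynomial (Fin N) ℝ :=
  f n + ∑ᶠ m : Below n, u κ n m.1 • f m.1

/-- The configurations with pairwise distinct positions. -/
def config (N : ℕ) : Set (Fin N → ℝ) := {x | Function.Injective x}

/-- The second partial derivative of `Ψ` in the direction `x_j` at `x`. -/
def partial2 {N : ℕ} (j : Fin N) (Ψ : (Fin N → ℝ) → ℂ) (x : Fin N → ℝ) : ℂ :=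
  iteratedDeriv 2 (fun t : ℝ => Ψ (Function.update x j t)) (x j)

/-- The Schrödinger operator of the Calogero model,
`-∑_j ∂²/∂x_j² + ∑_j x_j² + 2 κ (κ - 1) ∑_{j<k} 1 / (x_j - x_k)²`. -/
def hamiltonian {N : ℕ} (κ : ℝ) (Ψ : (Fin N → ℝ) → ℂ) (x : Fin N → ℝ) : ℂ :=
  -(∑ j, partial2 j Ψ x) + ((∑ j, x j ^ 2 : ℝ) : ℂ) * Ψ x +
    ((2 * κ * (κ - 1) *
      ∑ p : Fin N × Fin N with p.1 < p.2, 1 / (x p.1 - x p.2) ^ 2 : ℝ) : ℂ) * Ψ x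

/-- The ground state `∏_j exp (-x_j² / 2) ∏_{j<k} (x_k - x_j)^κ` (principal powers, which are
the positive real ones where `x_1 < ⋯ < x_N`). -/
def groundState {N : ℕ} (κ : ℝ) (x : Fin N → ℝ) : ℂ :=
  (∏ j, (Real.exp (-(1 / 2) * x j ^ 2) : ℂ)) *
    ∏ p : Fin N × Fin N with p.1 < p.2, ((x p.2 - x p.1 : ℝ) : ℂ) ^ (κ : ℂ)

/-- The wave function `Ψ_0 Q` of a polynomial `Q`. -/
def waveFunction {N : ℕ} (κ : ℝ) (Q : MvPolynomial (Fin N) ℝ) (x : Fin N → ℝ) : ℂ :=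
  groundState κ x * ((MvPolynomial.eval x Q : ℝ) : ℂ)

/-- `Q` is a symmetric polynomial for which `Ψ = Ψ_0 Q` is square integrable, smooth where the
positions are pairwise distinct, and satisfies `H Ψ = E Ψ` there.  (The zero polynomial is
not excluded.) -/
structure IsReducedEigenfunction {N : ℕ} (κ E : ℝ) (Q : MvPolynomial (Fin N) ℝ) : Prop where
  symmetric : Q.IsSymmetric
  squareIntegrable : MeasureTheory.MemLp (waveFunction κ Q) 2 MeasureTheory.volume
  smooth : ContDiffOn ℝ ∞ (waveFunction κ Q) (config N)
  schrodinger : ∀ x ∈ config N,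
    hamiltonian κ (waveFunction κ Q) x = (E : ℂ) * waveFunction κ Q x

/-- `E_n = 2 |n| + N (1 + κ (N - 1))`. -/
def energy {N : ℕ} (κ : ℝ) (n : IntVec N) : ℝ :=
  2 * (weight n : ℝ) + (N : ℝ) * (1 + κ * ((N : ℝ) - 1))

/-- Partitions of length at most `N`, i.e. integer vectors `λ_1 ≥ ⋯ ≥ λ_N ≥ 0`. -/
abbrev Part (N : ℕ) : Type := {l : IntVec N // Antitone l ∧ ∀ j, 0 ≤ l j}

end Calogero

end

/-! Write `D = ∑ x_j ∂_j` and `L = ∑ ∂_j² + 2κ ∑_{i<j} (x_i - x_j)⁻¹ (∂_i - ∂_j)`. Conjugating the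
Hamiltonian by the ground state removes both potentials: `Ψ_0 Q` has eigenvalue `2w + N(1 + κ(N-1))`
as soon as `L Q = 2 (D - w) Q` (`hamiltonian_waveFunction`). Since `L` lowers the degree by two,
`exp(-L/4) f` solves this equation whenever `f` is homogeneous of degree `w`. The claim is that
`P_n` is `exp(-L/4) f_n`, written out.

This needs the action of `L` on the `f_n`. The generating function is a kernel function
(`kernel_identity`): applying `L` in `x` equals applying an operator in `y`, namely `∑ D_m² -
2κ(κ-1) ∑_{j<k} (y_k - y_j)⁻²`, with `D_m` a conjugate of `-∂/∂y_m`. Comparing coefficients of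
`y^{-n}`, with `(y_k - y_j)⁻² = ∑ ν y^{-E^ν_{jk}}`, gives `-L f_n = ∑ g_{jk}(ν; n - E^ν_{jk}) f_{n -
E^ν_{jk}}` (`laplace_fcoef`). Iteration produces the chains in `u_n(m)`, and `1/(4^s s!)` is the
exponential series (`P_eq_sum_level`, `laplaceEval_P`).

The algebra takes place in formal power series in `1/y_1, y_1/y_2, …, y_{N-1}/y_N`. The exponents of
`y^{-n}` in these variables are the tail sums `n_l + ⋯ + n_N`, so `f_n` vanishes unless all of them
are nonnegative; this makes every sum finite. Convergence of the binomial series identifies the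
formal coefficients with the analytic ones, and uniqueness of Fourier coefficients shows that the
expansion determines them (`isExpansion_fcoef`, `isExpansion_unique`).

For the basis, let `∏ (1 - x_j t)^{-κ} = ∑ g_r t^r`. The factor `∏ (1 - y_j/y_k)^κ` makes `f_λ`, and
hence `P_λ`, unitriangular over the products `g_λ = ∏ g_{λ_k}` (`P_sub_gprod_mem_span_rank`). That
the `g_λ` with at most `N` parts form a basis follows from positivity. Let `T` send `x^b` to `∏
g_{b_k}`, and let monomials be orthonormal. Newton's recursion gives `d ⟨C, T C⟩ = κ ∑ ⟨p_i^* C, T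
p_i^* C⟩` in degree `d`, where `p_i^*` is the adjoint of multiplication by the power sum `p_i`. So
for `κ > 0` the form is nonnegative, and its null vectors are orthogonal to all symmetric
polynomials (`pairing_smear`). Thus `T` is injective, and degree by degree bijective, on symmetric
polynomials, and it maps orbit sums to multiples of the `g_λ`. -/

noncomputable section

/-! ### Tail sums, and formal series indexed by a cone in `ℤ^N`. -/

namespace Calogero

variable {N : ℕ}

/-- The tail sums `n_l + ⋯ + n_N` of an integer vector. -/
def tail (n : IntVec N) (l : Fin N) : ℤ := ∑ i ∈ Finset.Ici l, n i

lemma tail_add (m n : IntVec N) (l : Fin N) : tail (m + n) l = tail m l + tail n l := by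
  simp [tail, Finset.sum_add_distrib]

lemma tail_sub (m n : IntVec N) (l : Fin N) : tail (m - n) l = tail m l - tail n l := by
  simp [tail, Finset.sum_sub_distrib]

lemma tail_zero (l : Fin N) : tail (0 : IntVec N) l = 0 := by
  simp [tail]

lemma tail_smul (c : ℤ) (n : IntVec N) (l : Fin N) : tail (c • n) l = c * tail n l := by
  simp [tail, Finset.mul_sum]

lemma tail_sum {ι : Type*} (s : Finset ι) (v : ι → IntVec N) (l : Fin N) :
    tail (∑ i ∈ s, v i) l = ∑ i ∈ s, tail (v i) l := by
  simp only [tail, Finset.sum_apply]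
  exact Finset.sum_comm

lemma tail_single (k : Fin N) (c : ℤ) (l : Fin N) :
    tail (Pi.single k c) l = if l ≤ k then c else 0 := by
  simp [tail]

lemma tail_succ (n : IntVec N) (l : Fin N) :
    tail n l = n l + if h : (l : ℕ) + 1 < N then tail n ⟨l + 1, h⟩ else 0 := by
  have h1 : Finset.Ici l = insert l (Finset.Ioi l) := by
    ext i; simp [le_iff_eq_or_lt]
  rw [tail, h1, Finset.sum_insert (by simp)]
  congr 1
  split_ifs with h
  · refine Finset.sum_congr ?_ fun _ _ => rfl
    ext i
    rw [Finset.mem_Ioi, Finset.mem_Ici, Fin.lt_def, Fin.le_def, Nat.succ_le_iff]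
  · refine Finset.sum_eq_zero fun i hi => ?_
    have := Finset.mem_Ioi.1 hi
    rw [Fin.lt_def] at this
    omega

/-- The integer vector with prescribed tail sums. -/
def untail (t : Fin N → ℤ) : IntVec N :=
  fun k => t k - if h : (k : ℕ) + 1 < N then t ⟨k + 1, h⟩ else 0

lemma untail_tail (n : IntVec N) : untail (tail n) = n := by
  funext k
  rw [untail, tail_succ n k]
  ring

lemma tail_injective : Function.Injective (tail (N := N)) :=
  Function.LeftInverse.injective untail_tail

lemma tail_untail (t : Fin N → ℤ) : tail (untail t) = t := by
  have key : ∀ (i : ℕ) (l : Fin N), N ≤ (l : ℕ) + i → tail (untail t) l = t l := by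
    intro i
    induction i with
    | zero => intro l hl; exact absurd l.2 (by omega)
    | succ i ih =>
      intro l hl
      rw [tail_succ, untail]
      split_ifs with h
      · rw [ih ⟨l + 1, h⟩ (by simp; omega)]; ring
      · ring
  funext l
  exact key N l (by omega)

/-- Integer vectors with nonnegative tail sums. -/
def Cone (n : IntVec N) : Prop := ∀ l, 0 ≤ tail n l

lemma Cone.add {m n : IntVec N} (hm : Cone m) (hn : Cone n) : Cone (m + n) := fun l => by
  rw [tail_add]; exact add_nonneg (hm l) (hn l)

lemma cone_zero : Cone (0 : IntVec N) := fun l => (tail_zero l).ge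

lemma Cone.nsmul {m : IntVec N} (hm : Cone m) (i : ℕ) : Cone (i • m) := by
  induction i with
  | zero => simpa using cone_zero
  | succ i ih => rw [succ_nsmul]; exact ih.add hm

lemma cone_single (k : Fin N) : Cone (Pi.single k (1 : ℤ)) := fun l => by
  rw [tail_single]; split_ifs <;> simp

/-- The tail sums as an exponent vector. -/
def tailExp (n : IntVec N) : Fin N →₀ ℕ :=
  Finsupp.equivFunOnFinite.symm fun l => (tail n l).toNat

lemma tailExp_apply (n : IntVec N) (l : Fin N) : tailExp n l = (tail n l).toNat := rfl

/-- The integer vector whose tail sums are a given exponent vector. -/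
def ofExp (d : Fin N →₀ ℕ) : IntVec N := untail fun l => (d l : ℤ)

lemma tail_ofExp (d : Fin N →₀ ℕ) (l : Fin N) : tail (ofExp d) l = d l := by
  rw [ofExp, tail_untail]

lemma cone_ofExp (d : Fin N →₀ ℕ) : Cone (ofExp d) := fun l => by
  rw [tail_ofExp]; positivity

lemma tailExp_ofExp (d : Fin N →₀ ℕ) : tailExp (ofExp d) = d := by
  ext l; simp [tailExp_apply, tail_ofExp]

lemma ofExp_tailExp {n : IntVec N} (hn : Cone n) : ofExp (tailExp n) = n := by
  apply tail_injective
  funext l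
  rw [tail_ofExp, tailExp_apply, Int.toNat_of_nonneg (hn l)]

lemma ofExp_add (d e : Fin N →₀ ℕ) : ofExp (d + e) = ofExp d + ofExp e := by
  apply tail_injective
  funext l
  rw [tail_add]
  simp [tail_ofExp]

lemma ofExp_injective : Function.Injective (ofExp (N := N)) :=
  Function.LeftInverse.injective tailExp_ofExp

lemma tailExp_add {m n : IntVec N} (hm : Cone m) (hn : Cone n) :
    tailExp (m + n) = tailExp m + tailExp n := by
  apply ofExp_injective
  rw [ofExp_add, ofExp_tailExp hm, ofExp_tailExp hn, ofExp_tailExp (hm.add hn)]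

lemma tailExp_zero : tailExp (0 : IntVec N) = 0 := by
  ext l; simp [tailExp_apply, tail_zero]

lemma tailExp_nsmul {m : IntVec N} (hm : Cone m) (i : ℕ) : tailExp (i • m) = i • tailExp m := by
  induction i with
  | zero => simp [tailExp_zero]
  | succ i ih => rw [succ_nsmul, tailExp_add (hm.nsmul i) hm, ih, succ_nsmul]

lemma tailExp_ne_zero {m : IntVec N} (hm : Cone m) (h0 : m ≠ 0) : tailExp m ≠ 0 := by
  intro h
  apply h0
  rw [← ofExp_tailExp hm, h, ← tailExp_zero, ofExp_tailExp cone_zero]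

/-- Polynomials in the particle positions. -/
abbrev Coef (N : ℕ) : Type := MvPolynomial (Fin N) ℝ

/-- Formal series in `1 / y_1, y_1 / y_2, …, y_{N-1} / y_N` whose coefficients are polynomials
in the positions. -/
abbrev Series (N : ℕ) : Type := MvPowerSeries (Fin N) (Coef N)

open Classical in
/-- The coefficient of `y^{-n}` in a series. -/
def cf (φ : Series N) (n : IntVec N) : Coef N :=
  if Cone n then MvPowerSeries.coeff (tailExp n) φ else 0

lemma cf_of_cone {n : IntVec N} (hn : Cone n) (φ : Series N) :
    cf φ n = MvPowerSeries.coeff (tailExp n) φ := if_pos hn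

lemma cf_of_not_cone {n : IntVec N} (hn : ¬ Cone n) (φ : Series N) : cf φ n = 0 := if_neg hn

lemma cf_ofExp (φ : Series N) (d : Fin N →₀ ℕ) : cf φ (ofExp d) = MvPowerSeries.coeff d φ := by
  rw [cf_of_cone (cone_ofExp d), tailExp_ofExp]

lemma series_ext {φ ψ : Series N} (h : ∀ n, cf φ n = cf ψ n) : φ = ψ := by
  ext1 d
  rw [← cf_ofExp, ← cf_ofExp, h]

lemma cf_add (φ ψ : Series N) (n : IntVec N) : cf (φ + ψ) n = cf φ n + cf ψ n := by
  unfold cf; split_ifs <;> simp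

lemma cf_sub (φ ψ : Series N) (n : IntVec N) : cf (φ - ψ) n = cf φ n - cf ψ n := by
  unfold cf; split_ifs <;> simp

lemma cf_smul (c : ℝ) (φ : Series N) (n : IntVec N) : cf (c • φ) n = c • cf φ n := by
  unfold cf; split_ifs <;> simp

lemma cf_zero (n : IntVec N) : cf (0 : Series N) n = 0 := by
  unfold cf; split_ifs <;> simp

lemma cf_sum {ι : Type*} (s : Finset ι) (φ : ι → Series N) (n : IntVec N) :
    cf (∑ i ∈ s, φ i) n = ∑ i ∈ s, cf (φ i) n := by
  unfold cf; split_ifs <;> simp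

lemma cf_C_mul (a : Coef N) (φ : Series N) (n : IntVec N) :
    cf (MvPowerSeries.C a * φ) n = a * cf φ n := by
  unfold cf; split_ifs <;> simp

/-- The monomial `y^{-m}`. -/
def mon (m : IntVec N) : Series N := MvPowerSeries.monomial (tailExp m) 1

lemma mon_add {m n : IntVec N} (hm : Cone m) (hn : Cone n) : mon (m + n) = mon m * mon n := by
  rw [mon, mon, mon, MvPowerSeries.monomial_mul_monomial, tailExp_add hm hn, one_mul]

lemma mon_zero : mon (0 : IntVec N) = 1 := by
  rw [mon, tailExp_zero]; rfl

lemma mon_nsmul {m : IntVec N} (hm : Cone m) (i : ℕ) : mon (i • m) = mon m ^ i := by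
  induction i with
  | zero => simp [mon_zero]
  | succ i ih => rw [succ_nsmul, mon_add (hm.nsmul i) hm, ih, pow_succ]

lemma mon_ne_zero (m : IntVec N) : mon m ≠ 0 := by
  intro h
  have := congrArg (MvPowerSeries.coeff (tailExp m)) h
  simp [mon] at this

lemma mon_injective {m n : IntVec N} (hm : Cone m) (hn : Cone n) (h : mon m = mon n) : m = n := by
  have := congrArg (MvPowerSeries.coeff (tailExp m)) h
  rw [mon, mon, MvPowerSeries.coeff_monomial_same, MvPowerSeries.coeff_monomial] at this
  split_ifs at this with h1
  · rw [← ofExp_tailExp hm, h1, ofExp_tailExp hn]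
  · simp at this

/-- Because `cf` is zero off the cone, the shift rule needs no boundary cases, and all later
recurrences can be stated over the whole of `ℤ^N`. -/
lemma cf_mon_mul {m : IntVec N} (hm : Cone m) (φ : Series N) (n : IntVec N) :
    cf (mon m * φ) n = cf φ (n - m) := by
  by_cases h : Cone (n - m)
  · have hn : n = (n - m) + m := by abel
    have hc : Cone n := hn ▸ h.add hm
    have he : tailExp n = tailExp (n - m) + tailExp m := by
      conv_lhs => rw [hn]
      exact tailExp_add h hm
    rw [cf_of_cone hc, cf_of_cone h, mon, MvPowerSeries.coeff_monomial_mul, he, if_pos (by simp),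
      one_mul, add_tsub_cancel_right]
  · rw [cf_of_not_cone h]
    by_cases hn : Cone n
    · rw [cf_of_cone hn, mon, MvPowerSeries.coeff_monomial_mul, if_neg]
      intro hle
      apply h
      intro l
      have := hle l
      rw [tailExp_apply, tailExp_apply] at this
      have h1 := hm l
      have h2 := hn l
      rw [tail_sub]
      omega
    · rw [cf_of_not_cone hn]

lemma cf_mon (m n : IntVec N) (hm : Cone m) : cf (mon m) n = if n = m then 1 else 0 := by
  by_cases hn : Cone n
  · rw [cf_of_cone hn, mon, MvPowerSeries.coeff_monomial]
    congr 1
    refine propext ⟨fun h => ?_, fun h => by rw [h]⟩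
    rw [← ofExp_tailExp hm, ← h, ofExp_tailExp hn]
  · rw [cf_of_not_cone hn, if_neg]
    rintro rfl
    exact hn hm

/-- The coefficientwise partial derivative `∂ / ∂x_j`. -/
def xder (j : Fin N) : Derivation ℝ (Series N) (Series N) :=
  Derivation.mk'
    { toFun := fun φ d => MvPolynomial.pderiv j (MvPowerSeries.coeff d φ)
      map_add' := fun φ ψ => by ext1 d; exact map_add (MvPolynomial.pderiv j) _ _
      map_smul' := fun c φ => by ext1 d; exact Derivation.map_smul (MvPolynomial.pderiv j) c _ }
    fun φ ψ => by
      classical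
      ext1 d
      change MvPolynomial.pderiv j (MvPowerSeries.coeff d (φ * ψ)) = _
      rw [map_add, smul_eq_mul, smul_eq_mul, mul_comm ψ, MvPowerSeries.coeff_mul,
        MvPowerSeries.coeff_mul, MvPowerSeries.coeff_mul, map_sum, ← Finset.sum_add_distrib]
      refine Finset.sum_congr rfl fun p _ => ?_
      rw [Derivation.leibniz, smul_eq_mul, smul_eq_mul, mul_comm (MvPowerSeries.coeff p.2 ψ)]
      rfl

/-- The operator `-y_k ∂ / ∂y_k`, which multiplies `y^{-n}` by `n_k`. -/
def yder (k : Fin N) : Derivation ℝ (Series N) (Series N) :=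
  Derivation.mk'
    { toFun := fun φ d => (ofExp d k : Coef N) * MvPowerSeries.coeff d φ
      map_add' := fun φ ψ => by ext1 d; exact mul_add _ _ _
      map_smul' := fun c φ => by ext1 d; exact mul_smul_comm c _ _ }
    fun φ ψ => by
      classical
      ext1 d
      change (ofExp d k : Coef N) * (MvPowerSeries.coeff d (φ * ψ)) = _
      rw [map_add, smul_eq_mul, smul_eq_mul, mul_comm ψ, MvPowerSeries.coeff_mul,
        MvPowerSeries.coeff_mul, MvPowerSeries.coeff_mul, Finset.mul_sum,
        ← Finset.sum_add_distrib]
      refine Finset.sum_congr rfl fun p hp => ?_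
      have hp' : p.1 + p.2 = d := Finset.HasAntidiagonal.mem_antidiagonal.1 hp
      change _ = _ * ((ofExp p.2 k : Coef N) * _) + ((ofExp p.1 k : Coef N) * _) * _
      rw [← hp', ofExp_add]
      simp only [Pi.add_apply, Int.cast_add]
      ring

lemma cf_xder (j : Fin N) (φ : Series N) (n : IntVec N) :
    cf (xder j φ) n = MvPolynomial.pderiv j (cf φ n) := by
  by_cases hn : Cone n
  · rw [cf_of_cone hn, cf_of_cone hn]; rfl
  · rw [cf_of_not_cone hn, cf_of_not_cone hn, map_zero]

lemma cf_yder (k : Fin N) (φ : Series N) (n : IntVec N) :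
    cf (yder k φ) n = (n k : Coef N) * cf φ n := by
  by_cases hn : Cone n
  · rw [cf_of_cone hn, cf_of_cone hn]
    change (ofExp (tailExp n) k : Coef N) * _ = _
    rw [ofExp_tailExp hn]
  · rw [cf_of_not_cone hn, cf_of_not_cone hn, mul_zero]

lemma yder_mon (k : Fin N) {m : IntVec N} (hm : Cone m) :
    yder k (mon m) = (m k : Series N) * mon m := by
  apply series_ext
  intro n
  have : (m k : Series N) = MvPowerSeries.C (m k : Coef N) := by simp
  rw [this, cf_yder, cf_C_mul, cf_mon _ _ hm]
  split_ifs with h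
  · rw [h]
  · simp

lemma yder_C (k : Fin N) (a : Coef N) : yder k (MvPowerSeries.C a) = 0 := by
  apply series_ext
  intro n
  have : MvPowerSeries.C a = MvPowerSeries.C a * mon (0 : IntVec N) := by rw [mon_zero, mul_one]
  rw [cf_yder, cf_zero, this, cf_C_mul, cf_mon _ _ cone_zero]
  split_ifs with h
  · simp [h]
  · simp

lemma xder_mon (j : Fin N) (m : IntVec N) (hm : Cone m) : xder j (mon m) = 0 := by
  apply series_ext
  intro n
  rw [cf_xder, cf_zero, cf_mon _ _ hm]
  split_ifs <;> simp

lemma xder_C (j : Fin N) (a : Coef N) :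
    xder j (MvPowerSeries.C a) = MvPowerSeries.C (MvPolynomial.pderiv j a) := by
  apply series_ext
  intro n
  have h (a : Coef N) : MvPowerSeries.C a = MvPowerSeries.C a * mon (0 : IntVec N) := by
    rw [mon_zero, mul_one]
  rw [cf_xder, h a, h (MvPolynomial.pderiv j a), cf_C_mul, cf_C_mul, cf_mon _ _ cone_zero]
  split_ifs <;> simp

/-! ### Formal powers `(1 - u)^s` and their logarithmic derivatives. -/

/-- The formal power `(1 - X)^s`. -/
def oneSubPow (s : ℝ) : PowerSeries ℝ := PowerSeries.mk fun i => (-1) ^ i * Ring.choose s i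

lemma succ_mul_choose_succ (s : ℝ) (i : ℕ) :
    ((i : ℝ) + 1) * Ring.choose s (i + 1) = (s - i) * Ring.choose s i := by
  have h := Ring.choose_smul_choose s (n := i + 1) (k := i) (by omega)
  simp only [Nat.choose_succ_self_right, Nat.add_sub_cancel_left, Ring.choose_one_right,
    nsmul_eq_mul] at h
  push_cast at h
  linarith

/-- This differential equation is all that the algebraic part uses about the power: it fixes the
logarithmic derivative. -/
lemma one_sub_mul_derivative_oneSubPow (s : ℝ) :
    (1 - PowerSeries.X) * PowerSeries.derivative ℝ (oneSubPow s) =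
      PowerSeries.C (-s) * oneSubPow s := by
  ext i
  rw [sub_mul, one_mul, map_sub, PowerSeries.coeff_C_mul]
  cases i with
  | zero =>
    simp [oneSubPow, PowerSeries.coeff_derivative]
  | succ i =>
    rw [PowerSeries.coeff_succ_X_mul, PowerSeries.coeff_derivative, PowerSeries.coeff_derivative]
    simp only [oneSubPow, PowerSeries.coeff_mk]
    have h1 := succ_mul_choose_succ s (i + 1)
    push_cast at h1 ⊢
    rw [pow_succ, pow_succ]
    linear_combination (-1) ^ i * h1

/-- Substitution of a series without constant term into a power series. -/
abbrev sub (u : Series N) (φ : PowerSeries ℝ) : Series N := PowerSeries.subst u φ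

/-- `u` has order at least one, so `u ^ i` has order at least `i`, and divisibility by `u ^ (degree
d + 1)` already kills the coefficient at `d`. -/
lemma eq_zero_of_forall_pow_dvd {u v : Series N} (hu : MvPowerSeries.constantCoeff u = 0)
    (h : ∀ i : ℕ, u ^ i ∣ v) : v = 0 := by
  ext1 d
  obtain ⟨w, rfl⟩ := h (d.degree + 1)
  refine MvPowerSeries.coeff_of_lt_order ?_
  have h1 : (1 : ℕ∞) ≤ u.order := MvPowerSeries.one_le_order_iff_constCoeff_eq_zero.2 hu
  have h2 : ((d.degree + 1 : ℕ) : ℕ∞) ≤ (u ^ (d.degree + 1)).order := by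
    refine le_trans ?_ (MvPowerSeries.le_order_pow _)
    calc ((d.degree + 1 : ℕ) : ℕ∞) = (d.degree + 1) • 1 := by simp
      _ ≤ _ := nsmul_le_nsmul_right h1 _
  calc (d.degree : ℕ∞) < ((d.degree + 1 : ℕ) : ℕ∞) := by exact_mod_cast Nat.lt_succ_self _
    _ ≤ (u ^ (d.degree + 1)).order + w.order := h2.trans le_self_add
    _ ≤ _ := MvPowerSeries.le_order_mul

lemma sub_C {u : Series N} (hu : MvPowerSeries.constantCoeff u = 0) (a : ℝ) :
    sub u (PowerSeries.C a) = algebraMap ℝ (Series N) a := by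
  have h := PowerSeries.HasSubst.of_constantCoeff_zero hu
  rw [sub, ← PowerSeries.coe_substAlgHom h]
  exact AlgHom.commutes _ a

/-- The chain rule for a derivation applied to a substituted power series. -/
lemma derivation_sub {u : Series N} (hu : MvPowerSeries.constantCoeff u = 0)
    (D : Derivation ℝ (Series N) (Series N)) (φ : PowerSeries ℝ) :
    D (sub u φ) = sub u (PowerSeries.derivative ℝ φ) * D u := by
  have h := PowerSeries.HasSubst.of_constantCoeff_zero hu
  rw [← sub_eq_zero]
  -- No continuity of `D` is needed. Splitting `φ = a + X ψ` shows that the defect of the chain rule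
  -- for `φ` is `u` times the defect for `ψ`, so by induction every power of `u` divides it.
  refine eq_zero_of_forall_pow_dvd hu fun i => ?_
  induction i generalizing φ with
  | zero => simp
  | succ i ih =>
    obtain ⟨a, ψ, rfl⟩ : ∃ (a : ℝ) (ψ : PowerSeries ℝ),
        φ = PowerSeries.C a + PowerSeries.X * ψ :=
      ⟨_, _, by rw [add_comm]; exact PowerSeries.eq_X_mul_shift_add_const φ⟩
    obtain ⟨w, hw⟩ := ih ψ
    refine ⟨w, ?_⟩
    have e1 : sub u (PowerSeries.C a + PowerSeries.X * ψ) =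
        algebraMap ℝ (Series N) a + u * sub u ψ := by
      rw [← sub_C hu, sub, PowerSeries.subst_add h, PowerSeries.subst_mul h, PowerSeries.subst_X h]
    have e2 : sub u (PowerSeries.derivative ℝ (PowerSeries.C a + PowerSeries.X * ψ)) =
        sub u ψ + u * sub u (PowerSeries.derivative ℝ ψ) := by
      have : PowerSeries.derivative ℝ (PowerSeries.C a + PowerSeries.X * ψ) =
          ψ + PowerSeries.X * PowerSeries.derivative ℝ ψ := by
        rw [map_add, Derivation.leibniz, PowerSeries.derivative_C, PowerSeries.derivative_X]
        simp only [smul_eq_mul]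
        ring
      rw [this, sub, PowerSeries.subst_add h, PowerSeries.subst_mul h, PowerSeries.subst_X h]
    rw [e1, e2, map_add, Derivation.map_algebraMap, Derivation.leibniz, pow_succ]
    simp only [smul_eq_mul]
    linear_combination u * hw

/-- The power `(1 - u)^s`. -/
def pw (s : ℝ) (u : Series N) : Series N := sub u (oneSubPow s)

/-- The inverse of `1 - u`. -/
def inv1 (u : Series N) : Series N := sub u (PowerSeries.mk fun _ => 1)

lemma one_sub_mul_inv1 {u : Series N} (hu : MvPowerSeries.constantCoeff u = 0) :
    (1 - u) * inv1 u = 1 := by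
  have h := PowerSeries.HasSubst.of_constantCoeff_zero hu
  have h1 : sub u (1 - PowerSeries.X : PowerSeries ℝ) = 1 - u := by
    rw [sub, PowerSeries.subst_sub h, PowerSeries.subst_X h, ← PowerSeries.coe_substAlgHom h,
      map_one]
  have h2 : (1 - PowerSeries.X : PowerSeries ℝ) * (PowerSeries.mk fun _ => 1) = 1 := by
    rw [mul_comm]; exact PowerSeries.mk_one_mul_one_sub_eq_one ℝ
  rw [← h1, inv1, sub, sub, ← PowerSeries.subst_mul h, h2, ← PowerSeries.coe_substAlgHom h, map_one]

lemma derivation_pw {u : Series N} (hu : MvPowerSeries.constantCoeff u = 0) (s : ℝ)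
    (D : Derivation ℝ (Series N) (Series N)) :
    D (pw s u) = pw s u * (-s • (D u * inv1 u)) := by
  have h := PowerSeries.HasSubst.of_constantCoeff_zero hu
  have h1 : sub u (1 - PowerSeries.X : PowerSeries ℝ) = 1 - u := by
    rw [sub, PowerSeries.subst_sub h, PowerSeries.subst_X h, ← PowerSeries.coe_substAlgHom h,
      map_one]
  have h2 : (1 - u) * sub u (PowerSeries.derivative ℝ (oneSubPow s)) = -s • pw s u := by
    rw [← h1, sub, sub, ← PowerSeries.subst_mul h, one_sub_mul_derivative_oneSubPow,
      PowerSeries.subst_mul h]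
    have := sub_C hu (-s)
    rw [sub] at this
    rw [this, pw, Algebra.smul_def]
  have h3 := one_sub_mul_inv1 hu
  rw [Algebra.smul_def] at h2 ⊢
  have h4 : D (pw s u) = sub u (PowerSeries.derivative ℝ (oneSubPow s)) * D u :=
    derivation_sub hu D _
  rw [h4]
  linear_combination (inv1 u * D u) * h2 -
    sub u (PowerSeries.derivative ℝ (oneSubPow s)) * D u * h3

end Calogero
end

/-! ### The kernel function identity. -/

noncomputable section

namespace Calogero

variable {N : ℕ}

section Algebra

variable {ι R : Type*} [Fintype ι] [DecidableEq ι] [CommRing R]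

/-- Vanishing of the three-body terms. -/
lemma sum_sq_sum_eq [NoZeroDivisors R] [CharZero R] (Q : ι → ι → R) (h0 : ∀ k, Q k k = 0)
    (h3 : ∀ k l m, k ≠ l → l ≠ m → m ≠ k →
      Q k l * Q k m + Q l m * Q l k + Q m k * Q m l = 0) :
    ∑ k, (∑ l, Q k l) ^ 2 = ∑ k, ∑ l, Q k l ^ 2 := by
  set h : ι → ι → ι → R := fun k l m => if l = m then 0 else Q k l * Q k m with hh
  have hcyc : ∀ k l m, h k l m + h l m k + h m k l = 0 := by
    intro k l m
    simp only [hh]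
    by_cases h1 : k = l
    · subst h1; simp [h0]
    by_cases h2 : l = m
    · subst h2; simp [h0]
    by_cases h4 : m = k
    · subst h4; simp [h0]
    rw [if_neg h2, if_neg h4, if_neg h1]
    exact h3 k l m h1 h2 h4
  have e1 : ∑ k, ∑ l, ∑ m, h l m k = ∑ k, ∑ l, ∑ m, h k l m := by
    rw [Finset.sum_comm]
    exact Finset.sum_congr rfl fun l _ => Finset.sum_comm
  have e2 : ∑ k, ∑ l, ∑ m, h m k l = ∑ k, ∑ l, ∑ m, h k l m := by
    calc ∑ k, ∑ l, ∑ m, h m k l = ∑ k, ∑ m, ∑ l, h m k l :=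
          Finset.sum_congr rfl fun k _ => Finset.sum_comm
      _ = _ := Finset.sum_comm
  -- The total over all triples is invariant under cyclic relabelling, so three copies of it add up
  -- to the sum of the vanishing cyclic sums.
  have hs : (3 : R) * ∑ k, ∑ l, ∑ m, h k l m = 0 := by
    have : ∑ k, ∑ l, ∑ m, (h k l m + h l m k + h m k l) = 0 := by simp [hcyc]
    simp only [Finset.sum_add_distrib] at this
    rw [e1, e2] at this
    linear_combination this
  have hs' : ∑ k, ∑ l, ∑ m, h k l m = 0 := by
    rcases mul_eq_zero.1 hs with h | h
    · norm_num at h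
    · exact h
  have key : ∀ k, (∑ l, Q k l) ^ 2 = ∑ l, Q k l ^ 2 + ∑ l, ∑ m, h k l m := by
    intro k
    rw [sq, Finset.sum_mul_sum, ← Finset.sum_add_distrib]
    refine Finset.sum_congr rfl fun l _ => ?_
    have : ∀ m, Q k l * Q k m = (if l = m then Q k l ^ 2 else 0) + h k l m := by
      intro m
      simp only [hh]
      split_ifs with hlm
      · rw [← hlm]; ring
      · ring
    simp only [this, Finset.sum_add_distrib, Finset.sum_ite_eq, Finset.mem_univ, if_true]
  rw [Finset.sum_congr rfl fun k _ => key k, Finset.sum_add_distrib, hs', add_zero]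

/-- Antisymmetrization of the mixed terms. -/
lemma two_mul_sum_mul_sum_eq {ι' : Type*} [Fintype ι'] (Q : ι → ι → R) (z : ι' → ι → R)
    (ha : ∀ k l, Q l k = -Q k l)
    (hz : ∀ j k l, k ≠ l → Q k l * (z j k - z j l) = -(z j k * z j l)) :
    2 * ∑ m, (∑ j, z j m) * ∑ l, Q m l = ∑ m, ∑ j, z j m ^ 2 - ∑ j, (∑ m, z j m) ^ 2 := by
  have e1 : ∑ m, (∑ j, z j m) * ∑ l, Q m l = ∑ j, ∑ m, ∑ l, z j m * Q m l := by
    rw [Finset.sum_comm]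
    refine Finset.sum_congr rfl fun m _ => ?_
    rw [Finset.sum_mul_sum]
  have e2 : ∀ j, 2 * ∑ m, ∑ l, z j m * Q m l = ∑ m, z j m ^ 2 - (∑ m, z j m) ^ 2 := by
    intro j
    -- Relabelling together with antisymmetry of `Q` turns twice the mixed sum into a sum of `Q m l
    -- * (z j m - z j l)`, to which `hz` applies.
    have e3 : ∑ m, ∑ l, z j m * Q m l = -∑ m, ∑ l, z j l * Q m l := by
      rw [Finset.sum_comm, ← Finset.sum_neg_distrib]
      refine Finset.sum_congr rfl fun m _ => ?_
      rw [← Finset.sum_neg_distrib]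
      refine Finset.sum_congr rfl fun l _ => ?_
      rw [ha m l]; ring
    have e4 : 2 * ∑ m, ∑ l, z j m * Q m l = ∑ m, ∑ l, Q m l * (z j m - z j l) := by
      rw [two_mul]
      nth_rewrite 2 [e3]
      rw [← sub_eq_add_neg, ← Finset.sum_sub_distrib]
      refine Finset.sum_congr rfl fun m _ => ?_
      rw [← Finset.sum_sub_distrib]
      exact Finset.sum_congr rfl fun l _ => by ring
    -- The relation `hz` excludes `m = l`, where the left side is zero; the correction `z j m ^ 2`
    -- on the diagonal produces the sum of squares.
    have e5 : ∀ m l, Q m l * (z j m - z j l) = (if m = l then z j m ^ 2 else 0) - z j m * z j l := by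
      intro m l
      split_ifs with h
      · subst h; ring
      · rw [hz j m l h]; ring
    rw [e4, sq (∑ m, z j m), Finset.sum_mul_sum, ← Finset.sum_sub_distrib]
    refine Finset.sum_congr rfl fun m _ => ?_
    simp only [e5, Finset.sum_sub_distrib, Finset.sum_ite_eq, Finset.mem_univ, if_true]
  rw [e1, Finset.mul_sum, Finset.sum_congr rfl fun j _ => e2 j, Finset.sum_sub_distrib,
    Finset.sum_comm]

end Algebra

/-- Variable `m` enters a factor indexed by `j < k` with opposite signs as `k` and as `j`. This
sorts the logarithmic derivative of a product over pairs by the partner of `m`; it serves both the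
generating function and the ground state. -/
lemma sum_filter_lt {R : Type*} [CommRing R] (m : Fin N) (f : Fin N × Fin N → R) :
    ∑ p : Fin N × Fin N with p.1 < p.2,
      ((if m = p.2 then 1 else 0) - (if m = p.1 then 1 else 0)) * f p =
    ∑ l, (if l < m then f (l, m) else 0) - ∑ l, (if m < l then f (m, l) else 0) := by
  rw [Finset.sum_filter, Fintype.sum_prod_type]
  have e : ∀ j k : Fin N, (if (j, k).1 < (j, k).2 then
      ((if m = (j, k).2 then 1 else 0) - (if m = (j, k).1 then 1 else 0)) * f (j, k) else 0) =
      (if m = k then (if j < m then f (j, m) else 0) else 0) -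
        (if m = j then (if m < k then f (m, k) else 0) else 0) := by
    intro j k
    by_cases h1 : m = k
    · subst h1
      by_cases h2 : m = j
      · subst h2; simp
      · simp [h2]
    · by_cases h2 : m = j
      · subst h2; simp only [h1, if_true, if_false]; split_ifs <;> simp
      · simp [h1, h2]
  simp only [e, Finset.sum_sub_distrib, Finset.sum_ite_eq, Finset.mem_univ, if_true]
  congr 1
  rw [Finset.sum_comm]
  simp

/-- The inverse variable `1 / y_k`. -/
def eta (k : Fin N) : Series N := mon (Pi.single k 1)

/-- The ratio `y_j / y_k`, for `j < k`. -/
def rat (j k : Fin N) : Series N := mon (Pi.single k 1 - Pi.single j 1)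

/-- The position `x_j`. -/
def xC (j : Fin N) : Series N := MvPowerSeries.C (MvPolynomial.X j)

lemma cone_sub {j k : Fin N} (h : j < k) :
    Cone (Pi.single k (1 : ℤ) - Pi.single j (1 : ℤ) : IntVec N) := fun l => by
  rw [tail_sub, tail_single, tail_single]
  by_cases h1 : l ≤ j
  · simp [h1, h1.trans h.le]
  · rw [if_neg h1]; split_ifs <;> simp

lemma sub_single_ne_zero {j k : Fin N} (h : j < k) :
    (Pi.single k (1 : ℤ) - Pi.single j (1 : ℤ) : IntVec N) ≠ 0 := by
  intro h0
  have := congrFun h0 k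
  simp [h.ne'] at this

lemma single_ne_zero' (k : Fin N) : (Pi.single k (1 : ℤ) : IntVec N) ≠ 0 := by
  simp

lemma constantCoeff_mon {m : IntVec N} (hm : Cone m) (h0 : m ≠ 0) :
    MvPowerSeries.constantCoeff (mon m) = 0 := by
  rw [← MvPowerSeries.coeff_zero_eq_constantCoeff_apply, mon, MvPowerSeries.coeff_monomial, if_neg]
  exact fun h => tailExp_ne_zero hm h0 h.symm

lemma constantCoeff_rat {j k : Fin N} (h : j < k) : MvPowerSeries.constantCoeff (rat j k) = 0 :=
  constantCoeff_mon (cone_sub h) (sub_single_ne_zero h)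

lemma constantCoeff_xC_mul_eta (j k : Fin N) :
    MvPowerSeries.constantCoeff (xC j * eta k) = 0 := by
  rw [map_mul, eta, constantCoeff_mon (cone_single k) (single_ne_zero' k), mul_zero]

lemma rat_mul_eta {j k : Fin N} (h : j < k) : rat j k * eta j = eta k := by
  rw [rat, eta, eta, ← mon_add (cone_sub h) (cone_single j)]
  simp

lemma eta_ne_zero (k : Fin N) : eta k ≠ 0 := mon_ne_zero _

lemma eta_injective : Function.Injective (eta (N := N)) := fun j k h => by
  have := mon_injective (cone_single j) (cone_single k) h
  have := congrFun this j
  by_contra hne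
  simp [hne] at this

lemma yder_eta (m k : Fin N) : yder m (eta k) = if m = k then eta k else 0 := by
  rw [eta, yder_mon m (cone_single k)]
  rcases eq_or_ne m k with h | h <;> simp [h]

lemma xder_eta (j k : Fin N) : xder j (eta k) = 0 := xder_mon j _ (cone_single k)

lemma yder_rat (m : Fin N) {j k : Fin N} (h : j < k) :
    yder m (rat j k) = ((if m = k then 1 else 0) - (if m = j then 1 else 0)) * rat j k := by
  rw [rat, yder_mon m (cone_sub h)]
  simp [Pi.single_apply]

lemma xder_rat (i : Fin N) {j k : Fin N} (h : j < k) : xder i (rat j k) = 0 :=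
  xder_mon i _ (cone_sub h)

lemma yder_xC (m j : Fin N) : yder m (xC j) = 0 := yder_C _ _

lemma xder_xC (i j : Fin N) : xder i (xC j) = if i = j then 1 else 0 := by
  rw [xC, xder_C, MvPolynomial.pderiv_X]
  rcases eq_or_ne i j with h | h
  · simp [h]
  · simp [h]

/-- The series `1 / (y_k - x_j)`. -/
def zz (j k : Fin N) : Series N := eta k * inv1 (xC j * eta k)

/-- The series `1 / (y_k - y_j)` for `j < k`. -/
def qq (j k : Fin N) : Series N := eta k * inv1 (rat j k)

/-- The series `1 / (y_k - y_l)`, with value `0` for `k = l`. -/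
def QQ (k l : Fin N) : Series N := if l < k then qq l k else if k < l then -qq k l else 0

/-- This relation and its analogue `QQ_mul` characterise the series, since the ring is a domain.
Every rational identity below is proved by multiplying with the nonzero denominators and combining
these relations linearly. -/
lemma zz_mul (j k : Fin N) : zz j k * (1 - xC j * eta k) = eta k := by
  rw [zz, mul_assoc, mul_comm (inv1 _), one_sub_mul_inv1 (constantCoeff_xC_mul_eta j k), mul_one]

lemma QQ_self (k : Fin N) : QQ k k = 0 := by simp [QQ]

lemma QQ_antisymm (k l : Fin N) : QQ l k = -QQ k l := by
  rcases lt_trichotomy k l with h | h | h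
  · simp [QQ, h, h.not_gt]
  · simp [QQ, h]
  · simp [QQ, h, h.not_gt]

lemma qq_mul {j k : Fin N} (h : j < k) : qq j k * (eta j - eta k) = eta j * eta k := by
  have h1 := one_sub_mul_inv1 (constantCoeff_rat h)
  have h2 := rat_mul_eta h
  rw [qq]
  linear_combination eta j * eta k * h1 + eta k * inv1 (rat j k) * h2

lemma QQ_mul {k l : Fin N} (h : k ≠ l) : QQ k l * (eta l - eta k) = eta k * eta l := by
  rcases lt_or_gt_of_ne h with h1 | h1
  · rw [QQ, if_neg h1.not_gt, if_pos h1]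
    linear_combination qq_mul h1
  · rw [QQ, if_pos h1]
    linear_combination qq_mul h1

instance : CharZero (Series N) :=
  charZero_of_injective_algebraMap (FaithfulSMul.algebraMap_injective ℝ (Series N))

lemma eta_sub_ne_zero {k l : Fin N} (h : k ≠ l) : eta l - eta k ≠ 0 :=
  sub_ne_zero.2 fun h' => h (eta_injective h').symm

lemma one_sub_xC_mul_eta_ne_zero (j k : Fin N) : 1 - xC j * eta k ≠ 0 := by
  intro h
  have := zz_mul j k
  rw [h, mul_zero] at this
  exact eta_ne_zero k this.symm

/-- The partial fraction identity behind the absence of three-body terms: the products of reciprocal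
differences at the three vertices of a triangle sum to zero. -/
lemma QQ_cyclic (k l m : Fin N) (h1 : k ≠ l) (h2 : l ≠ m) (h3 : m ≠ k) :
    QQ k l * QQ k m + QQ l m * QQ l k + QQ m k * QQ m l = 0 := by
  have e1 := QQ_mul h1
  have e2 := QQ_mul h2
  have e3 := QQ_mul h3
  rw [QQ_antisymm m k, QQ_antisymm k l, QQ_antisymm l m]
  have n1 := eta_sub_ne_zero h1
  have n2 := eta_sub_ne_zero h2
  have n3 := eta_sub_ne_zero h3
  refine (mul_eq_zero.1 (?_ : ((eta l - eta k) * (eta m - eta l) * (eta k - eta m)) * _ = 0)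
    ).resolve_left (mul_ne_zero (mul_ne_zero n1 n2) n3)
  generalize QQ k l = a at *
  generalize QQ l m = b at *
  generalize QQ m k = c at *
  linear_combination (-(eta m - eta l) * (eta k - eta m) * c - (eta m - eta l) * (eta k - eta m) * b) * e1
    + (-(eta k - eta m) * c * (eta l - eta k)  - (eta k - eta m) * (eta k * eta l)) * e2 +
     (- (eta m - eta l) * (eta k * eta l) - (eta l - eta k) * (eta l * eta m) ) * e3

lemma QQ_mul_zz_sub (j k l : Fin N) (h : k ≠ l) :
    QQ k l * (zz j k - zz j l) = -(zz j k * zz j l) := by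
  have e1 := QQ_mul h
  have e2 := zz_mul j k
  have e3 := zz_mul j l
  have n1 := eta_sub_ne_zero h
  have n2 := one_sub_xC_mul_eta_ne_zero j k
  have n3 := one_sub_xC_mul_eta_ne_zero j l
  rw [← add_eq_zero_iff_eq_neg]
  refine (mul_eq_zero.1 (?_ : ((eta l - eta k) * ((1 - xC j * eta k) * (1 - xC j * eta l))) * _ = 0)
    ).resolve_left (mul_ne_zero n1 (mul_ne_zero n2 n3))
  generalize QQ k l = a at *
  generalize zz j k = b at *
  generalize zz j l = c at *
  linear_combination ((1 - xC j * eta k) * (1 - xC j * eta l) * (b - c)) * e1 +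
    (eta k * eta l * (1 - xC j * eta l) + (eta l - eta k) * (1 - xC j * eta l) * c) * e2 +
    (- eta k * eta l * (1 - xC j * eta k) + (eta l - eta k) * eta k) * e3

lemma zz_sub_zz (i j k : Fin N) : zz i k - zz j k = (xC i - xC j) * (zz i k * zz j k) := by
  have e2 := zz_mul i k
  have e3 := zz_mul j k
  have n2 := one_sub_xC_mul_eta_ne_zero i k
  have n3 := one_sub_xC_mul_eta_ne_zero j k
  refine mul_left_cancel₀ (mul_ne_zero n2 n3) ?_
  generalize zz i k = b at *
  generalize zz j k = c at *
  linear_combination ((1 - xC j * eta k) - (xC i - xC j) * c * (1 - xC j * eta k)) * e2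
    + (-(1 - xC i * eta k) - (xC i - xC j) * eta k) * e3

/-- The operator `eta k * yder k` is `-∂/∂y_k`. Differentiating the relation `zz_mul` and cancelling
the denominator avoids differentiating `inv1`. -/
lemma eta_mul_yder_zz (j k : Fin N) : eta k * yder k (zz j k) = zz j k ^ 2 := by
  have e2 := zz_mul j k
  have n2 := one_sub_xC_mul_eta_ne_zero j k
  have e3 := congrArg (yder k) e2
  simp only [Derivation.leibniz, smul_eq_mul, map_sub, Derivation.map_one_eq_zero, yder_xC,
    yder_eta, if_true] at e3
  refine mul_left_cancel₀ n2 ?_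
  linear_combination eta k * e3 - (zz j k + eta k) * e2

lemma xder_zz (i j k : Fin N) : xder i (zz j k) = if i = j then zz j k ^ 2 else 0 := by
  have e2 := zz_mul j k
  have n2 := one_sub_xC_mul_eta_ne_zero j k
  have e3 := congrArg (xder i) e2
  simp only [Derivation.leibniz, smul_eq_mul, map_sub, Derivation.map_one_eq_zero, xder_xC,
    xder_eta] at e3
  refine mul_left_cancel₀ n2 ?_
  split_ifs at e3 ⊢ with h
  · linear_combination e3 - zz j k * e2
  · linear_combination e3

lemma eta_mul_yder_QQ (k l : Fin N) : eta k * yder k (QQ k l) = QQ k l ^ 2 := by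
  rcases eq_or_ne k l with h | h
  · rw [h, QQ_self]; simp
  have e2 := QQ_mul h
  have n2 := eta_sub_ne_zero h
  have e3 := congrArg (yder k) e2
  simp only [Derivation.leibniz, smul_eq_mul, map_sub, yder_eta, if_true, if_neg h] at e3
  refine mul_left_cancel₀ n2 ?_
  linear_combination eta k * e3 + (-QQ k l - eta k) * e2

lemma derivation_prod_eq {ι : Type*} (D : Derivation ℝ (Series N) (Series N)) (s : Finset ι)
    (G L : ι → Series N) (h : ∀ i ∈ s, D (G i) = G i * L i) :
    D (∏ i ∈ s, G i) = (∏ i ∈ s, G i) * ∑ i ∈ s, L i := by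
  classical
  induction s using Finset.induction_on with
  | empty => simp
  | insert a s ha ih =>
    rw [Finset.prod_insert ha, Finset.sum_insert ha, Derivation.leibniz,
      ih fun i hi => h i (Finset.mem_insert_of_mem hi), h a (Finset.mem_insert_self a s),
      smul_eq_mul, smul_eq_mul]
    ring

/-- The factor `∏_{j<k} (1 - y_j / y_k)^κ` of the generating function. -/
def raising (κ : ℝ) (N : ℕ) : Series N :=
  ∏ p : Fin N × Fin N with p.1 < p.2, pw κ (rat p.1 p.2)

/-- The factor `∏_{j,k} (1 - x_j / y_k)^{-κ}` of the generating function. -/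
def cauchy (κ : ℝ) (N : ℕ) : Series N := ∏ k : Fin N, ∏ j : Fin N, pw (-κ) (xC j * eta k)

/-- The generating function as a formal series. -/
def kernel (κ : ℝ) (N : ℕ) : Series N := raising κ N * cauchy κ N

/-- The scalar `κ` as a series. -/
abbrev cst (κ : ℝ) : Series N := algebraMap ℝ (Series N) κ

lemma derivation_raising (κ : ℝ) (D : Derivation ℝ (Series N) (Series N)) :
    D (raising κ N) = raising κ N *
      ∑ p : Fin N × Fin N with p.1 < p.2, -(cst κ * (D (rat p.1 p.2) * inv1 (rat p.1 p.2))) := by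
  refine derivation_prod_eq D _ _ _ fun p hp => ?_
  rw [derivation_pw (constantCoeff_rat (Finset.mem_filter.1 hp).2), Algebra.smul_def, map_neg,
    neg_mul]

lemma derivation_cauchy (κ : ℝ) (D : Derivation ℝ (Series N) (Series N)) :
    D (cauchy κ N) = cauchy κ N *
      ∑ k, ∑ j, cst κ * (D (xC j * eta k) * inv1 (xC j * eta k)) := by
  refine derivation_prod_eq D _ _ _ fun k _ => ?_
  refine derivation_prod_eq D _ _ _ fun j _ => ?_
  rw [derivation_pw (constantCoeff_xC_mul_eta j k), Algebra.smul_def, neg_neg]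

lemma xder_kernel (κ : ℝ) (i : Fin N) :
    xder i (kernel κ N) = kernel κ N * (cst κ * ∑ k, zz i k) := by
  have h1 : xder i (raising κ N) = 0 := by
    rw [derivation_raising, Finset.sum_eq_zero, mul_zero]
    intro p hp
    rw [xder_rat i (Finset.mem_filter.1 hp).2]
    simp
  have h2 : ∀ k j, cst κ * (xder i (xC j * eta k) * inv1 (xC j * eta k)) =
      if i = j then cst κ * zz j k else 0 := by
    intro k j
    rw [Derivation.leibniz, xder_xC, xder_eta]
    split_ifs
    · simp [zz]
    · simp
  rw [kernel, Derivation.leibniz, h1, derivation_cauchy]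
  simp only [h2, Finset.sum_ite_eq, Finset.mem_univ, if_true, smul_eq_mul, Finset.mul_sum]
  rw [mul_zero, add_zero]
  refine Finset.sum_congr rfl fun k _ => by ring

lemma yder_cauchy (κ : ℝ) (m : Fin N) : yder m (cauchy κ N) =
    cauchy κ N * (cst κ * ∑ j, xC j * eta m * inv1 (xC j * eta m)) := by
  have h : ∀ k j, cst κ * (yder m (xC j * eta k) * inv1 (xC j * eta k)) =
      if m = k then cst κ * (xC j * eta k * inv1 (xC j * eta k)) else 0 := by
    intro k j
    rw [Derivation.leibniz, yder_xC, yder_eta]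
    split_ifs
    · simp
    · simp
  rw [derivation_cauchy, Finset.sum_comm]
  simp only [h, Finset.sum_ite_eq, Finset.mem_univ, if_true, Finset.mul_sum]

lemma yder_kernel (κ : ℝ) (m : Fin N) :
    yder m (kernel κ N) = kernel κ N * (cst κ *
      (∑ j, xC j * eta m * inv1 (xC j * eta m) -
        (∑ l, (if l < m then rat l m * inv1 (rat l m) else 0) -
          ∑ l, (if m < l then rat m l * inv1 (rat m l) else 0)))) := by
  have h1 : yder m (raising κ N) = raising κ N * -(cst κ *
      (∑ l, (if l < m then rat l m * inv1 (rat l m) else 0) -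
          ∑ l, (if m < l then rat m l * inv1 (rat m l) else 0))) := by
    have hs : ∀ p ∈ Finset.univ.filter (fun p : Fin N × Fin N => p.1 < p.2),
        -(cst κ * (yder m (rat p.1 p.2) * inv1 (rat p.1 p.2))) =
        -cst κ * (((if m = p.2 then 1 else 0) - (if m = p.1 then 1 else 0)) *
          (rat p.1 p.2 * inv1 (rat p.1 p.2))) := by
      intro p hp
      rw [yder_rat m (Finset.mem_filter.1 hp).2]
      ring
    rw [derivation_raising, Finset.sum_congr rfl hs, ← Finset.mul_sum,
      sum_filter_lt m fun p => rat p.1 p.2 * inv1 (rat p.1 p.2), neg_mul]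
  rw [kernel, Derivation.leibniz, h1, yder_cauchy, smul_eq_mul, smul_eq_mul]
  ring

/-- The operator `-∂ / ∂y_m` conjugated by a power of `y_m`. -/
def Dp (κ : ℝ) (m : Fin N) (φ : Series N) : Series N :=
  eta m * yder m φ + cst κ * ((N : Series N) - ((m : ℕ) : Series N)) * eta m * φ

/-- Up to the factor `∏ y_m^{κ(N-m)}`, with `m` counted from zero, the kernel is `∏ (y_k - y_j)^κ /
∏ (y_k - x_j)^κ`. The conjugation in `Dp` removes exactly that factor, so only the simple poles
remain. -/
lemma Dp_kernel (κ : ℝ) (m : Fin N) :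
    Dp κ m (kernel κ N) = kernel κ N * (cst κ * (∑ j, zz j m - ∑ l, QQ m l)) := by
  have hz : ∀ j, eta m * (xC j * eta m * inv1 (xC j * eta m)) = zz j m - eta m := by
    intro j
    have := one_sub_mul_inv1 (constantCoeff_xC_mul_eta j m)
    rw [zz]
    linear_combination -eta m * this
  have hq : ∀ l, QQ m l = (if l < m then eta m * (rat l m * inv1 (rat l m)) else 0) -
      (if m < l then eta m * (rat m l * inv1 (rat m l)) else 0) + if l < m then eta m else 0 := by
    intro l
    rw [QQ]
    by_cases h : l < m
    · have := one_sub_mul_inv1 (constantCoeff_rat h)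
      simp only [h, h.not_gt, if_true, if_false, qq]
      linear_combination eta m * this
    · by_cases h' : m < l
      · have := rat_mul_eta h'
        simp only [h, h', if_true, if_false, qq]
        linear_combination inv1 (rat m l) * this
      · simp [h, h']
  -- Passing from `rat * inv1` to `inv1` costs one `eta m` for each `l < m`, hence `m` of them,
  -- against `N` from the factors with `x_j`; the difference `N - m` is the shift in `Dp`.
  have hc : ∑ l : Fin N, (if l < m then eta m else 0) = ((m : ℕ) : Series N) * eta m := by
    rw [← Finset.sum_filter, Finset.sum_const, nsmul_eq_mul]
    congr 2
    rw [Finset.filter_gt_eq_Iio, Fin.card_Iio]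
  rw [Finset.sum_congr rfl fun l _ => hq l, Finset.sum_add_distrib, hc, Finset.sum_sub_distrib]
  have hz' : eta m * ∑ j, xC j * eta m * inv1 (xC j * eta m) = ∑ j, zz j m - N * eta m := by
    rw [Finset.mul_sum, Finset.sum_congr rfl fun j _ => hz j]
    simp
  have hr1 : ∑ l, (if l < m then eta m * (rat l m * inv1 (rat l m)) else 0) =
      eta m * ∑ l, (if l < m then rat l m * inv1 (rat l m) else 0) := by
    rw [Finset.mul_sum]; simp
  have hr2 : ∑ l, (if m < l then eta m * (rat m l * inv1 (rat m l)) else 0) =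
      eta m * ∑ l, (if m < l then rat m l * inv1 (rat m l) else 0) := by
    rw [Finset.mul_sum]; simp
  rw [hr1, hr2, Dp, yder_kernel]
  linear_combination kernel κ N * cst κ * hz'

lemma Dp_mul (κ : ℝ) (m : Fin N) (φ ψ : Series N) :
    Dp κ m (φ * ψ) = Dp κ m φ * ψ + φ * (eta m * yder m ψ) := by
  rw [Dp, Dp, Derivation.leibniz, smul_eq_mul, smul_eq_mul]
  ring

/-- The kernel function identity. -/
theorem kernel_identity (κ : ℝ) :
    ∑ j, xder j (xder j (kernel κ N)) +
      cst κ * ∑ i, ∑ j, (if i = j then 0 else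
        kernel κ N * (cst κ * ∑ k, zz i k * zz j k)) =
    ∑ m, Dp κ m (Dp κ m (kernel κ N)) -
      cst κ * (cst κ - 1) * ∑ k, ∑ l, QQ k l ^ 2 * kernel κ N := by
  set F := kernel κ N
  set c : Series N := cst κ with hc
  have hDc : ∀ D : Derivation ℝ (Series N) (Series N), D c = 0 := fun D => D.map_algebraMap κ
  have a1 : ∀ j, xder j (xder j F) =
      F * (c ^ 2 * (∑ k, zz j k) ^ 2 + c * ∑ k, zz j k ^ 2) := by
    intro j
    rw [xder_kernel, Derivation.leibniz, Derivation.leibniz, hDc, xder_kernel, map_sum,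
      Finset.sum_congr rfl fun k _ => xder_zz j j k]
    simp only [if_true, smul_eq_mul]
    ring
  have a2 : ∑ i, ∑ j, (if i = j then 0 else F * (c * ∑ k, zz i k * zz j k)) =
      F * c * (∑ k, (∑ i, zz i k) ^ 2 - ∑ k, ∑ i, zz i k ^ 2) := by
    have e1 : ∀ i j : Fin N, (if i = j then 0 else F * (c * ∑ k, zz i k * zz j k)) =
        F * c * ∑ k, zz i k * zz j k - (if i = j then F * c * ∑ k, zz i k * zz j k else 0) := by
      intro i j; split_ifs <;> ring
    simp only [e1, Finset.sum_sub_distrib, Finset.sum_ite_eq, Finset.mem_univ, if_true]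
    simp only [← Finset.mul_sum, ← sq]
    have e2 : ∑ i : Fin N, ∑ j, ∑ k, zz i k * zz j k = ∑ k, (∑ i, zz i k) ^ 2 := by
      simp only [sq, Finset.sum_mul_sum]
      calc ∑ i, ∑ j, ∑ k, zz i k * zz j k = ∑ i, ∑ k, ∑ j, zz i k * zz j k :=
            Finset.sum_congr rfl fun i _ => Finset.sum_comm
        _ = _ := Finset.sum_comm
    rw [e2, Finset.sum_comm (f := fun i k => zz i k ^ 2)]
    ring
  have a3 : ∀ m, Dp κ m (Dp κ m F) = F * (c ^ 2 * (∑ j, zz j m - ∑ l, QQ m l) ^ 2 +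
      c * (∑ j, zz j m ^ 2 - ∑ l, QQ m l ^ 2)) := by
    intro m
    have e1 : eta m * yder m (∑ j, zz j m - ∑ l, QQ m l) = ∑ j, zz j m ^ 2 - ∑ l, QQ m l ^ 2 := by
      rw [map_sub, map_sum, map_sum, mul_sub, Finset.mul_sum, Finset.mul_sum]
      simp only [eta_mul_yder_zz, eta_mul_yder_QQ]
    rw [Dp_kernel, Dp_mul, Dp_kernel, Derivation.leibniz, hDc]
    simp only [smul_eq_mul]
    linear_combination F * c * e1
  -- After removal of the three-body terms, the squares of `QQ` carry the factor `c ^ 2 - c`, which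
  -- the interaction term cancels. The mixed terms supply the squares of `zz` and of their sums over
  -- `k` that the left side has.
  have b1 := sum_sq_sum_eq (QQ (N := N)) QQ_self QQ_cyclic
  have b2 := two_mul_sum_mul_sum_eq (QQ (N := N)) zz QQ_antisymm QQ_mul_zz_sub
  have a4 : ∑ m, Dp κ m (Dp κ m F) = F * (c ^ 2 * (∑ m, (∑ j, zz j m) ^ 2 -
      (2 * ∑ m, (∑ j, zz j m) * ∑ l, QQ m l) + ∑ m, (∑ l, QQ m l) ^ 2) +
      c * (∑ m, ∑ j, zz j m ^ 2 - ∑ m, ∑ l, QQ m l ^ 2)) := by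
    rw [Finset.sum_congr rfl fun m _ => a3 m]
    calc ∑ m, F * (c ^ 2 * (∑ j, zz j m - ∑ l, QQ m l) ^ 2 +
          c * (∑ j, zz j m ^ 2 - ∑ l, QQ m l ^ 2)) =
        ∑ m, (F * c ^ 2 * (∑ j, zz j m) ^ 2 - F * c ^ 2 * 2 * ((∑ j, zz j m) * ∑ l, QQ m l) +
          F * c ^ 2 * (∑ l, QQ m l) ^ 2 + F * c * ∑ j, zz j m ^ 2 - F * c * ∑ l, QQ m l ^ 2) :=
          Finset.sum_congr rfl fun m _ => by ring
      _ = _ := by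
        rw [Finset.sum_sub_distrib, Finset.sum_add_distrib, Finset.sum_add_distrib,
          Finset.sum_sub_distrib, ← Finset.mul_sum, ← Finset.mul_sum, ← Finset.mul_sum,
          ← Finset.mul_sum, ← Finset.mul_sum]
        ring
  rw [a4, a2, Finset.sum_congr rfl fun j _ => a1 j, b1, b2]
  have e1 : ∑ k : Fin N, ∑ l, QQ k l ^ 2 * F = (∑ k : Fin N, ∑ l, QQ k l ^ 2) * F := by
    rw [Finset.sum_mul]
    exact Finset.sum_congr rfl fun k _ => (Finset.sum_mul _ _ _).symm
  rw [e1, ← Finset.mul_sum, Finset.sum_add_distrib, ← Finset.mul_sum, ← Finset.mul_sum,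
    Finset.sum_comm (f := fun i k => zz i k ^ 2)]
  ring

end Calogero
end

/-! ### Coefficient comparison: the action on the `f_n`. -/

noncomputable section

namespace Calogero

variable {N : ℕ}

lemma cf_cst_mul (c : ℝ) (φ : Series N) (n : IntVec N) : cf (cst c * φ) n = c • cf φ n := by
  rw [cst, ← Algebra.smul_def, cf_smul]

lemma cf_eta_mul (m : Fin N) (φ : Series N) (n : IntVec N) :
    cf (eta m * φ) n = cf φ (n - Pi.single m 1) := cf_mon_mul (cone_single m) φ n

lemma cf_Dp (κ : ℝ) (m : Fin N) (φ : Series N) (n : IntVec N) :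
    cf (Dp κ m φ) n = ((n m : ℝ) - 1 + κ * ((N : ℝ) - (m : ℕ))) • cf φ (n - Pi.single m 1) := by
  have h : Dp κ m φ = eta m * (yder m φ + cst (κ * ((N : ℝ) - (m : ℕ))) * φ) := by
    rw [Dp, cst, cst]
    simp only [map_mul, map_sub, map_natCast]
    ring
  have h2 : ((n m - 1 : ℤ) : Coef N) = MvPolynomial.C ((n m : ℝ) - 1) := by simp
  rw [h, cf_eta_mul, cf_add, cf_cst_mul, cf_yder, add_smul]
  congr 1
  rw [Pi.sub_apply, Pi.single_eq_same, h2, MvPolynomial.C_mul']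

/-- The expansion of `1 / (1 - u) ^ 2` with an exact remainder divisible by `u ^ M`, so that
coefficients can be read off without infinite sums. -/
lemma inv1_sq_eq {u : Series N} (hu : MvPowerSeries.constantCoeff u = 0) (M : ℕ) :
    inv1 u ^ 2 = ∑ ν ∈ Finset.range M, cst ((ν : ℝ) + 1) * u ^ ν +
      u ^ M * ((M : Series N) * inv1 u + inv1 u ^ 2) := by
  have h := one_sub_mul_inv1 hu
  induction M with
  | zero => simp
  | succ M ih =>
    rw [Finset.sum_range_succ]
    have hc : (cst ((M : ℝ) + 1) : Series N) = M + 1 := by simp [cst]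
    rw [hc]
    rw [Nat.cast_add, Nat.cast_one]
    linear_combination ih + u ^ M * (M + 1 + inv1 u) * h

lemma stepVec_succ (j k : Fin N) (ν : ℕ) :
    stepVec j k (ν + 1) = Pi.single k 1 + Pi.single k 1 + ν • (Pi.single k 1 - Pi.single j 1) := by
  funext i
  rw [← natCast_zsmul]
  simp only [stepVec, Pi.add_apply, Pi.smul_apply, Pi.sub_apply, smul_eq_mul,
    Nat.cast_add, Nat.cast_one]
  ring

lemma mon_stepVec_succ {j k : Fin N} (h : j < k) (ν : ℕ) :
    mon (stepVec j k (ν + 1)) = eta k ^ 2 * rat j k ^ ν := by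
  rw [stepVec_succ, mon_add ((cone_single k).add (cone_single k)) ((cone_sub h).nsmul ν),
    mon_add (cone_single k) (cone_single k), mon_nsmul (cone_sub h), eta, rat, sq]

lemma tail_stepVec {j k : Fin N} (h : j ≤ k) (ν : ℕ) (l : Fin N) :
    tail (stepVec j k ν) l = if l ≤ j then 2 else if l ≤ k then 1 + (ν : ℤ) else 0 := by
  rw [stepVec, tail_add, tail_smul, tail_smul, tail_single, tail_single]
  by_cases h1 : l ≤ j
  · simp only [h1, h1.trans h, if_true]; ring
  · simp [h1]

lemma cone_stepVec {j k : Fin N} (h : j ≤ k) (ν : ℕ) : Cone (stepVec j k ν) := fun l => by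
  rw [tail_stepVec h]; split_ifs <;> positivity

/-- The expansion is `(y_k - y_j)⁻² = ∑ ν y^{-E^ν}`, with vanishing term at `ν = 0`. The remainder
starts at `E^{M+1}`, whose tail sum at `k` is `M + 2` and thus exceeds that of `n`, so it does not
contribute. -/
lemma cf_qq_sq_mul {j k : Fin N} (h : j < k) (φ : Series N) (n : IntVec N) (M : ℕ)
    (hM : tail n k ≤ M) :
    cf (qq j k ^ 2 * φ) n =
      ∑ ν ∈ Finset.range (M + 1), (ν : ℝ) • cf φ (n - stepVec j k ν) := by
  have e : qq j k ^ 2 * φ =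
      ∑ ν ∈ Finset.range M, cst ((ν : ℝ) + 1) * (mon (stepVec j k (ν + 1)) * φ) +
      mon (stepVec j k (M + 1)) *
        (((M : Series N) * inv1 (rat j k) + inv1 (rat j k) ^ 2) * φ) := by
    have e1 : ∑ ν ∈ Finset.range M, cst ((ν : ℝ) + 1) * (mon (stepVec j k (ν + 1)) * φ) =
        (∑ ν ∈ Finset.range M, cst ((ν : ℝ) + 1) * rat j k ^ ν) * (eta k ^ 2 * φ) := by
      rw [Finset.sum_mul]
      refine Finset.sum_congr rfl fun ν _ => ?_
      rw [mon_stepVec_succ h]; ring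
    rw [e1, mon_stepVec_succ h, qq]
    linear_combination eta k ^ 2 * φ * inv1_sq_eq (constantCoeff_rat h) M
  rw [e, cf_add, cf_sum, cf_mon_mul (cone_stepVec h.le _), cf_of_not_cone (n := n - _), add_zero,
    Finset.sum_range_succ' (n := M)]
  · simp only [cf_cst_mul, cf_mon_mul (cone_stepVec h.le _)]
    simp
  · intro hc
    have := hc k
    rw [tail_sub, tail_stepVec h.le, if_neg h.not_ge, if_pos le_rfl] at this
    push_cast at this
    linarith

lemma sum_pairs_le {A : Type*} [AddCommMonoid A] (f : Fin N → Fin N → A) :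
    ∑ p : {p : Fin N × Fin N // p.1 ≤ p.2}, f p.1.1 p.1.2 =
      ∑ j, f j j + ∑ p : Fin N × Fin N with p.1 < p.2, f p.1 p.2 := by
  rw [← Finset.sum_subtype (Finset.univ.filter fun p : Fin N × Fin N => p.1 ≤ p.2) (by simp)
    (fun p => f p.1 p.2), Finset.sum_filter, Finset.sum_filter, Fintype.sum_prod_type,
    Fintype.sum_prod_type, ← Finset.sum_add_distrib]
  refine Finset.sum_congr rfl fun j _ => ?_
  have : f j j = ∑ k, if j = k then f j k else 0 := by simp
  rw [this, ← Finset.sum_add_distrib]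
  refine Finset.sum_congr rfl fun k _ => ?_
  rcases lt_trichotomy j k with h | h | h
  · simp [h.le, h, h.ne]
  · simp [h]
  · simp [h.not_ge, h.not_gt, h.ne']

lemma sum_QQ_sq : ∑ k : Fin N, ∑ l, QQ k l ^ 2 =
    2 * ∑ p : Fin N × Fin N with p.1 < p.2, qq p.1 p.2 ^ 2 := by
  rw [Finset.sum_filter, Fintype.sum_prod_type, two_mul]
  conv_rhs => arg 2; rw [Finset.sum_comm]
  rw [← Finset.sum_add_distrib]
  refine Finset.sum_congr rfl fun k _ => ?_
  rw [← Finset.sum_add_distrib]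
  refine Finset.sum_congr rfl fun l _ => ?_
  rw [QQ]
  rcases lt_trichotomy k l with h | h | h
  · simp [h, h.not_gt]
  · simp [h]
  · simp [h, h.not_gt]

/-- The coefficient of `y^{-n}` in the expansion of the generating function. -/
def fcoef (κ : ℝ) (n : IntVec N) : Coef N := cf (kernel κ N) n

/-- The divided difference `(∂_i f_n - ∂_j f_n) / (x_i - x_j)`. -/
def wcoef (κ : ℝ) (i j : Fin N) (n : IntVec N) : Coef N :=
  cf (kernel κ N * (cst κ * ∑ k, zz i k * zz j k)) n

/-- Both derivatives multiply the kernel by sums of simple poles, and `1/(y - x_i) - 1/(y - x_j)`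
has the explicit factor `x_i - x_j`. Hence the difference quotient is polynomial, with a known
generating function. -/
lemma pderiv_sub_pderiv_fcoef (κ : ℝ) (i j : Fin N) (n : IntVec N) :
    MvPolynomial.pderiv i (fcoef κ n) - MvPolynomial.pderiv j (fcoef κ n) =
      (MvPolynomial.X i - MvPolynomial.X j) * wcoef κ i j n := by
  have hC : MvPowerSeries.C (MvPolynomial.X i - MvPolynomial.X j) = xC i - xC j := by
    rw [map_sub]; rfl
  rw [fcoef, wcoef, ← cf_xder, ← cf_xder, ← cf_sub, xder_kernel, xder_kernel, ← cf_C_mul, hC]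
  congr 1
  have : ∑ k, zz i k - ∑ k, zz j k = (xC i - xC j) * ∑ k, zz i k * zz j k := by
    rw [Finset.mul_sum, ← Finset.sum_sub_distrib]
    exact Finset.sum_congr rfl fun k _ => zz_sub_zz i j k
  linear_combination kernel κ N * cst κ * this

/-- The action of the reduced Calogero operator on the coefficients of the generating function. -/
theorem laplace_fcoef (κ : ℝ) (n : IntVec N) (M : ℕ) (hM : ∀ l, tail n l ≤ M) :
    ∑ j, MvPolynomial.pderiv j (MvPolynomial.pderiv j (fcoef κ n)) +
      κ • ∑ i, ∑ j, (if i = j then 0 else wcoef κ i j n) =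
    -∑ p : {p : Fin N × Fin N // p.1 ≤ p.2}, ∑ ν ∈ Finset.range (M + 1),
      Step.coeff κ (p, ν) (n - Step.vec (p, ν)) • fcoef κ (n - Step.vec (p, ν)) := by
  have h := congrArg (fun φ => cf φ n) (kernel_identity (N := N) κ)
  simp only [cf_add, cf_sum, cf_sub, cf_xder, cf_cst_mul, cf_Dp] at h
  have hL : ∀ i j : Fin N, cf (if i = j then 0 else kernel κ N * (cst κ * ∑ k, zz i k * zz j k)) n =
      if i = j then 0 else wcoef κ i j n := by
    intro i j; split_ifs
    · exact cf_zero n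
    · rfl
  simp only [hL] at h
  have hR := sum_pairs_le (fun j k => ∑ ν ∈ Finset.range (M + 1),
      g κ j k ν (n - stepVec j k ν) • fcoef κ (n - stepVec j k ν))
  simp only [Step.coeff, Step.vec]
  rw [fcoef, h, hR]
  -- For `j = k` only `ν = 0` survives, and `E^0_{jj} = 2 e_j`: these are the two shifts in `D_j²`,
  -- whose factors become `m_j^+ + 1` and `m_j^+` at `m = n - 2 e_j`.
  have hd : ∀ j : Fin N, ∑ ν ∈ Finset.range (M + 1),
      g κ j j ν (n - stepVec j j ν) • fcoef κ (n - stepVec j j ν) =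
      -(((n j : ℝ) - 1 + κ * (N - (j : ℕ))) • (((n - Pi.single j 1 : IntVec N) j : ℝ) - 1 +
        κ * (N - (j : ℕ))) • cf (kernel κ N) (n - Pi.single j 1 - Pi.single j 1)) := by
    intro j
    have hv : stepVec j j 0 = Pi.single j 1 + Pi.single j 1 := by
      simp [stepVec]
    rw [Finset.sum_eq_single_of_mem 0 (by simp), hv, fcoef, sub_sub, smul_smul, ← neg_smul]
    · congr 1
      simp [g, shifted]
      ring
    · intro ν _ hν
      simp [g, hν]
  have ho : ∀ p ∈ (Finset.univ.filter fun p : Fin N × Fin N => p.1 < p.2),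
      ∑ ν ∈ Finset.range (M + 1),
      g κ p.1 p.2 ν (n - stepVec p.1 p.2 ν) • fcoef κ (n - stepVec p.1 p.2 ν) =
      (2 * κ * (κ - 1)) • cf (qq p.1 p.2 ^ 2 * kernel κ N) n := by
    intro p hp
    have hp' := (Finset.mem_filter.1 hp).2
    rw [cf_qq_sq_mul hp' _ n M (hM _), Finset.smul_sum]
    refine Finset.sum_congr rfl fun ν _ => ?_
    rw [g, if_neg hp'.ne, smul_smul, fcoef]
    simp
  rw [Finset.sum_congr rfl fun j _ => hd j, Finset.sum_congr rfl ho, neg_add,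
    Finset.sum_neg_distrib, neg_neg, ← sub_eq_add_neg]
  congr 1
  have e : cst κ * (cst κ - 1) * ∑ k : Fin N, ∑ l, QQ k l ^ 2 * kernel κ N =
      cst (2 * κ * (κ - 1)) *
        ∑ p : Fin N × Fin N with p.1 < p.2, qq p.1 p.2 ^ 2 * kernel κ N := by
    have e1 : ∑ k : Fin N, ∑ l, QQ k l ^ 2 * kernel κ N =
        (∑ k : Fin N, ∑ l, QQ k l ^ 2) * kernel κ N := by
      rw [Finset.sum_mul]
      exact Finset.sum_congr rfl fun k _ => (Finset.sum_mul _ _ _).symm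
    rw [e1, sum_QQ_sq, ← Finset.sum_mul, cst, cst]
    simp only [map_mul, map_sub, map_one, map_ofNat]
    ring
  rw [e, cf_cst_mul, cf_sum, Finset.smul_sum]

/-- Homogeneity of the coefficients, in the form of the Euler equation. -/
theorem euler_fcoef (κ : ℝ) (n : IntVec N) :
    ∑ j, MvPolynomial.X j * MvPolynomial.pderiv j (fcoef κ n) = (weight n : ℝ) • fcoef κ n := by
  have h : ∑ j : Fin N, xC j * xder j (kernel κ N) = ∑ m, yder m (kernel κ N) := by
    -- The factor `∏ (1 - y_j/y_k)^κ` has degree zero in `y`, so its contributions to the total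
    -- degree cancel in pairs.
    have h2 : ∑ m : Fin N, (∑ l, (if l < m then rat l m * inv1 (rat l m) else 0) -
          ∑ l, (if m < l then rat m l * inv1 (rat m l) else 0)) = 0 := by
      rw [Finset.sum_sub_distrib, Finset.sum_comm, sub_self]
    simp only [yder_kernel, xder_kernel]
    rw [← Finset.mul_sum, ← Finset.mul_sum, Finset.sum_sub_distrib, h2, sub_zero,
      Finset.sum_comm]
    simp only [Finset.mul_sum]
    refine Finset.sum_congr rfl fun j _ => Finset.sum_congr rfl fun k _ => ?_
    rw [zz]; ring
  have h' := congrArg (fun φ => cf φ n) h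
  simp only [cf_sum, cf_yder, xC, cf_C_mul, cf_xder] at h'
  rw [fcoef, h', ← Finset.sum_mul, weight, ← MvPolynomial.C_mul']
  congr 1
  simp

lemma fcoef_of_not_cone (κ : ℝ) {n : IntVec N} (hn : ¬ Cone n) : fcoef κ n = 0 :=
  cf_of_not_cone hn _

end Calogero
end

/-! ### Convergence, uniqueness and symmetry of the expansion. -/

noncomputable section

namespace Calogero

variable {N : ℕ}

/-- The Laurent monomial `y^{-n}`. -/
def lmon (y : Fin N → ℂ) (n : IntVec N) : ℂ := ∏ k, y k ^ (-(n k))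

lemma lmon_add {y : Fin N → ℂ} (hy : ∀ k, y k ≠ 0) (m n : IntVec N) :
    lmon y (m + n) = lmon y m * lmon y n := by
  rw [lmon, lmon, lmon, ← Finset.prod_mul_distrib]
  refine Finset.prod_congr rfl fun k _ => ?_
  rw [← zpow_add₀ (hy k), Pi.add_apply, neg_add]

lemma lmon_nsmul {y : Fin N → ℂ} (hy : ∀ k, y k ≠ 0) (m : IntVec N) (i : ℕ) :
    lmon y (i • m) = lmon y m ^ i := by
  induction i with
  | zero => simp [lmon]
  | succ i ih => rw [succ_nsmul, lmon_add hy, ih, pow_succ]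

lemma lmon_single (y : Fin N → ℂ) (k : Fin N) : lmon y (Pi.single k 1) = (y k)⁻¹ := by
  rw [lmon, Finset.prod_eq_single_of_mem k (Finset.mem_univ k)]
  · simp
  · intro l _ h; simp [h]

lemma lmon_neg_single (y : Fin N → ℂ) (k : Fin N) : lmon y (-Pi.single k 1) = y k := by
  rw [lmon, Finset.prod_eq_single_of_mem k (Finset.mem_univ k)]
  · simp
  · intro l _ h; simp [h]

/-- The series `φ` converges to `v` at the given positions and values of the `y_k`. -/
def IsEval (x y : Fin N → ℂ) (φ : Series N) (v : ℂ) : Prop :=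
  HasSum (fun d => MvPolynomial.aeval x (MvPowerSeries.coeff d φ) * lmon y (ofExp d)) v

lemma hasSum_of_eq {ι : Type*} {f g : ι → ℂ} {v : ℂ} (h : ∀ i, f i = g i) (hg : HasSum g v) :
    HasSum f v := by
  rwa [funext h]

/-- In `ℂ` unconditional convergence is absolute, so Cauchy products converge to the product. -/
lemma hasSum_mul_antidiagonal {A : Type*} [AddCommMonoid A] [Finset.HasAntidiagonal A]
    {f g : A → ℂ} {v w : ℂ} (h1 : HasSum f v) (h2 : HasSum g w) :
    HasSum (fun n => ∑ p ∈ Finset.HasAntidiagonal.antidiagonal n, f p.1 * g p.2) (v * w) := by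
  have h12 := summable_mul_of_summable_norm h1.summable.norm h2.summable.norm
  have hs := (summable_sum_mul_antidiagonal_of_summable_mul h12).hasSum
  rwa [← h1.summable.tsum_mul_tsum_eq_tsum_sum_antidiagonal h2.summable h12, h1.tsum_eq,
    h2.tsum_eq] at hs

lemma IsEval.mul {x y : Fin N → ℂ} (hy : ∀ k, y k ≠ 0) {φ ψ : Series N} {v w : ℂ}
    (h1 : IsEval x y φ v) (h2 : IsEval x y ψ w) : IsEval x y (φ * ψ) (v * w) := by
  refine hasSum_of_eq (fun d => ?_) (hasSum_mul_antidiagonal h1 h2)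
  rw [MvPowerSeries.coeff_mul, map_sum, Finset.sum_mul]
  refine Finset.sum_congr rfl fun p hp => ?_
  rw [← Finset.HasAntidiagonal.mem_antidiagonal.1 hp, ofExp_add, lmon_add hy, map_mul]
  ring

lemma isEval_one {x y : Fin N → ℂ} : IsEval x y (1 : Series N) 1 := by
  have h := hasSum_single (f := fun d => MvPolynomial.aeval x
    (MvPowerSeries.coeff d (1 : Series N)) * lmon y (ofExp d)) 0 (by
      classical
      intro d hd
      simp [MvPowerSeries.coeff_one, hd])
  have h0 : ofExp (0 : Fin N →₀ ℕ) = 0 := by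
    rw [← tailExp_zero, ofExp_tailExp cone_zero]
  simp only [MvPowerSeries.coeff_zero_eq_constantCoeff_apply, map_one, h0, one_mul] at h
  have h1 : lmon y 0 = 1 := by simp [lmon]
  rwa [h1] at h

lemma isEval_prod {x y : Fin N → ℂ} (hy : ∀ k, y k ≠ 0) {ι : Type*} (s : Finset ι)
    (φ : ι → Series N) (v : ι → ℂ) (h : ∀ i ∈ s, IsEval x y (φ i) (v i)) :
    IsEval x y (∏ i ∈ s, φ i) (∏ i ∈ s, v i) := by
  classical
  induction s using Finset.induction_on with
  | empty => simpa using isEval_one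
  | insert a s ha ih =>
    rw [Finset.prod_insert ha, Finset.prod_insert ha]
    exact (h a (Finset.mem_insert_self a s)).mul hy
      (ih fun i hi => h i (Finset.mem_insert_of_mem hi))

lemma nsmul_tailExp_injective {m : IntVec N} (hm : Cone m) (h0 : m ≠ 0) :
    Function.Injective fun i : ℕ => i • tailExp m := by
  obtain ⟨l, hl⟩ := Finsupp.ne_iff.1 (tailExp_ne_zero hm h0)
  intro i j h
  have := DFunLike.congr_fun h l
  simp only [Finsupp.smul_apply, smul_eq_mul] at this
  exact Nat.eq_of_mul_eq_mul_right (Nat.pos_of_ne_zero hl) this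

/-- As `m ≠ 0`, the powers of `a y^{-m}` sit at distinct exponents, so each coefficient of the
substituted series has a single source. -/
lemma coeff_sub_C_mul_mon {m : IntVec N} (hm : Cone m) (h0 : m ≠ 0) (a : Coef N)
    (φ : PowerSeries ℝ) (i : ℕ) :
    MvPowerSeries.coeff (i • tailExp m) (sub (MvPowerSeries.C a * mon m) φ) =
      PowerSeries.coeff i φ • a ^ i := by
  have hs : PowerSeries.HasSubst (MvPowerSeries.C a * mon m) :=
    PowerSeries.HasSubst.of_constantCoeff_zero (by rw [map_mul, constantCoeff_mon hm h0, mul_zero])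
  have hp : ∀ l : ℕ, (MvPowerSeries.C a * mon m) ^ l = MvPowerSeries.C (a ^ l) * mon (l • m) := by
    intro l; rw [mul_pow, mon_nsmul hm, map_pow]
  rw [sub, PowerSeries.coeff_subst hs, finsum_eq_single _ i]
  · rw [hp, MvPowerSeries.coeff_C_mul, mon, tailExp_nsmul hm, MvPowerSeries.coeff_monomial_same,
      mul_one]
  · intro l hl
    rw [hp, MvPowerSeries.coeff_C_mul, mon, tailExp_nsmul hm, MvPowerSeries.coeff_monomial, if_neg,
      mul_zero, smul_zero]
    intro h
    exact hl (nsmul_tailExp_injective hm h0 h.symm)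

lemma coeff_sub_C_mul_mon_of_notMem {m : IntVec N} (hm : Cone m) (h0 : m ≠ 0) (a : Coef N)
    (φ : PowerSeries ℝ) (d : Fin N →₀ ℕ) (hd : d ∉ Set.range fun i : ℕ => i • tailExp m) :
    MvPowerSeries.coeff d (sub (MvPowerSeries.C a * mon m) φ) = 0 := by
  have hs : PowerSeries.HasSubst (MvPowerSeries.C a * mon m) :=
    PowerSeries.HasSubst.of_constantCoeff_zero (by rw [map_mul, constantCoeff_mon hm h0, mul_zero])
  have hp : ∀ l : ℕ, (MvPowerSeries.C a * mon m) ^ l = MvPowerSeries.C (a ^ l) * mon (l • m) := by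
    intro l; rw [mul_pow, mon_nsmul hm, map_pow]
  rw [sub, PowerSeries.coeff_subst hs, finsum_eq_zero_of_forall_eq_zero]
  intro l
  rw [hp, MvPowerSeries.coeff_C_mul, mon, tailExp_nsmul hm, MvPowerSeries.coeff_monomial, if_neg,
    mul_zero, smul_zero]
  rintro rfl
  exact hd ⟨l, rfl⟩

lemma isEval_sub {x y : Fin N → ℂ} (hy : ∀ k, y k ≠ 0) {m : IntVec N} (hm : Cone m) (h0 : m ≠ 0)
    (a : Coef N) (φ : PowerSeries ℝ) (v : ℂ)
    (h : HasSum (fun i => ((PowerSeries.coeff i φ : ℝ) : ℂ) *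
      (MvPolynomial.aeval x a * lmon y m) ^ i) v) :
    IsEval x y (sub (MvPowerSeries.C a * mon m) φ) v := by
  have hinj : Function.Injective fun i : ℕ => i • tailExp m := nsmul_tailExp_injective hm h0
  rw [IsEval, ← hinj.hasSum_iff]
  · refine hasSum_of_eq (fun i => ?_) h
    rw [Function.comp_apply, coeff_sub_C_mul_mon hm h0, ← tailExp_nsmul hm,
      ofExp_tailExp (hm.nsmul i), lmon_nsmul hy, map_smul, map_pow, mul_pow, Complex.real_smul]
    ring
  · intro d hd
    rw [coeff_sub_C_mul_mon_of_notMem hm h0 a φ d hd, map_zero, zero_mul]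

lemma hasSum_oneSubPow (s : ℝ) {U : ℂ} (hU : ‖U‖ < 1) :
    HasSum (fun i => ((PowerSeries.coeff i (oneSubPow s) : ℝ) : ℂ) * U ^ i) ((1 - U) ^ (s : ℂ)) := by
  have h := (Complex.one_add_cpow_hasFPowerSeriesOnBall_zero (a := (s : ℂ))).hasSum (y := -U)
    (by rw [Metric.mem_eball, edist_zero_right, enorm_neg, ← ofReal_norm]
        exact ENNReal.ofReal_lt_one.2 hU)
  rw [zero_add, ← sub_eq_add_neg] at h
  refine hasSum_of_eq (fun i => ?_) h
  · rw [binomialSeries_apply, oneSubPow, PowerSeries.coeff_mk]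
    simp only [List.ofFn_const, List.prod_replicate, smul_eq_mul]
    push_cast
    rw [neg_pow U]
    ring

lemma isEval_pw {x y : Fin N → ℂ} (hy : ∀ k, y k ≠ 0) {m : IntVec N} (hm : Cone m) (h0 : m ≠ 0)
    (a : Coef N) (s : ℝ) {U : ℂ} (hUe : MvPolynomial.aeval x a * lmon y m = U) (hU : ‖U‖ < 1) :
    IsEval x y (pw s (MvPowerSeries.C a * mon m)) ((1 - U) ^ (s : ℂ)) := by
  refine isEval_sub hy hm h0 a _ _ ?_
  rw [hUe]
  exact hasSum_oneSubPow s hU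

lemma isEval_kernel (κ : ℝ) {x y : Fin N → ℂ} (hy : StrictMono fun k => ‖y k‖)
    (hxy : ∀ j k, ‖x j‖ < ‖y k‖) : IsEval x y (kernel κ N) (genFun κ x y) := by
  have hy0 : ∀ k, y k ≠ 0 := fun k => norm_pos_iff.1 ((norm_nonneg _).trans_lt (hxy k k))
  rw [genFun, div_eq_mul_inv, kernel]
  refine IsEval.mul hy0 ?_ ?_
  · refine isEval_prod hy0 _ _ _ fun p hp => ?_
    have hlt := (Finset.mem_filter.1 hp).2
    have e : rat p.1 p.2 = MvPowerSeries.C 1 *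
        mon (Pi.single p.2 1 - Pi.single p.1 1) := by rw [map_one, one_mul, rat]
    rw [e]
    refine isEval_pw hy0 (cone_sub hlt) (sub_single_ne_zero hlt) 1 κ ?_ ?_
    · rw [map_one, one_mul, sub_eq_add_neg, lmon_add hy0, lmon_single, lmon_neg_single]
      field_simp
    · rw [norm_div, div_lt_one (norm_pos_iff.2 (hy0 _))]
      exact hy hlt
  · rw [← Finset.prod_inv_distrib, cauchy]
    simp only [← Finset.prod_inv_distrib]
    rw [Finset.prod_comm]
    refine isEval_prod hy0 _ _ _ fun j _ => isEval_prod hy0 _ _ _ fun k _ => ?_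
    rw [← Complex.cpow_neg, ← Complex.ofReal_neg]
    refine isEval_pw hy0 (cone_single k) (single_ne_zero' k) (MvPolynomial.X j) (-κ) ?_ ?_
    · rw [MvPolynomial.aeval_X, lmon_single, div_eq_mul_inv]
    · rw [norm_div, div_lt_one (norm_pos_iff.2 (hy0 _))]
      exact hxy j k

/-- Summation over the cone and over `ℤ^N` agree because the coefficients vanish off the cone. -/
theorem isExpansion_fcoef (κ : ℝ) : IsExpansion κ (fcoef (N := N) κ) := by
  intro x y hy hxy
  have h := isEval_kernel κ hy hxy
  rw [← (ofExp_injective (N := N)).hasSum_iff]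
  · refine hasSum_of_eq (fun d => ?_) h
    rw [Function.comp_apply, fcoef, cf_ofExp]
    rfl
  · intro n hn
    rw [fcoef_of_not_cone, map_zero, zero_mul]
    intro hc
    exact hn ⟨tailExp n, ofExp_tailExp hc⟩

section Fourier

attribute [local instance] instMeasureSpaceUnitAddCircle
  instIsProbabilityMeasureUnitAddCircleVolume

/-- Uniqueness of the coefficients of an absolutely convergent multiple Fourier series. -/
lemma eq_zero_of_hasSum_mFourier {c : IntVec N → ℂ}
    (h : ∀ θ : UnitAddTorus (Fin N), HasSum (fun n => c n * UnitAddTorus.mFourier n θ) 0) :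
    c = 0 := by
  -- At `θ = 0` all characters equal one, so the hypothesis there already gives absolute
  -- summability.
  have hs : Summable fun n => ‖c n‖ := by
    have := (h 0).summable.norm
    simpa [UnitAddTorus.mFourier] using this
  have hS : Summable fun n => c n • (UnitAddTorus.mFourier n : C(UnitAddTorus (Fin N), ℂ)) := by
    refine Summable.of_norm ?_
    simpa only [norm_smul, UnitAddTorus.mFourier_norm, mul_one] using hs
  have hz : HasSum (fun n => c n • (UnitAddTorus.mFourier n : C(UnitAddTorus (Fin N), ℂ))) 0 := by
    convert hS.hasSum using 1
    ext θ
    have h1 := (ContinuousMap.evalCLM ℂ θ).hasSum hS.hasSum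
    exact (h θ).unique h1
  funext m
  -- `T` is the Fourier coefficient at `m`; it is continuous in the uniform norm, so it can be
  -- applied term by term.
  let T : C(UnitAddTorus (Fin N), ℂ) →L[ℂ] ℂ := (innerSL ℂ (UnitAddTorus.mFourierLp 2 m)).comp
    (ContinuousMap.toLp (E := ℂ) 2 MeasureTheory.volume ℂ)
  have hi := T.hasSum hz
  have e : ∀ n, T (c n • UnitAddTorus.mFourier n) = if n = m then c m else 0 := by
    intro n
    have := orthonormal_iff_ite.1 (UnitAddTorus.orthonormal_mFourier (d := Fin N)) m n
    rw [map_smul]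
    change c n • inner ℂ (UnitAddTorus.mFourierLp 2 m) (UnitAddTorus.mFourierLp 2 n) = _
    rw [this]
    by_cases hmn : m = n
    · simp [hmn]
    · simp [hmn, Ne.symm hmn]
  simp only [e, map_zero] at hi
  exact (hasSum_ite_eq m (c m)).unique hi

end Fourier

/-- For fixed `x`, restriction to a torus `|y_k| = r_k` inside the region makes the difference of
two expansions a vanishing Fourier series. So the polynomials agree at every complex point. -/
theorem isExpansion_unique {κ : ℝ} {f f' : IntVec N → MvPolynomial (Fin N) ℝ}
    (h : IsExpansion κ f) (h' : IsExpansion κ f') : f = f' := by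
  funext n
  apply MvPolynomial.map_injective (algebraMap ℝ ℂ) (algebraMap ℝ ℂ).injective
  apply MvPolynomial.funext
  intro x
  rw [MvPolynomial.eval_map, MvPolynomial.eval_map]
  change MvPolynomial.aeval x (f n) = MvPolynomial.aeval x (f' n)
  -- These radii increase strictly and exceed every `‖x j‖`. Taking phases `fourier (-1)` below
  -- turns `y^{-n}` into the character with index `n`.
  set r : Fin N → ℝ := fun k => (∑ j, ‖x j‖) + (k : ℕ) + 1 with hr
  have hr0 : ∀ k, 0 < r k := fun k => by positivity
  have hn : ∀ θ : UnitAddTorus (Fin N), ∀ k,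
      ‖(r k : ℂ) * fourier (-1) (θ k)‖ = r k := by
    intro θ k
    rw [norm_mul, fourier_apply, Circle.norm_coe, mul_one, Complex.norm_real,
      Real.norm_of_nonneg (hr0 k).le]
  have key := eq_zero_of_hasSum_mFourier (c := fun n : IntVec N =>
    (MvPolynomial.aeval x (f n) - MvPolynomial.aeval x (f' n)) * lmon (fun k => (r k : ℂ)) n) (by
      intro θ
      have hy1 : StrictMono fun k => ‖(r k : ℂ) * fourier (-1) (θ k)‖ := by
        intro k l hkl
        change ‖(r k : ℂ) * fourier (-1) (θ k)‖ < ‖(r l : ℂ) * fourier (-1) (θ l)‖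
        rw [hn, hn]
        simp only [hr]
        have : ((k : ℕ) : ℝ) < ((l : ℕ) : ℝ) := by exact_mod_cast hkl
        linarith
      have hy2 : ∀ j k, ‖x j‖ < ‖(r k : ℂ) * fourier (-1) (θ k)‖ := by
        intro j k
        rw [hn]
        have : ‖x j‖ ≤ ∑ j, ‖x j‖ :=
          Finset.single_le_sum (f := fun j => ‖x j‖) (fun _ _ => norm_nonneg _) (Finset.mem_univ j)
        have h2 : (0 : ℝ) ≤ ((k : ℕ) : ℝ) := by positivity
        simp only [hr]
        linarith
      have hd := (h x _ hy1 hy2).sub (h' x _ hy1 hy2)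
      rw [sub_self] at hd
      refine hasSum_of_eq (fun n => ?_) hd
      have e : ∏ k, ((r k : ℂ) * fourier (-1) (θ k)) ^ (-(n k)) =
          lmon (fun k => (r k : ℂ)) n * UnitAddTorus.mFourier n θ := by
        change _ = (∏ k, (r k : ℂ) ^ (-(n k))) * ∏ k, fourier (n k) (θ k)
        rw [← Finset.prod_mul_distrib]
        refine Finset.prod_congr rfl fun k _ => ?_
        rw [mul_zpow]
        congr 1
        rw [fourier_apply, fourier_apply, ← Circle.coe_zpow, neg_one_zsmul,
          AddCircle.toCircle_neg, inv_zpow', neg_neg, AddCircle.toCircle_zsmul]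
      rw [e]
      ring)
  have h1 := congrFun key n
  have h2 : lmon (fun k => (r k : ℂ)) n ≠ 0 :=
    Finset.prod_ne_zero_iff.2 fun k _ => zpow_ne_zero _ (Complex.ofReal_ne_zero.2 (hr0 k).ne')
  exact sub_eq_zero.1 ((mul_eq_zero.1 h1).resolve_right h2)

lemma genFun_comp_perm (κ : ℝ) (x y : Fin N → ℂ) (σ : Equiv.Perm (Fin N)) :
    genFun κ (x ∘ σ) y = genFun κ x y := by
  rw [genFun, genFun]
  congr 1
  exact Equiv.prod_comp σ fun j => ∏ k, (1 - x j / y k) ^ (κ : ℂ)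

/-- The generating function is symmetric in the positions; uniqueness of the expansion passes this
on to the coefficients. -/
theorem isSymmetric_fcoef (κ : ℝ) (n : IntVec N) : (fcoef κ n).IsSymmetric := by
  intro σ
  have h : IsExpansion κ fun n => MvPolynomial.rename σ (fcoef (N := N) κ n) := by
    intro x y hy hxy
    have := isExpansion_fcoef κ (x ∘ σ) y hy fun j k => hxy (σ j) k
    rw [genFun_comp_perm] at this
    simpa only [MvPolynomial.aeval_rename] using this
  exact congrFun (isExpansion_unique h (isExpansion_fcoef κ)) n

end Calogero
end

/-! ### Conjugation of the Hamiltonian by the ground state. -/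

noncomputable section

namespace Calogero

variable {N : ℕ}

section Derivatives

lemma hasDerivAt_of_eq {E : Type*} [NormedAddCommGroup E] [NormedSpace ℝ E] {f g : ℝ → E}
    {f' g' : E} {t : ℝ} (h : HasDerivAt f f' t) (hf : ∀ s, g s = f s) (hd : g' = f') :
    HasDerivAt g g' t := by
  rw [funext hf, hd]
  exact h

lemma hasDerivAt_prod_of_log {ι : Type*} (s : Finset ι) (f : ι → ℝ → ℂ) (L : ι → ℂ) (t : ℝ)
    (h : ∀ i ∈ s, HasDerivAt (f i) (f i t * L i) t) :
    HasDerivAt (fun t => ∏ i ∈ s, f i t) ((∏ i ∈ s, f i t) * ∑ i ∈ s, L i) t := by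
  classical
  induction s using Finset.induction_on with
  | empty => simpa using hasDerivAt_const t (1 : ℂ)
  | insert a s ha ih =>
    simp only [Finset.prod_insert ha, Finset.sum_insert ha]
    refine hasDerivAt_of_eq ((h a (Finset.mem_insert_self a s)).mul
      (ih fun i hi => h i (Finset.mem_insert_of_mem hi))) (fun _ => rfl) ?_
    ring

lemma hasDerivAt_eval_update (Q : MvPolynomial (Fin N) ℝ) (x : Fin N → ℝ) (j : Fin N) :
    HasDerivAt (fun t => MvPolynomial.eval (Function.update x j t) Q)
      (MvPolynomial.eval x (MvPolynomial.pderiv j Q)) (x j) := by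
  induction Q using MvPolynomial.induction_on with
  | C a => simpa using hasDerivAt_const (x j) a
  | add p q hp hq => exact hasDerivAt_of_eq (hp.add hq) (fun _ => by simp) (by simp)
  | mul_X p i hp =>
    have hX : HasDerivAt (fun t => Function.update x j t i) (if i = j then 1 else 0) (x j) := by
      rcases eq_or_ne i j with h | h
      · subst h; simpa using hasDerivAt_id' (x i)
      · simpa [h] using hasDerivAt_const (x j) (x i)
    have := hp.mul hX
    simp only [Function.update_eq_self] at this
    refine hasDerivAt_of_eq this (fun t => by simp) ?_
    simp only [map_mul, MvPolynomial.eval_X, Derivation.leibniz, smul_eq_mul, map_add,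
      MvPolynomial.pderiv_X, Pi.single_apply]
    split_ifs <;> simp <;> ring

/-- The phase of `s^κ` on the half line containing `s`. -/
lemma ofReal_cpow_eventuallyEq (κ : ℝ) {s : ℝ} (hs : s ≠ 0) :
    ∃ c : ℂ, (fun t : ℝ => (t : ℂ) ^ (κ : ℂ)) =ᶠ[nhds s] fun t => ((|t| ^ κ : ℝ) : ℂ) * c := by
  rcases lt_or_gt_of_ne hs with h | h
  · refine ⟨Complex.exp (Real.pi * Complex.I * κ), ?_⟩
    filter_upwards [gt_mem_nhds h] with t ht
    rw [Complex.ofReal_cpow_of_nonpos ht.le, abs_of_neg ht, Complex.ofReal_cpow (by linarith)]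
    push_cast
    rfl
  · refine ⟨1, ?_⟩
    filter_upwards [lt_mem_nhds h] with t ht
    rw [abs_of_pos ht, Complex.ofReal_cpow ht.le, mul_one]

lemma contDiffAt_ofReal_cpow (κ : ℝ) {s : ℝ} (hs : s ≠ 0) :
    ContDiffAt ℝ ∞ (fun t : ℝ => (t : ℂ) ^ (κ : ℂ)) s := by
  obtain ⟨c, hc⟩ := ofReal_cpow_eventuallyEq κ hs
  refine ContDiffAt.congr_of_eventuallyEq ?_ hc
  refine ContDiffAt.mul (Complex.ofRealCLM.contDiff.contDiffAt.comp s ?_) contDiffAt_const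
  exact (contDiffAt_abs hs).rpow_const_of_ne (abs_pos.2 hs).ne'

/-- The principal power has its cut on the negative axis, but along the real line it is `|t| ^ κ`
times a locally constant phase, so the usual logarithmic derivative holds on both half lines. -/
lemma hasDerivAt_ofReal_cpow (κ : ℝ) {s : ℝ} (hs : s ≠ 0) :
    HasDerivAt (fun t : ℝ => (t : ℂ) ^ (κ : ℂ)) ((s : ℂ) ^ (κ : ℂ) * (κ / s : ℝ)) s := by
  obtain ⟨c, hc⟩ := ofReal_cpow_eventuallyEq κ hs
  have h1 : HasDerivAt (fun t : ℝ => |t| ^ κ) (|s| ^ κ * (κ / s)) s := by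
    refine hasDerivAt_of_eq ((hasDerivAt_abs hs).rpow_const (p := κ) (Or.inl (abs_pos.2 hs).ne'))
      (fun _ => rfl) ?_
    rw [Real.rpow_sub_one (abs_pos.2 hs).ne']
    rcases lt_or_gt_of_ne hs with h | h
    · rw [abs_of_neg h]; simp [h]; field_simp
    · rw [abs_of_pos h]; simp [h]; field_simp
  have h2 := (h1.ofReal_comp.mul_const c).congr_of_eventuallyEq hc
  refine hasDerivAt_of_eq h2 (fun _ => rfl) ?_
  have h3 : (s : ℂ) ^ (κ : ℂ) = ((|s| ^ κ : ℝ) : ℂ) * c := hc.self_of_nhds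
  rw [h3]
  push_cast
  ring

/-- The logarithmic derivative of the ground state. -/
def logDer (κ : ℝ) (j : Fin N) (x : Fin N → ℝ) : ℝ := -x j + κ * ∑ k, 1 / (x j - x k)

lemma hasDerivAt_groundState (κ : ℝ) {x : Fin N → ℝ} (hx : x ∈ config N) (j : Fin N) :
    HasDerivAt (fun t => groundState κ (Function.update x j t))
      (groundState κ x * (logDer κ j x : ℝ)) (x j) := by
  have hu : ∀ i, HasDerivAt (fun t => Function.update x j t i) (if j = i then 1 else 0) (x j) := by
    intro i
    rcases eq_or_ne j i with h | h
    · subst h; simpa using hasDerivAt_id' (x j)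
    · simpa [h, Ne.symm h] using hasDerivAt_const (x j) (x i)
  have h1 := hasDerivAt_prod_of_log Finset.univ
    (fun i t => (Real.exp (-(1 / 2) * (Function.update x j t i) ^ 2) : ℂ))
    (fun i => ((if j = i then -x i else 0 : ℝ) : ℂ)) (x j) (by
      intro i _
      have := ((((hu i).pow 2).const_mul (-(1 / 2))).exp).ofReal_comp
      refine hasDerivAt_of_eq this (fun _ => rfl) ?_
      simp only [Function.update_eq_self]
      push_cast
      split_ifs <;> simp)
  have h2 := hasDerivAt_prod_of_log (Finset.univ.filter fun p : Fin N × Fin N => p.1 < p.2)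
    (fun p t => ((Function.update x j t p.2 - Function.update x j t p.1 : ℝ) : ℂ) ^ (κ : ℂ))
    (fun p => ((κ * (((if j = p.2 then 1 else 0) - (if j = p.1 then 1 else 0)) *
      (1 / (x p.2 - x p.1))) : ℝ) : ℂ)) (x j) (by
      intro p hp
      have hp' := (Finset.mem_filter.1 hp).2
      have hne : x p.2 - x p.1 ≠ 0 := sub_ne_zero.2 fun h => hp'.ne' (hx h)
      have hin := (hu p.2).sub (hu p.1)
      have hc : HasDerivAt (fun t : ℝ => (t : ℂ) ^ (κ : ℂ)) _
          (Function.update x j (x j) p.2 - Function.update x j (x j) p.1) :=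
        hasDerivAt_ofReal_cpow κ (by simpa using hne)
      have := hc.scomp (x j) hin
      refine hasDerivAt_of_eq this (fun _ => rfl) ?_
      simp only [Function.update_eq_self, Complex.real_smul]
      push_cast
      ring)
  have h3 := h1.mul h2
  simp only [Function.update_eq_self] at h3
  refine hasDerivAt_of_eq h3 (fun _ => rfl) ?_
  rw [groundState, logDer, ← Complex.ofReal_sum, ← Complex.ofReal_sum, ← Finset.mul_sum,
    sum_filter_lt j fun p => 1 / (x p.2 - x p.1), Finset.sum_ite_eq, if_pos (Finset.mem_univ j),
    ← Finset.sum_sub_distrib]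
  have e : ∑ l, ((if l < j then 1 / (x j - x l) else 0) - (if j < l then 1 / (x l - x j) else 0)) =
      ∑ k, 1 / (x j - x k) := by
    refine Finset.sum_congr rfl fun l _ => ?_
    rcases lt_trichotomy l j with h | h | h
    · simp [h, h.not_gt]
    · simp [h]
    · rw [if_neg h.not_gt, if_pos h, ← neg_sub (x l), div_neg]; ring
  rw [e]
  push_cast
  ring

lemma hasDerivAt_logDer (κ : ℝ) {x : Fin N → ℝ} (hx : x ∈ config N) (j : Fin N) :
    HasDerivAt (fun t => logDer κ j (Function.update x j t))
      (-1 - κ * ∑ k, (1 / (x j - x k)) ^ 2) (x j) := by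
  unfold logDer
  have h : ∀ k ∈ Finset.univ, HasDerivAt (fun t => 1 / (Function.update x j t j -
      Function.update x j t k)) (-(1 / (x j - x k)) ^ 2) (x j) := by
    intro k _
    rcases eq_or_ne k j with hk | hk
    · subst hk; simpa using hasDerivAt_const (x k) (0 : ℝ)
    · have hne : x j - x k ≠ 0 := sub_ne_zero.2 fun h => hk (hx h).symm
      simp only [Function.update_self, Function.update_of_ne hk, one_div]
      refine hasDerivAt_of_eq (((hasDerivAt_id' (x j)).sub_const (x k)).inv hne) (fun _ => rfl) ?_
      field_simp
  have h2 := HasDerivAt.fun_sum h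
  have h3 := (hasDerivAt_id' (x j)).neg.add (h2.const_mul κ)
  refine hasDerivAt_of_eq h3 (fun t => by simp) ?_
  rw [Finset.sum_neg_distrib]; ring

lemma update_mem_config {x : Fin N → ℝ} (hx : x ∈ config N) (j : Fin N) :
    ∀ᶠ t in nhds (x j), Function.update x j t ∈ config N := by
  have h : ∀ k, ∀ᶠ t in nhds (x j), k ≠ j → t ≠ x k := by
    intro k
    by_cases hk : k = j
    · simp [hk]
    · have : x j ≠ x k := fun h => hk (hx h).symm
      filter_upwards [isOpen_ne.mem_nhds this] with t ht _ using ht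
  filter_upwards [Filter.eventually_all.2 h] with t ht
  intro k l hkl
  by_cases h1 : k = j
  · by_cases h2 : l = j
    · rw [h1, h2]
    · rw [h1, Function.update_self, Function.update_of_ne h2] at hkl
      exact absurd hkl (ht l h2)
  · by_cases h2 : l = j
    · rw [h2, Function.update_self, Function.update_of_ne h1] at hkl
      exact absurd hkl.symm (ht k h1)
    · rw [Function.update_of_ne h1, Function.update_of_ne h2] at hkl
      exact hx hkl

lemma partial2_waveFunction (κ : ℝ) (Q : MvPolynomial (Fin N) ℝ) {x : Fin N → ℝ}
    (hx : x ∈ config N) (j : Fin N) :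
    partial2 j (waveFunction κ Q) x = groundState κ x *
      (((logDer κ j x ^ 2 + (-1 - κ * ∑ k, (1 / (x j - x k)) ^ 2)) * MvPolynomial.eval x Q +
        2 * logDer κ j x * MvPolynomial.eval x (MvPolynomial.pderiv j Q) +
        MvPolynomial.eval x (MvPolynomial.pderiv j (MvPolynomial.pderiv j Q)) : ℝ) : ℂ) := by
  have h1 : ∀ y ∈ config N, HasDerivAt (fun t => waveFunction κ Q (Function.update y j t))
      (groundState κ y * ((logDer κ j y * MvPolynomial.eval y Q +
        MvPolynomial.eval y (MvPolynomial.pderiv j Q) : ℝ) : ℂ)) (y j) := by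
    intro y hy
    have := (hasDerivAt_groundState κ hy j).mul (hasDerivAt_eval_update Q y j).ofReal_comp
    simp only [Function.update_eq_self] at this
    refine hasDerivAt_of_eq this (fun _ => rfl) ?_
    push_cast
    ring
  -- The first derivative is needed on a whole neighbourhood; moving one coordinate slightly keeps
  -- the positions distinct.
  have h2 : deriv (fun t => waveFunction κ Q (Function.update x j t)) =ᶠ[nhds (x j)]
      fun t => groundState κ (Function.update x j t) *
        ((logDer κ j (Function.update x j t) * MvPolynomial.eval (Function.update x j t) Q +
        MvPolynomial.eval (Function.update x j t) (MvPolynomial.pderiv j Q) : ℝ) : ℂ) := by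
    filter_upwards [update_mem_config hx j] with t ht
    have := h1 _ ht
    simp only [Function.update_idem, Function.update_self] at this
    exact this.deriv
  rw [partial2, iteratedDeriv_succ, iteratedDeriv_one, h2.deriv_eq]
  have h3 := (hasDerivAt_groundState κ hx j).mul (((hasDerivAt_logDer κ hx j).mul
    (hasDerivAt_eval_update Q x j)).add
    (hasDerivAt_eval_update (MvPolynomial.pderiv j Q) x j)).ofReal_comp
  simp only [Pi.add_apply, Pi.mul_apply, Function.update_eq_self] at h3
  refine HasDerivAt.deriv ?_
  refine hasDerivAt_of_eq h3 (fun _ => rfl) ?_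
  push_cast
  ring

end Derivatives

/-- The logarithmic derivative of the ground state is `-x_j + κ ∑ 1/(x_j - x_k)`. Its squares
reproduce the two potentials once the three-body terms vanish, the cross terms give the constant `κ
N (N - 1)`, and what remains is the reduced equation `h`. -/
lemma hamiltonian_waveFunction (κ w : ℝ) (Q : MvPolynomial (Fin N) ℝ) {x : Fin N → ℝ}
    (hx : x ∈ config N)
    (h : ∑ j, MvPolynomial.eval x (MvPolynomial.pderiv j (MvPolynomial.pderiv j Q)) +
      κ * ∑ i, ∑ j, (MvPolynomial.eval x (MvPolynomial.pderiv i Q) -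
        MvPolynomial.eval x (MvPolynomial.pderiv j Q)) * (1 / (x i - x j)) =
      2 * ∑ j, x j * MvPolynomial.eval x (MvPolynomial.pderiv j Q) -
        2 * w * MvPolynomial.eval x Q) :
    hamiltonian κ (waveFunction κ Q) x =
      ((2 * w + N * (1 + κ * (N - 1)) : ℝ) : ℂ) * waveFunction κ Q x := by
  rw [hamiltonian, Finset.sum_congr rfl fun j _ => partial2_waveFunction κ Q hx j,
    ← Finset.mul_sum, ← Complex.ofReal_sum, waveFunction]
  set q := MvPolynomial.eval x Q
  set d : Fin N → ℝ := fun j => MvPolynomial.eval x (MvPolynomial.pderiv j Q)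
  set V : Fin N → Fin N → ℝ := fun j k => 1 / (x j - x k) with hV
  have hne : ∀ {k l}, k ≠ l → x k - x l ≠ 0 := fun hkl => sub_ne_zero.2 fun h => hkl (hx h)
  have hV0 : ∀ k, V k k = 0 := by intro k; simp [hV]
  have hVa : ∀ k l, V l k = -V k l := by
    intro k l; simp only [hV]; rw [← neg_sub (x k) (x l), div_neg]
  have t1 := sum_sq_sum_eq V hV0 (by
    intro k l m h1 h2 h3
    have := hne h1; have := hne h2; have := hne h3
    have := hne h1.symm; have := hne h2.symm; have := hne h3.symm
    simp only [hV]
    rw [← neg_sub (x l) (x k), ← neg_sub (x m) (x l), ← neg_sub (x k) (x m)]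
    field_simp
    ring)
  -- Pairing `(j, k)` with `(k, j)` turns each off-diagonal pair into `(x_j - x_k)/(x_j - x_k) = 1`.
  have t2 : 2 * ∑ j, x j * ∑ k, V j k = N * (N - 1) := by
    have e1 : ∑ j, x j * ∑ k, V j k = ∑ j, ∑ k, x j * V j k :=
      Finset.sum_congr rfl fun j _ => Finset.mul_sum _ _ _
    have e2 : ∑ j, ∑ k, x j * V j k = ∑ j, ∑ k, -(x k * V j k) := by
      rw [Finset.sum_comm]
      refine Finset.sum_congr rfl fun j _ => Finset.sum_congr rfl fun k _ => ?_
      rw [hVa]; ring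
    have e3 : ∀ j k, x j * V j k + -(x k * V j k) = 1 - if j = k then 1 else 0 := by
      intro j k
      split_ifs with hjk
      · rw [hjk]; ring
      · have := hne hjk
        simp only [hV]
        field_simp
        ring
    rw [e1, two_mul]
    nth_rewrite 2 [e2]
    rw [← Finset.sum_add_distrib]
    simp only [← Finset.sum_add_distrib, e3]
    simp
    ring
  have t3 : ∑ i, ∑ j, (d i - d j) * V i j = 2 * ∑ i, d i * ∑ j, V i j := by
    have e1 : ∑ i, ∑ j, d j * V i j = -∑ i, ∑ j, d i * V i j := by
      rw [Finset.sum_comm, ← Finset.sum_neg_distrib]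
      refine Finset.sum_congr rfl fun i _ => ?_
      rw [← Finset.sum_neg_distrib]
      refine Finset.sum_congr rfl fun j _ => ?_
      rw [hVa]; ring
    simp only [sub_mul, Finset.sum_sub_distrib, e1, Finset.mul_sum]
    simp only [← Finset.mul_sum]
    ring
  have t4 : 2 * ∑ p : Fin N × Fin N with p.1 < p.2, 1 / (x p.1 - x p.2) ^ 2 =
      ∑ j, ∑ k, V j k ^ 2 := by
    rw [Finset.sum_filter, Fintype.sum_prod_type, two_mul]
    conv_lhs => arg 2; rw [Finset.sum_comm]
    rw [← Finset.sum_add_distrib]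
    refine Finset.sum_congr rfl fun k _ => ?_
    rw [← Finset.sum_add_distrib]
    refine Finset.sum_congr rfl fun l _ => ?_
    rcases lt_trichotomy k l with h | h | h
    · simp [hV, h, h.not_gt]
    · simp [hV, h]
    · simp only [hV, h, h.not_gt, if_true, if_false]
      rw [div_pow, one_pow, zero_add, ← neg_sub (x k) (x l), neg_sq]
  have key : ∑ j, ((logDer κ j x ^ 2 + (-1 - κ * ∑ k, (1 / (x j - x k)) ^ 2)) * q +
        2 * logDer κ j x * d j +
        MvPolynomial.eval x (MvPolynomial.pderiv j (MvPolynomial.pderiv j Q))) =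
      ((∑ j, x j ^ 2) + 2 * κ * (κ - 1) *
        (∑ p : Fin N × Fin N with p.1 < p.2, 1 / (x p.1 - x p.2) ^ 2) -
        (2 * w + N * (1 + κ * (N - 1)))) * q := by
    have e : ∀ j, (logDer κ j x ^ 2 + (-1 - κ * ∑ k, (1 / (x j - x k)) ^ 2)) * q +
        2 * logDer κ j x * d j +
        MvPolynomial.eval x (MvPolynomial.pderiv j (MvPolynomial.pderiv j Q)) =
        x j ^ 2 * q - (2 * κ * q) * (x j * ∑ k, V j k) + κ ^ 2 * q * (∑ k, V j k) ^ 2 - q -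
        κ * q * ∑ k, V j k ^ 2 - 2 * (x j * d j) + 2 * κ * (d j * ∑ k, V j k) +
        MvPolynomial.eval x (MvPolynomial.pderiv j (MvPolynomial.pderiv j Q)) := by
      intro j
      change ((-x j + κ * ∑ k, V j k) ^ 2 + (-1 - κ * ∑ k, V j k ^ 2)) * q +
        2 * (-x j + κ * ∑ k, V j k) * d j + _ = _
      ring
    rw [Finset.sum_congr rfl fun j _ => e j]
    simp only [Finset.sum_add_distrib, Finset.sum_sub_distrib, ← Finset.mul_sum, ← Finset.sum_mul]
    rw [t1, Finset.sum_const, Finset.card_univ, Fintype.card_fin, nsmul_eq_mul]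
    change _ + κ * ∑ i, ∑ j, (d i - d j) * V i j = 2 * ∑ j, x j * d j - 2 * w * q at h
    rw [t3] at h
    linear_combination h - κ * q * t2 - κ * (κ - 1) * q * t4
  rw [key]
  push_cast
  ring

lemma contDiff_eval (Q : MvPolynomial (Fin N) ℝ) :
    ContDiff ℝ ∞ fun x : Fin N → ℝ => MvPolynomial.eval x Q := by
  induction Q using MvPolynomial.induction_on with
  | C a => simpa using contDiff_const
  | add p q hp hq => simpa using hp.add hq
  | mul_X p i hp => simpa using hp.mul (contDiff_apply ℝ ℝ i)

lemma contDiffOn_waveFunction (κ : ℝ) (Q : MvPolynomial (Fin N) ℝ) :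
    ContDiffOn ℝ ∞ (waveFunction κ Q) (config N) := by
  intro x hx
  refine ContDiffAt.contDiffWithinAt ?_
  refine ContDiffAt.mul (ContDiffAt.mul ?_ ?_) ?_
  · refine contDiffAt_prod fun i _ => ?_
    refine Complex.ofRealCLM.contDiff.contDiffAt.comp x ?_
    exact (contDiff_const.mul ((contDiff_apply ℝ ℝ i).pow 2)).exp.contDiffAt
  · refine contDiffAt_prod fun p hp => ?_
    have hp' := (Finset.mem_filter.1 hp).2
    have hne : x p.2 - x p.1 ≠ 0 := sub_ne_zero.2 fun h => hp'.ne' (hx h)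
    exact (contDiffAt_ofReal_cpow κ hne).comp x
      ((contDiff_apply ℝ ℝ p.2).sub (contDiff_apply ℝ ℝ p.1)).contDiffAt
  · exact Complex.ofRealCLM.contDiff.contDiffAt.comp x (contDiff_eval Q).contDiffAt

/-! ### Square integrability. -/

/-- Functions of at most polynomial growth. -/
def Moderate (f : (Fin N → ℝ) → ℂ) : Prop :=
  ∃ (C : ℝ) (m : ℕ), 0 ≤ C ∧ ∀ x, ‖f x‖ ≤ C * (1 + ‖x‖) ^ m

lemma Moderate.mul {f g : (Fin N → ℝ) → ℂ} (hf : Moderate f) (hg : Moderate g) :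
    Moderate fun x => f x * g x := by
  obtain ⟨C, m, hC, h⟩ := hf
  obtain ⟨C', m', hC', h'⟩ := hg
  refine ⟨C * C', m + m', mul_nonneg hC hC', fun x => ?_⟩
  rw [norm_mul]
  calc ‖f x‖ * ‖g x‖ ≤ (C * (1 + ‖x‖) ^ m) * (C' * (1 + ‖x‖) ^ m') :=
        mul_le_mul (h x) (h' x) (norm_nonneg _) (by positivity)
    _ = _ := by ring

lemma Moderate.add {f g : (Fin N → ℝ) → ℂ} (hf : Moderate f) (hg : Moderate g) :
    Moderate fun x => f x + g x := by
  obtain ⟨C, m, hC, h⟩ := hf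
  obtain ⟨C', m', hC', h'⟩ := hg
  refine ⟨C + C', m + m', add_nonneg hC hC', fun x => ?_⟩
  have h1 : (1 : ℝ) ≤ 1 + ‖x‖ := by linarith [norm_nonneg x]
  calc ‖f x + g x‖ ≤ C * (1 + ‖x‖) ^ m + C' * (1 + ‖x‖) ^ m' :=
        (norm_add_le _ _).trans (add_le_add (h x) (h' x))
    _ ≤ C * (1 + ‖x‖) ^ (m + m') + C' * (1 + ‖x‖) ^ (m + m') := by
        gcongr <;> first | exact h1 | omega
    _ = _ := by ring

lemma moderate_const (c : ℂ) : Moderate fun _ : Fin N → ℝ => c :=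
  ⟨‖c‖, 0, norm_nonneg c, fun x => by simp⟩

lemma moderate_prod {ι : Type*} (s : Finset ι) (f : ι → (Fin N → ℝ) → ℂ)
    (h : ∀ i ∈ s, Moderate (f i)) : Moderate fun x => ∏ i ∈ s, f i x := by
  classical
  induction s using Finset.induction_on with
  | empty => simpa using moderate_const 1
  | insert a s ha ih =>
    simp only [Finset.prod_insert ha]
    exact (h a (Finset.mem_insert_self a s)).mul (ih fun i hi => h i (Finset.mem_insert_of_mem hi))

lemma moderate_eval (Q : MvPolynomial (Fin N) ℝ) :
    Moderate fun x => ((MvPolynomial.eval x Q : ℝ) : ℂ) := by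
  induction Q using MvPolynomial.induction_on with
  | C a => simpa using moderate_const (a : ℂ)
  | add p q hp hq => simpa using hp.add hq
  | mul_X p i hp =>
    simp only [map_mul, MvPolynomial.eval_X, Complex.ofReal_mul]
    refine hp.mul ⟨1, 1, zero_le_one, fun x => ?_⟩
    rw [Complex.norm_real, pow_one, one_mul]
    linarith [norm_le_pi_norm x i]

lemma moderate_cpow {κ : ℝ} (hκ : 0 < κ) (j k : Fin N) :
    Moderate fun x => ((x k - x j : ℝ) : ℂ) ^ (κ : ℂ) := by
  refine ⟨2 ^ ⌈κ⌉₊, ⌈κ⌉₊, by positivity, fun x => ?_⟩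
  rw [Complex.norm_cpow_real, Complex.norm_real, ← mul_pow]
  have h1 : ‖x k - x j‖ ≤ 2 * (1 + ‖x‖) := by
    linarith [norm_sub_le (x k) (x j), norm_le_pi_norm x k, norm_le_pi_norm x j]
  calc ‖x k - x j‖ ^ κ ≤ (2 * (1 + ‖x‖)) ^ κ := Real.rpow_le_rpow (norm_nonneg _) h1 hκ.le
    _ ≤ (2 * (1 + ‖x‖)) ^ (⌈κ⌉₊ : ℝ) :=
        Real.rpow_le_rpow_of_exponent_le (by linarith [norm_nonneg x]) (Nat.le_ceil κ)
    _ = _ := Real.rpow_natCast _ _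

/-- Half of the Gaussian exponent suffices to absorb polynomial growth. -/
lemma Moderate.exists_gaussian_bound {f : (Fin N → ℝ) → ℂ} (hf : Moderate f) :
    ∃ C : ℝ, ∀ x, ‖(∏ j, (Real.exp (-(1 / 2) * x j ^ 2) : ℂ)) * f x‖ ≤
      ‖C * ∏ j, Real.exp (-(1 / 4) * x j ^ 2)‖ := by
  obtain ⟨C, m, hC, h⟩ := hf
  refine ⟨C * (m.factorial * Real.exp 2), fun x => ?_⟩
  rw [norm_mul, ← Complex.ofReal_prod, Complex.norm_real, ← Real.exp_sum, ← Real.exp_sum,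
    Real.norm_of_nonneg (Real.exp_pos _).le, Real.norm_of_nonneg (by positivity)]
  have h1 : ‖x‖ ^ 2 ≤ ∑ j, x j ^ 2 := by
    rw [← Real.le_sqrt (norm_nonneg x) (Finset.sum_nonneg fun j _ => sq_nonneg (x j))]
    refine (pi_norm_le_iff_of_nonneg (Real.sqrt_nonneg _)).2 fun j => ?_
    rw [Real.norm_eq_abs]
    refine Real.abs_le_sqrt ?_
    exact Finset.single_le_sum (f := fun j => x j ^ 2) (fun _ _ => sq_nonneg _) (Finset.mem_univ j)
  have h2 : (1 + ‖x‖) ^ m ≤ m.factorial * Real.exp (1 + ‖x‖) := by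
    have := Real.pow_div_factorial_le_exp (1 + ‖x‖) (by positivity) m
    rw [div_le_iff₀ (by positivity)] at this
    linarith
  -- The constant `exp 2` comes from `1 + r ≤ 2 + r ^ 2 / 4`, which is `(r - 2) ^ 2 ≥ 0`.
  have h3 : Real.exp (1 + ‖x‖) * Real.exp (∑ j, -(1 / 2) * x j ^ 2) ≤
      Real.exp 2 * Real.exp (∑ j, -(1 / 4) * x j ^ 2) := by
    rw [← Real.exp_add, ← Real.exp_add, Real.exp_le_exp, ← Finset.mul_sum, ← Finset.mul_sum]
    nlinarith [sq_nonneg (‖x‖ - 2)]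
  calc Real.exp (∑ j, -(1 / 2) * x j ^ 2) * ‖f x‖
      ≤ Real.exp (∑ j, -(1 / 2) * x j ^ 2) * (C * (m.factorial * Real.exp (1 + ‖x‖))) := by
        gcongr
        exact (h x).trans (by gcongr)
    _ = C * m.factorial * (Real.exp (1 + ‖x‖) * Real.exp (∑ j, -(1 / 2) * x j ^ 2)) := by ring
    _ ≤ C * m.factorial * (Real.exp 2 * Real.exp (∑ j, -(1 / 4) * x j ^ 2)) := by gcongr
    _ = _ := by ring

lemma memLp_waveFunction {κ : ℝ} (hκ : 0 < κ) (Q : MvPolynomial (Fin N) ℝ) :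
    MeasureTheory.MemLp (waveFunction κ Q) 2 MeasureTheory.volume := by
  have hcont : Continuous (waveFunction κ Q) := by
    refine Continuous.mul (Continuous.mul ?_ ?_) ?_
    · refine continuous_finsetProd _ fun i _ => ?_
      exact Complex.continuous_ofReal.comp (by fun_prop)
    · refine continuous_finsetProd _ fun p _ => ?_
      -- Here `κ > 0` gives continuity across the hyperplanes where two positions coincide.
      exact (Complex.continuous_ofReal_cpow_const (y := (κ : ℂ)) (by simpa using hκ)).comp
        (by fun_prop : Continuous fun x : Fin N → ℝ => x p.2 - x p.1)
    · exact Complex.continuous_ofReal.comp (contDiff_eval Q).continuous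
  have hm : Moderate fun x : Fin N → ℝ =>
      (∏ p : Fin N × Fin N with p.1 < p.2, ((x p.2 - x p.1 : ℝ) : ℂ) ^ (κ : ℂ)) *
        ((MvPolynomial.eval x Q : ℝ) : ℂ) :=
    (moderate_prod _ _ fun p _ => moderate_cpow hκ p.1 p.2).mul (moderate_eval Q)
  obtain ⟨C, hC⟩ := hm.exists_gaussian_bound
  have hg : MeasureTheory.MemLp (fun x : Fin N → ℝ => C * ∏ j, Real.exp (-(1 / 4) * x j ^ 2)) 2
      MeasureTheory.volume := by
    refine MeasureTheory.MemLp.const_mul ?_ C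
    rw [MeasureTheory.memLp_two_iff_integrable_sq (by
      exact Continuous.aestronglyMeasurable (by fun_prop))]
    have e : (fun x : Fin N → ℝ => (∏ j, Real.exp (-(1 / 4) * x j ^ 2)) ^ 2) =
        fun x => ∏ j, Real.exp (-(1 / 2) * x j ^ 2) := by
      funext x
      rw [← Finset.prod_pow]
      refine Finset.prod_congr rfl fun j _ => ?_
      rw [← Real.exp_nat_mul]
      congr 1
      push_cast
      ring
    rw [e]
    exact MeasureTheory.Integrable.fintype_prod
      (f := fun (_ : Fin N) (t : ℝ) => Real.exp (-(1 / 2) * t ^ 2))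
      fun _ => integrable_exp_neg_mul_sq (by norm_num)
  refine hg.of_le hcont.aestronglyMeasurable (Filter.Eventually.of_forall fun x => ?_)
  rw [waveFunction, groundState, mul_assoc]
  exact hC x

/-- A symmetric polynomial that solves the reduced eigenvalue equation is a reduced
eigenfunction. -/
theorem isReducedEigenfunction_of_eval {κ : ℝ} (hκ : 0 < κ) (w : ℝ) {Q : MvPolynomial (Fin N) ℝ}
    (hs : Q.IsSymmetric)
    (h : ∀ x ∈ config N,
      ∑ j, MvPolynomial.eval x (MvPolynomial.pderiv j (MvPolynomial.pderiv j Q)) +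
      κ * ∑ i, ∑ j, (MvPolynomial.eval x (MvPolynomial.pderiv i Q) -
        MvPolynomial.eval x (MvPolynomial.pderiv j Q)) * (1 / (x i - x j)) =
      2 * ∑ j, x j * MvPolynomial.eval x (MvPolynomial.pderiv j Q) -
        2 * w * MvPolynomial.eval x Q) :
    IsReducedEigenfunction κ (2 * w + N * (1 + κ * (N - 1))) Q where
  symmetric := hs
  squareIntegrable := memLp_waveFunction hκ Q
  smooth := contDiffOn_waveFunction κ Q
  schrodinger x hx := hamiltonian_waveFunction κ w Q hx (h x hx)

end Calogero
end

/-! ### Chains of steps, and `P_n` as an exponential. -/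

noncomputable section

namespace Calogero

variable {N : ℕ}

lemma weight_sub (m n : IntVec N) : weight (m - n) = weight m - weight n := by
  simp [weight, Finset.sum_sub_distrib]

lemma weight_sum {ι : Type*} (s : Finset ι) (v : ι → IntVec N) :
    weight (∑ i ∈ s, v i) = ∑ i ∈ s, weight (v i) := by
  simp only [weight, Finset.sum_apply]
  exact Finset.sum_comm

lemma Cone.weight_nonneg {m : IntVec N} (hm : Cone m) : 0 ≤ weight m := by
  rcases N with _ | N
  · simp [weight]
  · have := hm 0
    rwa [tail, show Finset.Ici (0 : Fin (N + 1)) = Finset.univ from Finset.Ici_bot] at this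

lemma cone_sum {ι : Type*} (s : Finset ι) (v : ι → IntVec N) (h : ∀ i ∈ s, Cone (v i)) :
    Cone (∑ i ∈ s, v i) := fun l => by
  rw [tail_sum]; exact Finset.sum_nonneg fun i hi => h i hi l

lemma Step.cone_vec (t : Step N) : Cone t.vec := cone_stepVec t.1.2 t.2

lemma Step.weight_vec (t : Step N) : weight t.vec = 2 := by
  simp only [weight, Step.vec, stepVec, Pi.add_apply, Pi.smul_apply, smul_eq_mul,
    Finset.sum_add_distrib, ← Finset.mul_sum, Finset.sum_pi_single', Finset.mem_univ, if_true]
  ring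

/-- For `j < k` the tail sum of the step at `k` is `1 + ν`; for `j = k` the coefficient vanishes
unless `ν = 0`. -/
lemma Step.le_of_coeff_ne_zero {κ : ℝ} {t : Step N} {m : IntVec N} (h : t.coeff κ m ≠ 0) {M : ℕ}
    (hM : ∀ l, tail t.vec l ≤ M) : t.2 ≤ M := by
  rcases t with ⟨⟨⟨j, k⟩, hjk⟩, ν⟩
  rcases hjk.lt_or_eq with h1 | h1
  · have := hM k
    rw [Step.vec, tail_stepVec hjk, if_neg h1.not_ge, if_pos le_rfl] at this
    change ν ≤ M
    omega
  · have h2 : j = k := h1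
    subst h2
    by_contra hν
    apply h
    have : ν ≠ 0 := by rintro rfl; exact hν (Nat.zero_le _)
    simp [Step.coeff, g, this]

/-- Steps with a bounded parameter `ν`. -/
abbrev BStep (N M : ℕ) : Type := {p : Fin N × Fin N // p.1 ≤ p.2} × Fin (M + 1)

/-- A bounded step as a step. -/
def BStep.toStep {M : ℕ} (t : BStep N M) : Step N := (t.1, t.2)

lemma BStep.toStep_injective {M : ℕ} : Function.Injective (BStep.toStep (N := N) (M := M)) := by
  rintro ⟨p, i⟩ ⟨q, j⟩ h
  have h1 := congrArg Prod.fst h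
  have h2 := congrArg Prod.snd h
  exact Prod.ext h1 (Fin.ext h2)

/-- The chains of bounded length with bounded parameters. -/
def boundedChain (N M S : ℕ) (c : Σ s : Fin S, Fin (s + 1) → BStep N M) : Chain N :=
  ⟨⟨c.1 + 1, by omega⟩, fun r => (c.2 r).toStep⟩

lemma boundedChain_injective (M S : ℕ) : Function.Injective (boundedChain N M S) := by
  rintro ⟨⟨s, hs⟩, c⟩ ⟨⟨s', hs'⟩, c'⟩ h
  have h1 : s + 1 = s' + 1 := congrArg (fun c : Chain N => c.1.1) h
  obtain rfl : s = s' := by omega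
  have h2 := eq_of_heq (Sigma.mk.inj h).2
  congr 1
  funext r
  exact BStep.toStep_injective (congrFun h2 r)

/-- In a nonzero term the steps add up to `n - m`. Each has weight two, which bounds the length, and
each has nonnegative tail sums, so no step exceeds the tail sums of `n - m`, which bounds every `ν`.
-/
lemma support_chainTerm_subset (κ : ℝ) (n m : IntVec N) {M S : ℕ}
    (hM : ∀ l, tail (n - m) l ≤ M) (hS : weight (n - m) ≤ S) :
    Function.support (fun c : Chain N => chainTerm κ n m c.1.1 c.2) ⊆
      Set.range (boundedChain N M S) := by
  rintro ⟨⟨s, hs⟩, c⟩ hc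
  have hc' : chainTerm κ n m s c ≠ 0 := hc
  rw [chainTerm] at hc'
  have h1 : m + ∑ r, (c r).vec = n := by
    by_contra h; exact hc' (by rw [if_neg h]; ring)
  have h2 : ∀ r, (c r).coeff κ (n - ∑ l ∈ Finset.Iic r, (c l).vec) ≠ 0 := fun r =>
    Finset.prod_ne_zero_iff.1 (right_ne_zero_of_mul hc') r (Finset.mem_univ r)
  have h3 : n - m = ∑ r, (c r).vec := by rw [← h1]; abel
  have h4 : ∀ r, (c r).2 ≤ M := by
    intro r
    refine Step.le_of_coeff_ne_zero (h2 r) fun l => le_trans ?_ (hM l)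
    rw [h3, tail_sum]
    exact Finset.single_le_sum (f := fun r => tail (c r).vec l)
      (fun i _ => (c i).cone_vec l) (Finset.mem_univ r)
  have h5 : s ≤ S := by
    rw [h3, weight_sum] at hS
    simp only [Step.weight_vec, Finset.sum_const, Finset.card_univ, Fintype.card_fin] at hS
    have : (s : ℤ) * 2 ≤ S := by simpa using hS
    omega
  obtain ⟨s, rfl⟩ : ∃ s', s = s' + 1 := ⟨s - 1, by omega⟩
  exact ⟨⟨⟨s, by omega⟩, fun r => ((c r).1, ⟨(c r).2, Nat.lt_succ_of_le (h4 r)⟩)⟩, rfl⟩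

theorem finite_support_chainTerm (κ : ℝ) (n m : IntVec N) :
    (Function.support (fun c : Chain N => chainTerm κ n m c.1.1 c.2)).Finite := by
  refine (Set.finite_range _).subset (support_chainTerm_subset κ n m
    (M := ∑ l, (tail (n - m) l).toNat) (S := (weight (n - m)).toNat) (fun l => ?_)
    (Int.self_le_toNat _))
  calc tail (n - m) l ≤ (tail (n - m) l).toNat := Int.self_le_toNat _
    _ ≤ _ := by
      exact_mod_cast Finset.single_le_sum (f := fun l => (tail (n - m) l).toNat)
        (fun _ _ => Nat.zero_le _) (Finset.mem_univ l)

lemma u_eq_sum (κ : ℝ) (n m : IntVec N) {M S : ℕ}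
    (hM : ∀ l, tail (n - m) l ≤ M) (hS : weight (n - m) ≤ S) :
    u κ n m = ∑ c : (Σ s : Fin S, Fin (s + 1) → BStep N M),
      chainTerm κ n m (c.1 + 1) fun r => (c.2 r).toStep := by
  classical
  have h := support_chainTerm_subset κ n m hM hS
  rw [u, finsum_eq_sum_of_support_subset (s := Finset.univ.image (boundedChain N M S)) _
    (by simpa using h), Finset.sum_image fun a _ b _ hab => boundedChain_injective M S hab]
  rfl

/-- The product of the coefficients along a chain of steps that starts at `n`. -/
def chainCoeff (κ : ℝ) (n : IntVec N) {s : ℕ} (c : Fin s → Step N) : ℝ :=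
  ∏ r, (c r).coeff κ (n - ∑ l ∈ Finset.Iic r, (c l).vec)

/-- The sum over all chains of length `s`, which represents `(-L)^s f_n`. -/
def level (κ : ℝ) (n : IntVec N) (M s : ℕ) : Coef N :=
  ∑ c : Fin s → BStep N M, chainCoeff κ n (fun r => (c r).toStep) •
    fcoef κ (n - ∑ r, (c r).toStep.vec)

lemma level_zero (κ : ℝ) (n : IntVec N) (M : ℕ) : level κ n M 0 = fcoef κ n := by
  simp [level, chainCoeff]

/-- The factor of step `r` depends on steps up to `r` only. Appending a step therefore leaves the
earlier factors alone, and chains grow by applying the operator once more. -/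
lemma chainCoeff_snoc (κ : ℝ) (n : IntVec N) {s : ℕ} (c : Fin s → Step N) (t : Step N) :
    chainCoeff κ n (Fin.snoc c t : Fin (s + 1) → Step N) =
      chainCoeff κ n c * t.coeff κ (n - ∑ r, (c r).vec - t.vec) := by
  rw [chainCoeff, Fin.prod_univ_castSucc]
  congr 1
  · refine Finset.prod_congr rfl fun r _ => ?_
    rw [Fin.snoc_castSucc, ← Fin.map_castSuccEmb_Iic, Finset.sum_map]
    simp
  · rw [Fin.snoc_last, show Finset.Iic (Fin.last s) = Finset.univ from Finset.Iic_top,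
      Fin.sum_univ_castSucc]
    simp [sub_sub]

lemma level_succ (κ : ℝ) (n : IntVec N) (M s : ℕ) :
    level κ n M (s + 1) = ∑ c : Fin s → BStep N M, chainCoeff κ n (fun r => (c r).toStep) •
      ∑ t : BStep N M,
        t.toStep.coeff κ (n - ∑ r, (c r).toStep.vec - t.toStep.vec) •
          fcoef κ (n - ∑ r, (c r).toStep.vec - t.toStep.vec) := by
  rw [level, ← Fintype.sum_equiv (Fin.snocEquiv fun _ => BStep N M) _ _ fun _ => rfl,
    Fintype.sum_prod_type_right]
  refine Finset.sum_congr rfl fun c _ => ?_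
  rw [Finset.smul_sum]
  refine Finset.sum_congr rfl fun t _ => ?_
  have e : (fun r => (Fin.snocEquiv (fun _ => BStep N M) (t, c) r).toStep) =
      (Fin.snoc (fun r => (c r).toStep) t.toStep : Fin (s + 1) → Step N) := by
    funext r
    refine Fin.lastCases ?_ (fun i => ?_) r
    · simp [Fin.snocEquiv]
    · simp [Fin.snocEquiv]
  have e2 : ∑ r, (Fin.snocEquiv (fun _ => BStep N M) (t, c) r).toStep.vec =
      ∑ r, (c r).toStep.vec + t.toStep.vec := by
    have := congrArg (fun q : Fin (s + 1) → Step N => ∑ r, (q r).vec) e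
    refine this.trans ?_
    rw [Fin.sum_univ_castSucc]
    simp
  rw [e, e2, chainCoeff_snoc, smul_smul, sub_sub]

lemma weight_sub_sum_vec (n : IntVec N) {s : ℕ} (c : Fin s → Step N) :
    weight (n - ∑ r, (c r).vec) = weight n - 2 * s := by
  rw [weight_sub, weight_sum]
  simp only [Step.weight_vec, Finset.sum_const, Finset.card_univ, Fintype.card_fin, nsmul_eq_mul]
  ring

lemma tail_sub_sum_vec_le (n : IntVec N) {s : ℕ} (c : Fin s → Step N) (l : Fin N) :
    tail (n - ∑ r, (c r).vec) l ≤ tail n l := by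
  rw [tail_sub]
  linarith [cone_sum Finset.univ (fun r => (c r).vec) (fun r _ => (c r).cone_vec) l]

lemma level_mem_span (κ : ℝ) (n : IntVec N) (M s : ℕ) :
    level κ n M s ∈ Submodule.span ℝ (fcoef κ '' {m | weight m = weight n - 2 * s}) := by
  refine Submodule.sum_mem _ fun c _ => Submodule.smul_mem _ _ (Submodule.subset_span ?_)
  exact ⟨_, weight_sub_sum_vec n fun r => (c r).toStep, rfl⟩

lemma level_eq_zero (κ : ℝ) (n : IntVec N) (M s : ℕ) (h : weight n < 2 * s) :
    level κ n M s = 0 := by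
  refine Finset.sum_eq_zero fun c _ => ?_
  rw [fcoef_of_not_cone, smul_zero]
  intro hc
  have := hc.weight_nonneg
  rw [weight_sub_sum_vec n fun r => (c r).toStep] at this
  linarith

lemma isSymmetric_level (κ : ℝ) (n : IntVec N) (M s : ℕ) : (level κ n M s).IsSymmetric := by
  have : level κ n M s ∈ MvPolynomial.symmetricSubalgebra (Fin N) ℝ :=
    Subalgebra.sum_mem _ fun c _ => Subalgebra.smul_mem _ (isSymmetric_fcoef κ _) _
  exact this

/-- The value at `x` of the operator
`∑_j ∂_j² + 2 κ ∑_{i<j} (x_i - x_j)⁻¹ (∂_i - ∂_j)`. -/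
def laplaceEval (κ : ℝ) (x : Fin N → ℝ) : Coef N →ₗ[ℝ] ℝ where
  toFun Q := ∑ j, MvPolynomial.eval x (MvPolynomial.pderiv j (MvPolynomial.pderiv j Q)) +
    κ * ∑ i, ∑ j, (MvPolynomial.eval x (MvPolynomial.pderiv i Q) -
      MvPolynomial.eval x (MvPolynomial.pderiv j Q)) * (1 / (x i - x j))
  map_add' Q R := by
    have e : ∀ a b c d v : ℝ, (a + b - (c + d)) * v = (a - c) * v + (b - d) * v := by
      intros; ring
    simp only [map_add, Finset.sum_add_distrib, e]
    ring
  map_smul' c Q := by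
    have e : ∀ a b v : ℝ, (c * a - c * b) * v = c * ((a - b) * v) := by intros; ring
    simp only [Derivation.map_smul, MvPolynomial.smul_eval, e, ← Finset.mul_sum, smul_eq_mul,
      RingHom.id_apply]
    ring

/-- The value at `x` of the Euler operator. -/
def eulerEval (x : Fin N → ℝ) : Coef N →ₗ[ℝ] ℝ where
  toFun Q := ∑ j, x j * MvPolynomial.eval x (MvPolynomial.pderiv j Q)
  map_add' Q R := by simp only [map_add, mul_add, Finset.sum_add_distrib]
  map_smul' c Q := by
    simp only [Derivation.map_smul, MvPolynomial.smul_eval, smul_eq_mul, RingHom.id_apply,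
      Finset.mul_sum]
    exact Finset.sum_congr rfl fun j _ => by ring

lemma eulerEval_fcoef (κ : ℝ) (x : Fin N → ℝ) (n : IntVec N) :
    eulerEval x (fcoef κ n) = weight n * MvPolynomial.eval x (fcoef κ n) := by
  have := congrArg (MvPolynomial.eval x) (euler_fcoef κ n)
  simpa [eulerEval] using this

/-- At distinct positions `wcoef` evaluates to the difference quotient, so the polynomial identity
`laplace_fcoef` becomes a statement about the operator itself. -/
lemma laplaceEval_fcoef (κ : ℝ) {x : Fin N → ℝ} (hx : x ∈ config N) (n : IntVec N) (M : ℕ)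
    (hM : ∀ l, tail n l ≤ M) :
    laplaceEval κ x (fcoef κ n) = -MvPolynomial.eval x (∑ t : BStep N M,
      t.toStep.coeff κ (n - t.toStep.vec) • fcoef κ (n - t.toStep.vec)) := by
  have h := congrArg (MvPolynomial.eval x) (laplace_fcoef κ n M hM)
  rw [map_neg] at h
  have e1 : ∑ t : BStep N M, t.toStep.coeff κ (n - t.toStep.vec) • fcoef κ (n - t.toStep.vec) =
      ∑ p : {p : Fin N × Fin N // p.1 ≤ p.2}, ∑ ν ∈ Finset.range (M + 1),
      Step.coeff κ (p, ν) (n - Step.vec (p, ν)) • fcoef κ (n - Step.vec (p, ν)) := by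
    rw [Fintype.sum_prod_type]
    refine Finset.sum_congr rfl fun p _ => ?_
    rw [Finset.sum_range]
    rfl
  rw [e1, ← h]
  change ∑ j, _ + κ * ∑ i, ∑ j, _ = _
  simp only [map_add, map_sum, MvPolynomial.smul_eval]
  congr 2
  refine Finset.sum_congr rfl fun i _ => Finset.sum_congr rfl fun j _ => ?_
  split_ifs with hij
  · simp [hij]
  · have hne : x i - x j ≠ 0 := sub_ne_zero.2 fun h => hij (hx h)
    rw [← map_sub, pderiv_sub_pderiv_fcoef]
    simp
    field_simp

/-- Applying the operator lengthens each chain by one step, with a sign. One bound `M` serves at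
every stage because steps only lower tail sums. -/
lemma laplaceEval_level (κ : ℝ) {x : Fin N → ℝ} (hx : x ∈ config N) (n : IntVec N) (M s : ℕ)
    (hM : ∀ l, tail n l ≤ M) :
    laplaceEval κ x (level κ n M s) = -MvPolynomial.eval x (level κ n M (s + 1)) := by
  rw [level_succ, level, map_sum, map_sum, ← Finset.sum_neg_distrib]
  refine Finset.sum_congr rfl fun c _ => ?_
  rw [map_smul, laplaceEval_fcoef κ hx _ M
    fun l => (tail_sub_sum_vec_le n (fun r => (c r).toStep) l).trans (hM l),
    MvPolynomial.smul_eval, smul_eq_mul, mul_neg]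

lemma eulerEval_level (κ : ℝ) (x : Fin N → ℝ) (n : IntVec N) (M s : ℕ) :
    eulerEval x (level κ n M s) = (weight n - 2 * s) * MvPolynomial.eval x (level κ n M s) := by
  rw [level, map_sum, map_sum, Finset.mul_sum]
  refine Finset.sum_congr rfl fun c _ => ?_
  rw [map_smul, eulerEval_fcoef, weight_sub_sum_vec n fun r => (c r).toStep,
    MvPolynomial.smul_eval, smul_eq_mul]
  push_cast
  ring

lemma finite_tail_mem_Icc (a b : Fin N → ℤ) : {m : IntVec N | tail m ∈ Set.Icc a b}.Finite :=
  (Set.finite_Icc a b).preimage tail_injective.injOn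

/-- Tail sums of `m` are bounded above by `m ≺ n` and below by zero when `f_m ≠ 0`. -/
theorem finite_support_u_smul (κ : ℝ) (n : IntVec N) :
    (Function.support (fun m : Below n => u κ n m.1 • fcoef κ m.1)).Finite := by
  refine ((finite_tail_mem_Icc 0 (tail n)).preimage Subtype.val_injective.injOn).subset ?_
  intro m hm
  have hc : Cone m.1 := by
    by_contra hc
    exact hm (by simp only [fcoef_of_not_cone κ hc, smul_zero])
  exact ⟨fun l => hc l, fun l => m.2.1.1 l⟩

/-- `P_n` as the exponential of the lowering operator. -/
theorem P_eq_sum_level (κ : ℝ) (n : IntVec N) {M S : ℕ} (hM : ∀ l, tail n l ≤ M)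
    (hS : weight n ≤ S) :
    P κ (fcoef κ) n = ∑ s ∈ Finset.range (S + 1),
      (1 / ((4 : ℝ) ^ s * (s.factorial : ℝ))) • level κ n M s := by
  classical
  have hT := (finite_tail_mem_Icc 0 (tail n)).preimage
    (Subtype.val_injective (p := fun m => Prec m n ∧ weight m ≤ weight n - 2)).injOn
  have hsub : Function.support (fun m : Below n => u κ n m.1 • fcoef κ m.1) ⊆ hT.toFinset := by
    intro m hm
    rw [Set.Finite.coe_toFinset]
    have hc : Cone m.1 := by
      by_contra hc
      exact hm (by simp only [fcoef_of_not_cone κ hc, smul_zero])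
    exact ⟨fun l => hc l, fun l => m.2.1.1 l⟩
  have hu : ∀ m ∈ hT.toFinset, u κ n m.1 • fcoef κ m.1 =
      ∑ c : (Σ s : Fin S, Fin (s + 1) → BStep N M),
      chainTerm κ n m.1 (c.1 + 1) (fun r => (c.2 r).toStep) • fcoef κ m.1 := by
    intro m hm
    rw [Set.Finite.mem_toFinset] at hm
    have hc : Cone m.1 := fun l => hm.1 l
    rw [u_eq_sum κ n m.1 (M := M) (S := S), Finset.sum_smul]
    · intro l
      rw [tail_sub]
      linarith [hc l, hM l]
    · rw [weight_sub]
      linarith [hc.weight_nonneg]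
  have hc : ∀ (s : Fin S) (c : Fin (s + 1) → BStep N M), ∑ m ∈ hT.toFinset,
      chainTerm κ n m.1 (s + 1) (fun r => (c r).toStep) • fcoef κ m.1 =
      (1 / ((4 : ℝ) ^ ((s : ℕ) + 1) * (((s : ℕ) + 1).factorial : ℝ))) •
        (chainCoeff κ n (fun r => (c r).toStep) • fcoef κ (n - ∑ r, (c r).toStep.vec)) := by
    intro s c
    set v := ∑ r, (c r).toStep.vec with hv
    have hvc : Cone v := cone_sum _ _ fun r _ => (c r).toStep.cone_vec
    have hw : weight (n - v) = weight n - 2 * ((s : ℕ) + 1 : ℕ) :=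
      weight_sub_sum_vec n fun r => (c r).toStep
    -- The endpoint of any nonempty chain satisfies the restrictions on `m`, so they discard no term
    -- of the exponential series.
    have hb : Prec (n - v) n ∧ weight (n - v) ≤ weight n - 2 := by
      refine ⟨⟨fun l => tail_sub_sum_vec_le n (fun r => (c r).toStep) l, fun h => ?_⟩, ?_⟩
      · rw [h] at hw; push_cast at hw; omega
      · rw [hw]; push_cast; omega
    have hterm : ∀ m : Below n, chainTerm κ n m.1 (s + 1) (fun r => (c r).toStep) • fcoef κ m.1 =
        if m = ⟨n - v, hb⟩ then (1 / ((4 : ℝ) ^ ((s : ℕ) + 1) * (((s : ℕ) + 1).factorial : ℝ))) •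
        (chainCoeff κ n (fun r => (c r).toStep) • fcoef κ (n - v)) else 0 := by
      intro m
      rw [chainTerm]
      by_cases hm : m = ⟨n - v, hb⟩
      · have hm' : m.1 = n - v := congrArg Subtype.val hm
        rw [if_pos hm, hm', if_pos (by rw [← hv]; abel), mul_one, smul_smul]
        rfl
      · rw [if_neg hm, if_neg, mul_zero, zero_mul, zero_smul]
        intro h
        apply hm
        apply Subtype.ext
        rw [← hv] at h
        change m.1 = n - v
        exact eq_sub_of_add_eq h
    rw [Finset.sum_congr rfl fun m _ => hterm m, Finset.sum_ite_eq']
    split_ifs with hmem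
    · rfl
    -- An endpoint outside the finite index set lies off the cone, so both sides vanish.
    · rw [fcoef_of_not_cone, smul_zero, smul_zero]
      intro hcone
      apply hmem
      rw [Set.Finite.mem_toFinset]
      exact ⟨fun l => hcone l, fun l => tail_sub_sum_vec_le n (fun r => (c r).toStep) l⟩
  rw [P, finsum_eq_sum_of_support_subset _ hsub, Finset.sum_congr rfl hu, Finset.sum_comm,
    Fintype.sum_sigma]
  simp only [hc]
  rw [Finset.sum_range_succ', level_zero, add_comm, Finset.sum_range]
  congr 1
  · refine Finset.sum_congr rfl fun s _ => ?_
    rw [level, Finset.smul_sum]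
  · simp

lemma exists_tail_le (n : IntVec N) : ∃ M : ℕ, ∀ l, tail n l ≤ M :=
  ⟨∑ l, (tail n l).toNat, fun l => (Int.self_le_toNat _).trans (by
    exact_mod_cast Finset.single_le_sum (f := fun l => (tail n l).toNat)
      (fun _ _ => Nat.zero_le _) (Finset.mem_univ l))⟩

theorem isSymmetric_P (κ : ℝ) (n : IntVec N) : (P κ (fcoef κ) n).IsSymmetric := by
  obtain ⟨M, hM⟩ := exists_tail_le n
  rw [P_eq_sum_level κ n hM (Int.self_le_toNat _)]
  have : ∑ s ∈ Finset.range ((weight n).toNat + 1), (1 / ((4 : ℝ) ^ s * (s.factorial : ℝ))) •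
      level κ n M s ∈ MvPolynomial.symmetricSubalgebra (Fin N) ℝ :=
    Subalgebra.sum_mem _ fun s _ => Subalgebra.smul_mem _ (isSymmetric_level κ n _ s) _
  exact this

/-- With `e_s` the `s`-th iterate of `-L` on `f_n`, the coefficient of `e_s` in `-L P_n` is `4s/(4^s
s!)`, while `2D` contributes `2(|n| - 2s)/(4^s s!)`. The terms in `s` cancel, leaving `2|n| P_n`. -/
theorem laplaceEval_P (κ : ℝ) {x : Fin N → ℝ} (hx : x ∈ config N) (n : IntVec N) :
    laplaceEval κ x (P κ (fcoef κ) n) = 2 * eulerEval x (P κ (fcoef κ) n) -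
      2 * weight n * MvPolynomial.eval x (P κ (fcoef κ) n) := by
  obtain ⟨M, hM⟩ := exists_tail_le n
  rw [P_eq_sum_level κ n hM (Int.self_le_toNat (weight n))]
  set S := (weight n).toNat with hS
  simp only [map_sum, map_smul, MvPolynomial.smul_eval, laplaceEval_level κ hx n M _ hM,
    eulerEval_level, smul_eq_mul]
  set e : ℕ → ℝ := fun s => MvPolynomial.eval x (level κ n M s) with he
  -- Past half the weight of `n`, endpoints have negative weight and lie off the cone; the
  -- exponential series terminates and the index shift below has no boundary term.
  have hlast : e (S + 1) = 0 := by
    simp only [he]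
    rw [level_eq_zero κ n M (S + 1), map_zero]
    have := Int.self_le_toNat (weight n)
    push_cast
    omega
  have h1 : ∀ s : ℕ, 1 / ((4 : ℝ) ^ s * (s.factorial : ℝ)) * e (s + 1) =
      1 / ((4 : ℝ) ^ (s + 1) * ((s + 1).factorial : ℝ)) * (4 * ((s + 1 : ℕ) : ℝ)) * e (s + 1) := by
    intro s
    have : (s.factorial : ℝ) ≠ 0 := by positivity
    rw [Nat.factorial_succ]
    push_cast
    field_simp
    ring
  have h2 : ∑ s ∈ Finset.range (S + 1), 1 / ((4 : ℝ) ^ s * (s.factorial : ℝ)) * e (s + 1) =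
      ∑ s ∈ Finset.range (S + 1), 1 / ((4 : ℝ) ^ s * (s.factorial : ℝ)) * (4 * (s : ℝ)) * e s := by
    rw [Finset.sum_range_succ, hlast, Finset.sum_range_succ' (n := S),
      Finset.sum_congr rfl fun s _ => h1 s]
    simp
  simp only [Finset.mul_sum, ← Finset.sum_sub_distrib]
  have h3 : ∑ s ∈ Finset.range (S + 1), 1 / ((4 : ℝ) ^ s * (s.factorial : ℝ)) * -e (s + 1) =
      -∑ s ∈ Finset.range (S + 1), 1 / ((4 : ℝ) ^ s * (s.factorial : ℝ)) * e (s + 1) := by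
    simp only [mul_neg, Finset.sum_neg_distrib]
  rw [h3, h2, ← Finset.sum_neg_distrib]
  refine Finset.sum_congr rfl fun s _ => ?_
  change _ = 2 * (_ * ((weight n - 2 * s) * e s)) - 2 * weight n * (_ * e s)
  ring

theorem isReducedEigenfunction_P {κ : ℝ} (hκ : 0 < κ) (n : IntVec N) :
    IsReducedEigenfunction κ (energy κ n) (P κ (fcoef κ) n) :=
  isReducedEigenfunction_of_eval hκ (weight n) (isSymmetric_P κ n) fun _ hx =>
    laplaceEval_P κ hx n

end Calogero
end

/-! ### The products `g_n` as coefficients of the Cauchy factor. -/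

noncomputable section

namespace Calogero

variable {N : ℕ}

open MvPolynomial in
/-- The coefficient of `t^r` in `∏_j (1 - x_j t)^{-κ}`, given by Newton's recursion
`r g_r = κ ∑_{i=1}^r p_i g_{r-i}`. -/
def gNat (κ : ℝ) (N : ℕ) : ℕ → Coef N
  | 0 => 1
  | r + 1 => (κ / (r + 1)) • ∑ i : Fin (r + 1), psum (Fin N) ℝ (i + 1) * gNat κ N (r - i)

/-- The polynomials `g_r` for integers `r`; they vanish for negative `r`. -/
def gInt (κ : ℝ) (N : ℕ) (r : ℤ) : Coef N := if r < 0 then 0 else gNat κ N r.toNat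

lemma gInt_natCast (κ : ℝ) (r : ℕ) : gInt κ N r = gNat κ N r := by
  simp [gInt]

lemma gInt_zero (κ : ℝ) : gInt κ N 0 = 1 := by
  simp [gInt, gNat]

lemma gInt_of_neg (κ : ℝ) {r : ℤ} (h : r < 0) : gInt κ N r = 0 := if_pos h

/-- Since `g_r = 0` for `r < 0`, Newton's recursion holds for every integer `r` and every
sufficiently long range; a common range can then be used for all factors. -/
lemma smul_gInt (κ : ℝ) (r : ℤ) (M : ℕ) (hM : r ≤ M) :
    (r : ℝ) • gInt κ N r =
      κ • ∑ i ∈ Finset.range M, MvPolynomial.psum (Fin N) ℝ (i + 1) * gInt κ N (r - (i + 1)) := by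
  rcases le_or_gt r 0 with h | h
  · rw [Finset.sum_eq_zero fun i _ => by rw [gInt_of_neg κ (by omega), mul_zero], smul_zero]
    rcases h.lt_or_eq with h | rfl
    · rw [gInt_of_neg κ h, smul_zero]
    · simp
  · obtain ⟨s, rfl⟩ : ∃ s : ℕ, r = ((s + 1 : ℕ) : ℤ) := ⟨(r - 1).toNat, by omega⟩
    have hs : s + 1 ≤ M := by exact_mod_cast hM
    rw [gInt_natCast, gNat, smul_smul, Finset.sum_range
      (f := fun i : ℕ => MvPolynomial.psum (Fin N) ℝ (i + 1) * gInt κ N (((s + 1 : ℕ) : ℤ) - (i + 1)))]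
    have h1 : (((s + 1 : ℕ) : ℤ) : ℝ) * (κ / ((s : ℝ) + 1)) = κ := by
      have : (s : ℝ) + 1 ≠ 0 := by positivity
      push_cast
      field_simp
    rw [h1]
    congr 1
    rw [← Finset.sum_range (f := fun i : ℕ => MvPolynomial.psum (Fin N) ℝ (i + 1) * gNat κ N (s - i)),
      ← Finset.sum_range (f := fun i : ℕ =>
        MvPolynomial.psum (Fin N) ℝ (i + 1) * gInt κ N (((s + 1 : ℕ) : ℤ) - (i + 1)))]
    rw [← Finset.sum_subset (Finset.range_subset_range.2 hs)]
    · refine Finset.sum_congr rfl fun i hi => ?_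
      have := Finset.mem_range.1 hi
      rw [show ((s + 1 : ℕ) : ℤ) - (i + 1) = ((s - i : ℕ) : ℤ) by omega, gInt_natCast]
    · intro i _ hi
      rw [Finset.mem_range, not_lt] at hi
      rw [gInt_of_neg κ (by omega), mul_zero]

/-- The products `∏_k g_{n_k}`. -/
def gprod (κ : ℝ) (n : IntVec N) : Coef N := ∏ k, gInt κ N (n k)

lemma gprod_comp (κ : ℝ) (n : IntVec N) (σ : Equiv.Perm (Fin N)) :
    gprod κ (n ∘ σ) = gprod κ n :=
  Equiv.prod_comp σ fun k => gInt κ N (n k)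

lemma gprod_of_neg (κ : ℝ) {n : IntVec N} {k : Fin N} (h : n k < 0) : gprod κ n = 0 :=
  Finset.prod_eq_zero (Finset.mem_univ k) (gInt_of_neg κ h)

lemma smul_gprod (κ : ℝ) (n : IntVec N) (k : Fin N) (M : ℕ) (hM : n k ≤ M) :
    (n k : ℝ) • gprod κ n = κ • ∑ i ∈ Finset.range M,
      MvPolynomial.psum (Fin N) ℝ (i + 1) * gprod κ (n - (i + 1 : ℤ) • Pi.single k 1) := by
  have h1 : ∀ i : ℤ, gprod κ (n - i • Pi.single k 1) =
      gInt κ N (n k - i) * ∏ l ∈ Finset.univ.erase k, gInt κ N (n l) := by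
    intro i
    rw [gprod, ← Finset.mul_prod_erase _ _ (Finset.mem_univ k)]
    congr 1
    · simp
    · refine Finset.prod_congr rfl fun l hl => ?_
      simp [(Finset.mem_erase.1 hl).1]
  have h0 := h1 0
  rw [zero_smul, sub_zero, sub_zero] at h0
  rw [h0, ← smul_mul_assoc, smul_gInt κ (n k) M hM, smul_mul_assoc, Finset.sum_mul]
  congr 1
  refine Finset.sum_congr rfl fun i _ => ?_
  rw [h1, mul_assoc]

lemma mul_inv1_eq {u : Series N} (hu : MvPowerSeries.constantCoeff u = 0) (M : ℕ) :
    u * inv1 u = ∑ i ∈ Finset.range M, u ^ (i + 1) + u ^ (M + 1) * inv1 u := by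
  induction M with
  | zero => simp
  | succ M ih =>
    rw [ih, Finset.sum_range_succ]
    have h := one_sub_mul_inv1 hu
    linear_combination (u ^ (M + 1)) * h

lemma cf_xC_mul_eta_pow_mul (j k : Fin N) (i : ℕ) (φ : Series N) (n : IntVec N) :
    cf ((xC j * eta k) ^ i * φ) n = MvPolynomial.X j ^ i * cf φ (n - (i : ℤ) • Pi.single k 1) := by
  rw [mul_pow, mul_assoc, xC, ← map_pow, cf_C_mul, eta, ← mon_nsmul (cone_single k),
    cf_mon_mul ((cone_single k).nsmul i), natCast_zsmul]

/-- The logarithmic derivative of the Cauchy factor is a sum of geometric series in `x_j / y_k`,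
whose powers add up to power sums. Beyond `M` the shifted index leaves the cone. -/
lemma smul_cf_cauchy (κ : ℝ) (n : IntVec N) (k : Fin N) (M : ℕ) (hM : tail n k ≤ M) :
    (n k : ℝ) • cf (cauchy κ N) n = κ • ∑ i ∈ Finset.range M,
      MvPolynomial.psum (Fin N) ℝ (i + 1) * cf (cauchy κ N) (n - (i + 1 : ℤ) • Pi.single k 1) := by
  have h := congrArg (fun φ => cf φ n) (yder_cauchy (N := N) κ k)
  have hj : ∀ j : Fin N, cf (cauchy κ N * (xC j * eta k * inv1 (xC j * eta k))) n =
      ∑ i ∈ Finset.range M, MvPolynomial.X j ^ (i + 1) *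
        cf (cauchy κ N) (n - (i + 1 : ℤ) • Pi.single k 1) := by
    intro j
    rw [mul_inv1_eq (constantCoeff_xC_mul_eta j k) M, mul_add, Finset.mul_sum, cf_add, cf_sum]
    have h0 : cf (cauchy κ N * ((xC j * eta k) ^ (M + 1) * inv1 (xC j * eta k))) n = 0 := by
      rw [mul_left_comm, cf_xC_mul_eta_pow_mul, cf_of_not_cone, mul_zero]
      intro hc
      have := hc k
      rw [tail_sub, tail_smul, tail_single, if_pos le_rfl] at this
      push_cast at this
      omega
    rw [h0, add_zero]
    refine Finset.sum_congr rfl fun i _ => ?_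
    rw [mul_comm (cauchy κ N), cf_xC_mul_eta_pow_mul]
    push_cast
    rfl
  rw [cf_yder, mul_left_comm, cf_cst_mul, Finset.mul_sum, cf_sum, Finset.sum_congr rfl fun j _ => hj j,
    Finset.sum_comm] at h
  rw [MvPolynomial.smul_eq_C_mul]
  rw [show (MvPolynomial.C (n k : ℝ) : Coef N) = (n k : Coef N) by simp, h]
  congr 1
  refine Finset.sum_congr rfl fun i _ => ?_
  rw [MvPolynomial.psum, Finset.sum_mul]

lemma constantCoeff_pw (s : ℝ) (a : Coef N) {m : IntVec N} (hm : Cone m) (h0 : m ≠ 0) :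
    MvPowerSeries.constantCoeff (pw s (MvPowerSeries.C a * mon m)) = 1 := by
  have := coeff_sub_C_mul_mon (N := N) hm h0 a (oneSubPow s) 0
  rw [pw]
  simpa [oneSubPow] using this

/-- Both sides obey the same recursion. For `n ≠ 0` a direction `k` with `n_k ≠ 0` expresses the
value at `n` through indices of smaller weight; for negative weight both sides vanish. -/
lemma cf_cauchy (κ : ℝ) (n : IntVec N) : cf (cauchy κ N) n = gprod κ n := by
  suffices H : ∀ w : ℕ, ∀ n : IntVec N, weight n < w → cf (cauchy κ N) n = gprod κ n from
    H ((weight n).toNat + 1) n (by have := Int.self_le_toNat (weight n); push_cast; omega)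
  intro w
  induction w with
  | zero =>
    intro n hn
    rw [cf_of_not_cone fun hc => absurd hc.weight_nonneg (by simpa using hn)]
    have : ∃ k, n k < 0 := by
      by_contra! h
      exact absurd (Finset.sum_nonneg fun k (_ : k ∈ Finset.univ) => h k)
        (by simpa [weight] using hn)
    obtain ⟨k, hk⟩ := this
    rw [gprod_of_neg κ hk]
  | succ w ih =>
    intro n hn
    by_cases h0 : n = 0
    · subst h0
      have h1 : cf (cauchy κ N) 0 = MvPowerSeries.constantCoeff (cauchy κ N) := by
        rw [cf_of_cone cone_zero, tailExp_zero, MvPowerSeries.coeff_zero_eq_constantCoeff_apply]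
      rw [h1, cauchy, map_prod, gprod]
      refine Finset.prod_congr rfl fun k _ => ?_
      rw [map_prod, Pi.zero_apply, gInt_zero]
      exact Finset.prod_eq_one fun j _ =>
        constantCoeff_pw _ _ (cone_single k) (single_ne_zero' k)
    · obtain ⟨k, hk⟩ := Function.ne_iff.1 h0
      have hk' : (n k : ℝ) ≠ 0 := by exact_mod_cast hk
      have hM1 := Int.self_le_toNat (tail n k)
      have hM2 := Int.self_le_toNat (n k)
      set M := max (tail n k).toNat (n k).toNat with hMdef
      refine smul_right_injective _ hk' ?_
      change (n k : ℝ) • _ = (n k : ℝ) • _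
      rw [smul_cf_cauchy κ n k M (by omega), smul_gprod κ n k M (by omega)]
      congr 1
      refine Finset.sum_congr rfl fun i _ => ?_
      rw [ih]
      rw [weight_sub]
      have : weight ((i + 1 : ℤ) • Pi.single k (1 : ℤ) : IntVec N) = i + 1 := by
        simp [weight, ← Finset.mul_sum]
      rw [this]
      push_cast at hn
      omega

end Calogero
end

/-! ### Triangularity of `P_λ` over the `g_λ`. -/

noncomputable section

namespace Calogero

variable {N : ℕ}

lemma coeff_raising_mem_range (κ : ℝ) (d : Fin N →₀ ℕ) :
    ∃ r : ℝ, MvPowerSeries.coeff d (raising κ N) = MvPolynomial.C r := by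
  classical
  let S := (MvPowerSeries.map (σ := Fin N) (MvPolynomial.C : ℝ →+* Coef N)).range
  have hS : ∀ φ : Series N, (∀ d, ∃ r : ℝ, MvPowerSeries.coeff d φ = MvPolynomial.C r) → φ ∈ S := by
    intro φ h
    choose r hr using h
    let ψ : MvPowerSeries (Fin N) ℝ := fun d => r d
    have hψ : ∀ d, MvPowerSeries.coeff d ψ = r d := fun _ => rfl
    refine ⟨ψ, MvPowerSeries.ext fun d => ?_⟩
    rw [MvPowerSeries.coeff_map, hr, hψ]
  have h : raising κ N ∈ S := by
    refine Subring.prod_mem _ fun p hp => hS _ fun d => ?_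
    have hlt := (Finset.mem_filter.1 hp).2
    have h1 : pw κ (rat p.1 p.2) = sub (MvPowerSeries.C 1 * mon (Pi.single p.2 1 - Pi.single p.1 1))
        (oneSubPow κ) := by
      rw [map_one, one_mul]; rfl
    rw [h1]
    by_cases hd : d ∈ Set.range fun i : ℕ =>
        i • tailExp (Pi.single p.2 1 - Pi.single p.1 1 : IntVec N)
    · obtain ⟨i, rfl⟩ := hd
      refine ⟨PowerSeries.coeff i (oneSubPow κ), ?_⟩
      change MvPowerSeries.coeff (i • tailExp (Pi.single p.2 1 - Pi.single p.1 1 : IntVec N)) _ = _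
      rw [coeff_sub_C_mul_mon (cone_sub hlt) (sub_single_ne_zero hlt), one_pow,
        MvPolynomial.smul_eq_C_mul, mul_one]
    · exact ⟨0, by rw [coeff_sub_C_mul_mon_of_notMem (cone_sub hlt) (sub_single_ne_zero hlt) _ _ _ hd,
        map_zero]⟩
  obtain ⟨ψ, hψ⟩ := h
  exact ⟨MvPowerSeries.coeff d ψ, by rw [← hψ, MvPowerSeries.coeff_map]⟩

lemma constantCoeff_raising (κ : ℝ) : MvPowerSeries.constantCoeff (raising κ N) = 1 := by
  rw [raising, map_prod]
  refine Finset.prod_eq_one fun p hp => ?_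
  have hlt := (Finset.mem_filter.1 hp).2
  have := constantCoeff_pw (N := N) κ 1 (cone_sub hlt) (sub_single_ne_zero hlt)
  rwa [map_one, one_mul] at this

/-- The total degree operator `∑ yder k` annihilates every ratio `y_j / y_k`, hence the whole
product. -/
lemma cf_raising_of_weight_ne_zero (κ : ℝ) {n : IntVec N} (hn : weight n ≠ 0) :
    cf (raising κ N) n = 0 := by
  have hD : ∀ φ : Series N, (∑ k, yder k : Derivation ℝ (Series N) (Series N)) φ = ∑ k, yder k φ :=
    fun φ => (congrFun (map_sum Derivation.coeFnAddMonoidHom yder Finset.univ) φ).trans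
      (Finset.sum_apply _ _ _)
  have h : (∑ k, yder k : Derivation ℝ (Series N) (Series N)) (raising κ N) = 0 := by
    rw [derivation_raising, Finset.sum_eq_zero, mul_zero]
    intro p hp
    have : (∑ k, yder k : Derivation ℝ (Series N) (Series N)) (rat p.1 p.2) = 0 := by
      rw [hD,
        Finset.sum_congr rfl fun k _ => yder_rat k (Finset.mem_filter.1 hp).2, ← Finset.sum_mul]
      simp
    rw [this, zero_mul, mul_zero, neg_zero]
  have h2 := congrArg (fun φ => cf φ n) h
  simp only [hD, cf_sum, cf_yder, cf_zero,
    ← Finset.sum_mul] at h2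
  have h3 : (∑ k, (n k : Coef N)) = ((weight n : ℤ) : Coef N) := by
    rw [weight]; push_cast; rfl
  rw [h3] at h2
  exact (mul_eq_zero.1 h2).resolve_left (by exact_mod_cast hn)

/-- The statistic `∑_k k n_k`. -/
def stat (n : IntVec N) : ℤ := ∑ k : Fin N, ((k : ℕ) : ℤ) * n k

lemma stat_sub (m n : IntVec N) : stat (m - n) = stat m - stat n := by
  simp [stat, mul_sub, Finset.sum_sub_distrib]

lemma sum_tail (n : IntVec N) : ∑ l, tail n l = stat n + weight n := by
  have h : ∀ l, tail n l = ∑ k, if l ≤ k then n k else 0 := by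
    intro l
    rw [tail, ← Finset.sum_filter]
    refine Finset.sum_congr ?_ fun _ _ => rfl
    ext; simp
  rw [Finset.sum_congr rfl fun l _ => h l, Finset.sum_comm, stat, weight, ← Finset.sum_add_distrib]
  refine Finset.sum_congr rfl fun k _ => ?_
  rw [← Finset.sum_filter, Finset.sum_const,
    show Finset.univ.filter (fun l : Fin N => l ≤ k) = Finset.Iic k by ext; simp, Fin.card_Iic]
  simp; ring

/-- At weight zero the statistic is the sum of the tail sums, which are nonnegative and not all
zero. -/
lemma Cone.stat_pos {n : IntVec N} (hn : Cone n) (h0 : n ≠ 0) (hw : weight n = 0) : 0 < stat n := by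
  have h := sum_tail n
  rw [hw, add_zero] at h
  rw [← h]
  refine Finset.sum_pos' (fun l _ => hn l) ?_
  by_contra! hc
  apply h0
  apply tail_injective
  funext l
  rw [tail_zero]
  exact le_antisymm (hc l (Finset.mem_univ l)) (hn l)

/-- The rearrangement inequality: placing the large entries first minimises `∑ k n_k`. -/
lemma exists_antitone_comp (n : IntVec N) : ∃ σ : Equiv.Perm (Fin N),
    Antitone (n ∘ σ) ∧ stat (n ∘ σ) ≤ stat n := by
  refine ⟨Tuple.sort (OrderDual.toDual ∘ n), ?_⟩
  set σ := Tuple.sort (OrderDual.toDual ∘ n) with hσ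
  have h1 : Antitone (n ∘ σ) := fun i j hij => Tuple.monotone_sort (OrderDual.toDual ∘ n) hij
  refine ⟨h1, ?_⟩
  have h2 : Antivary (fun k : Fin N => ((k : ℕ) : ℤ)) (n ∘ σ) :=
    Monotone.antivary (fun i j hij => by exact_mod_cast hij) h1
  have h3 := h2.sum_mul_le_sum_mul_comp_perm (σ := σ⁻¹)
  simpa [stat] using h3

/-- Multiplying out the two factors of the kernel gives `f_n = ∑ r_d g_{n-d}` with scalars `r_d` and
`r_0 = 1`. Only `d` in the cone of weight zero occur, and `d ≠ 0` strictly lowers the statistic. -/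
lemma fcoef_sub_gprod_mem (κ : ℝ) (n : IntVec N) : fcoef κ n - gprod κ n ∈
    Submodule.span ℝ (gprod κ '' {m | weight m = weight n ∧ stat m < stat n}) := by
  classical
  by_cases hn : Cone n
  · rw [fcoef, kernel, cf_of_cone hn, MvPowerSeries.coeff_mul,
      ← Finset.add_sum_erase _ _ (show ((0 : Fin N →₀ ℕ), tailExp n) ∈
        Finset.HasAntidiagonal.antidiagonal (tailExp n) by simp)]
    dsimp only
    rw [MvPowerSeries.coeff_zero_eq_constantCoeff_apply, constantCoeff_raising, one_mul,
      ← cf_of_cone hn, cf_cauchy, add_sub_cancel_left]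
    refine Submodule.sum_mem _ fun p hp => ?_
    obtain ⟨hp0, hp⟩ := Finset.mem_erase.1 hp
    rw [Finset.HasAntidiagonal.mem_antidiagonal] at hp
    obtain ⟨r, hr⟩ := coeff_raising_mem_range κ p.1
    by_cases hw : weight (ofExp p.1) = 0
    · rw [hr, ← cf_ofExp, cf_cauchy, ← MvPolynomial.smul_eq_C_mul]
      refine Submodule.smul_mem _ _ (Submodule.subset_span ⟨_, ?_, rfl⟩)
      have h1 : ofExp p.1 + ofExp p.2 = n := by rw [← ofExp_add, hp, ofExp_tailExp hn]
      have h2 : ofExp p.2 = n - ofExp p.1 := eq_sub_of_add_eq' h1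
      have h3 : ofExp p.1 ≠ 0 := by
        intro h
        have : p.1 = 0 := by
          rw [← tailExp_ofExp p.1, h, tailExp_zero]
        apply hp0
        rw [this, zero_add] at hp
        exact Prod.ext this hp
      have h4 := (cone_ofExp p.1).stat_pos h3 hw
      constructor
      · rw [h2, weight_sub, hw, sub_zero]
      · rw [h2, stat_sub]; linarith
    · rw [← cf_ofExp, cf_raising_of_weight_ne_zero κ hw, zero_mul]
      exact Submodule.zero_mem _
  · rw [fcoef_of_not_cone κ hn, ← cf_cauchy, cf_of_not_cone hn, sub_zero]
    exact Submodule.zero_mem _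

/-- The rank of a partition: its weight, then the statistic `∑_k k n_k`. -/
def rank (l : Part N) : ℕ ×ₗ ℕ := toLex ((weight l.1).toNat, (stat l.1).toNat)

lemma weight_part_nonneg (l : Part N) : 0 ≤ weight l.1 := Finset.sum_nonneg fun k _ => l.2.2 k

lemma stat_part_nonneg (l : Part N) : 0 ≤ stat l.1 :=
  Finset.sum_nonneg fun k _ => mul_nonneg (by positivity) (l.2.2 k)

lemma weight_comp (n : IntVec N) (σ : Equiv.Perm (Fin N)) : weight (n ∘ σ) = weight n :=
  Equiv.sum_comp σ n

lemma gprod_eq_zero_or (κ : ℝ) (n : IntVec N) : gprod κ n = 0 ∨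
    ∃ l : Part N, gprod κ n = gprod κ l.1 ∧ weight l.1 = weight n ∧ stat l.1 ≤ stat n := by
  by_cases h : ∃ k, n k < 0
  · obtain ⟨k, hk⟩ := h
    exact Or.inl (gprod_of_neg κ hk)
  · push Not at h
    obtain ⟨σ, h1, h2⟩ := exists_antitone_comp n
    exact Or.inr ⟨⟨n ∘ σ, h1, fun k => h _⟩, (gprod_comp κ n σ).symm, weight_comp n σ, h2⟩

lemma fcoef_mem_span_gprod (κ : ℝ) (n : IntVec N) : fcoef κ n ∈
    Submodule.span ℝ ((fun l : Part N => gprod κ l.1) '' {l | weight l.1 = weight n}) := by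
  have hg : ∀ m : IntVec N, weight m = weight n → gprod κ m ∈
      Submodule.span ℝ ((fun l : Part N => gprod κ l.1) '' {l | weight l.1 = weight n}) := by
    intro m hm
    rcases gprod_eq_zero_or κ m with h | ⟨l, h1, h2, -⟩
    · rw [h]; exact Submodule.zero_mem _
    · rw [h1]; exact Submodule.subset_span ⟨l, h2.trans hm, rfl⟩
  rw [← sub_add_cancel (fcoef κ n) (gprod κ n)]
  refine Submodule.add_mem _ ?_ (hg n rfl)
  refine Submodule.span_le.2 ?_ (fcoef_sub_gprod_mem κ n)
  rintro _ ⟨m, hm, rfl⟩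
  exact hg m hm.1

lemma fcoef_sub_gprod_mem_span_rank (κ : ℝ) (l : Part N) : fcoef κ l.1 - gprod κ l.1 ∈
    Submodule.span ℝ ((fun l : Part N => gprod κ l.1) '' {m | rank m < rank l}) := by
  refine Submodule.span_le.2 ?_ (fcoef_sub_gprod_mem κ l.1)
  rintro _ ⟨m, hm, rfl⟩
  rcases gprod_eq_zero_or κ m with h | ⟨m', h1, h2, h3⟩
  · rw [h]; exact Submodule.zero_mem _
  · rw [h1]
    refine Submodule.subset_span ⟨m', ?_, rfl⟩
    rw [Set.mem_ofPred_eq, rank, rank, Prod.Lex.toLex_lt_toLex]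
    have := stat_part_nonneg m'
    have := hm.2
    exact Or.inr ⟨by simp [h2, hm.1], by dsimp only; omega⟩

/-- Level `0` is `f_λ`, which differs from `g_λ` at equal weight by terms of smaller statistic;
levels `s ≥ 1` have smaller weight. Hence the lexicographic rank. -/
lemma P_sub_gprod_mem_span_rank (κ : ℝ) (l : Part N) : P κ (fcoef κ) l.1 - gprod κ l.1 ∈
    Submodule.span ℝ ((fun l : Part N => gprod κ l.1) '' {m | rank m < rank l}) := by
  obtain ⟨M, hM⟩ := exists_tail_le l.1
  rw [P_eq_sum_level κ l.1 hM (Int.self_le_toNat _), Finset.sum_range_succ', level_zero]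
  simp only [pow_zero, Nat.factorial_zero, Nat.cast_one, mul_one, div_one, one_smul]
  rw [add_sub_assoc]
  refine Submodule.add_mem _ (Submodule.sum_mem _ fun s _ => Submodule.smul_mem _ _ ?_)
    (fcoef_sub_gprod_mem_span_rank κ l)
  refine Submodule.span_le.2 ?_ (level_mem_span κ l.1 M (s + 1))
  rintro _ ⟨m, hm, rfl⟩
  refine Submodule.span_mono (Set.image_mono ?_) (fcoef_mem_span_gprod κ m)
  intro m' hm'
  rw [Set.mem_ofPred_eq] at hm hm' ⊢
  rw [rank, rank, Prod.Lex.toLex_lt_toLex]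
  have := weight_part_nonneg m'
  push_cast at hm
  left
  dsimp only
  omega

section Triangular

variable {ι V α : Type*} [AddCommGroup V] [Module ℝ V] [LinearOrder α]
  {ρ : ι → α} {v w : ι → V}

lemma mem_span_of_triangular [WellFoundedLT α]
    (h : ∀ i, w i - v i ∈ Submodule.span ℝ (v '' {j | ρ j < ρ i})) (i : ι) :
    v i ∈ Submodule.span ℝ (Set.range w) := by
  induction i using (InvImage.wf ρ (wellFounded_lt (α := α))).induction with
  | _ i ih =>
    rw [← sub_sub_cancel (w i) (v i)]
    refine Submodule.sub_mem _ (Submodule.subset_span ⟨i, rfl⟩) (Submodule.span_le.2 ?_ (h i))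
    rintro _ ⟨j, hj, rfl⟩
    exact ih j hj

/-- In a vanishing combination, consider an index `i` of maximal rank with nonzero coefficient. The
corrections have strictly smaller rank and so never involve `v i`; ties in rank are harmless. -/
lemma linearIndependent_of_triangular (hv : LinearIndependent ℝ v)
    (h : ∀ i, w i - v i ∈ Submodule.span ℝ (v '' {j | ρ j < ρ i})) : LinearIndependent ℝ w := by
  classical
  rw [linearIndependent_iff']
  intro s a hs
  by_contra! hc
  obtain ⟨i0, hi0⟩ := hc
  obtain ⟨i, hi, hmax⟩ := Finset.exists_max_image (s.filter fun i => a i ≠ 0) ρ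
    ⟨i0, Finset.mem_filter.2 hi0⟩
  obtain ⟨his, hai⟩ := Finset.mem_filter.1 hi
  have hlow : ∀ j ∈ s, a j • (w j - v j) ∈ Submodule.span ℝ (v '' {i}ᶜ) := by
    intro j hj
    by_cases h0 : a j = 0
    · rw [h0, zero_smul]; exact Submodule.zero_mem _
    · refine Submodule.smul_mem _ _ (Submodule.span_mono (Set.image_mono ?_) (h j))
      intro k hk hki
      rw [Set.mem_singleton_iff] at hki
      subst hki
      exact absurd (hmax j (Finset.mem_filter.2 ⟨hj, h0⟩)) (not_le.2 hk)
  have h1 : a i • v i = -(∑ j ∈ s, a j • (w j - v j)) - ∑ j ∈ s.erase i, a j • v j := by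
    simp only [smul_sub, Finset.sum_sub_distrib, hs]
    rw [← Finset.add_sum_erase s (fun j => a j • v j) his]
    abel
  have h2 : a i • v i ∈ Submodule.span ℝ (v '' {i}ᶜ) := by
    rw [h1]
    refine Submodule.sub_mem _ (Submodule.neg_mem _ (Submodule.sum_mem _ hlow))
      (Submodule.sum_mem _ fun j hj => Submodule.smul_mem _ _ (Submodule.subset_span ⟨j, ?_, rfl⟩))
    exact (Finset.mem_erase.1 hj).1
  have h3 := (Submodule.smul_mem_iff _ hai).1 h2
  exact hv.notMem_span_image (s := {i}ᶜ) (by simp) h3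

end Triangular

end Calogero
end

/-! ### The `g_λ` form a basis: a positivity argument. -/

noncomputable section

namespace Calogero

variable {N : ℕ}

section PowerSums

open MvPolynomial

lemma mem_of_isHomogeneous {C : Coef N} {d : ℕ} (hC : C.IsHomogeneous d)
    (S : Submodule ℝ (Coef N)) (h : ∀ b : Fin N →₀ ℕ, b.degree = d → monomial b 1 ∈ S) :
    C ∈ S := by
  rw [C.as_sum]
  refine Submodule.sum_mem _ fun b hb => ?_
  have : monomial b (coeff b C) = coeff b C • (monomial b 1 : Coef N) := by simp [smul_monomial]
  rw [this]
  refine Submodule.smul_mem _ _ (h b ?_)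
  by_contra hd
  exact mem_support_iff.1 hb (hC.coeff_eq_zero hd)

/-- Newton's identities express `k e_k` through lower `e_i` and power sums, and `k` is invertible
over `ℝ`. -/
lemma esymm_mem_adjoin_psum (k : ℕ) : esymm (Fin N) ℝ k ∈
    Algebra.adjoin ℝ (Set.range fun i : ℕ => psum (Fin N) ℝ (i + 1)) := by
  induction k using Nat.strong_induction_on with
  | _ k ih =>
    rcases Nat.eq_zero_or_pos k with rfl | hk
    · rw [esymm_zero]; exact Subalgebra.one_mem _
    · have hk' : (k : ℝ) ≠ 0 := by positivity
      have h := mul_esymm_eq_sum (Fin N) ℝ k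
      have h2 : (k : ℝ) • esymm (Fin N) ℝ k ∈
          Algebra.adjoin ℝ (Set.range fun i : ℕ => psum (Fin N) ℝ (i + 1)) := by
        rw [smul_eq_C_mul, map_natCast, h]
        have h1 : ∀ i : ℕ, (-1 : Coef N) ^ i ∈
            Algebra.adjoin ℝ (Set.range fun i : ℕ => psum (Fin N) ℝ (i + 1)) := fun i =>
          Subalgebra.pow_mem _ (Subalgebra.neg_mem _ (Subalgebra.one_mem _)) _
        refine Subalgebra.mul_mem _ (h1 _) (Subalgebra.sum_mem _ fun a ha => ?_)
        obtain ⟨ha, hlt⟩ := Finset.mem_filter.1 ha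
        rw [Finset.HasAntidiagonal.mem_antidiagonal] at ha
        refine Subalgebra.mul_mem _ (Subalgebra.mul_mem _ (h1 _) (ih _ hlt))
          (Algebra.subset_adjoin ⟨a.2 - 1, ?_⟩)
        simp only
        congr 1
        omega
      have h3 := Subalgebra.smul_mem _ h2 (k : ℝ)⁻¹
      rwa [smul_smul, inv_mul_cancel₀ hk', one_smul] at h3

lemma mem_adjoin_psum {h : Coef N} (hh : h.IsSymmetric) :
    h ∈ Algebra.adjoin ℝ (Set.range fun i : ℕ => psum (Fin N) ℝ (i + 1)) := by
  obtain ⟨p, hp⟩ := esymmAlgHom_surjective (σ := Fin N) (R := ℝ) (n := N) (by simp) ⟨h, hh⟩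
  have h1 := esymmAlgHom_apply (σ := Fin N) (R := ℝ) p
  rw [hp] at h1
  change h = _ at h1
  have h2 : h ∈ (aeval (fun i : Fin N => esymm (Fin N) ℝ (i + 1)) : Coef N →ₐ[ℝ] Coef N).range :=
    ⟨p, h1.symm⟩
  rw [← Algebra.adjoin_range_eq_range_aeval] at h2
  refine Algebra.adjoin_le ?_ h2
  rintro _ ⟨i, rfl⟩
  exact esymm_mem_adjoin_psum _

/-- The inner product for which the monomials are orthonormal. -/
def pairing : Coef N →ₗ[ℝ] Coef N →ₗ[ℝ] ℝ :=
  (basisMonomials (Fin N) ℝ).constr ℝ fun b => lcoeff ℝ b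

lemma pairing_monomial (b : Fin N →₀ ℕ) (h : Coef N) : pairing (monomial b 1) h = coeff b h := by
  have := (basisMonomials (Fin N) ℝ).constr_basis ℝ (fun b => lcoeff ℝ b) b
  rw [coe_basisMonomials] at this
  exact congrArg (fun φ : Coef N →ₗ[ℝ] ℝ => φ h) this

lemma pairing_apply (C h : Coef N) : pairing C h = ∑ b ∈ C.support, coeff b C * coeff b h := by
  conv_lhs => rw [C.as_sum]
  rw [map_sum, LinearMap.sum_apply]
  refine Finset.sum_congr rfl fun b _ => ?_
  have : monomial b (coeff b C) = coeff b C • (monomial b 1 : Coef N) := by simp [smul_monomial]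
  rw [this, map_smul, LinearMap.smul_apply, pairing_monomial, smul_eq_mul]

lemma pairing_self_nonneg (C : Coef N) : 0 ≤ pairing C C := by
  rw [pairing_apply]
  exact Finset.sum_nonneg fun b _ => mul_self_nonneg _

lemma eq_zero_of_pairing_self {C : Coef N} (h : pairing C C = 0) : C = 0 := by
  rw [pairing_apply, Finset.sum_eq_zero_iff_of_nonneg fun b _ => mul_self_nonneg _] at h
  rw [← support_eq_empty]
  refine Finset.eq_empty_of_forall_notMem fun b hb => ?_
  exact mem_support_iff.1 hb (mul_self_eq_zero.1 (h b hb))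

/-- The adjoint of the multiplication by the power sum `p_r`. -/
def lower (r : ℕ) : Coef N →ₗ[ℝ] Coef N :=
  (basisMonomials (Fin N) ℝ).constr ℝ fun b =>
    ∑ k, if r ≤ b k then monomial (b - Finsupp.single k r) 1 else 0

lemma lower_monomial (r : ℕ) (b : Fin N →₀ ℕ) : lower r (monomial b 1 : Coef N) =
    ∑ k, if r ≤ b k then monomial (b - Finsupp.single k r) 1 else 0 := by
  have := (basisMonomials (Fin N) ℝ).constr_basis ℝ (fun b =>
    ∑ k, if r ≤ b k then (monomial (b - Finsupp.single k r) 1 : Coef N) else 0) b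
  rwa [coe_basisMonomials] at this

lemma pairing_lower (r : ℕ) (C h : Coef N) :
    pairing (lower r C) h = pairing C (psum (Fin N) ℝ r * h) := by
  have : pairing.flip h ∘ₗ lower r = pairing.flip (psum (Fin N) ℝ r * h) := by
    refine (basisMonomials (Fin N) ℝ).ext fun b => ?_
    rw [coe_basisMonomials, LinearMap.comp_apply, LinearMap.flip_apply, LinearMap.flip_apply,
      pairing_monomial, lower_monomial, map_sum, LinearMap.sum_apply, psum, Finset.sum_mul,
      coeff_sum]
    refine Finset.sum_congr rfl fun k _ => ?_
    rw [X_pow_eq_monomial, coeff_monomial_mul', one_mul]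
    simp only [Finsupp.single_le_iff]
    split_ifs
    · rw [pairing_monomial]
    · simp
  exact congrArg (fun φ : Coef N →ₗ[ℝ] ℝ => φ C) this

lemma degree_sub_single {b : Fin N →₀ ℕ} {k : Fin N} {r : ℕ} (h : r ≤ b k) :
    (b - Finsupp.single k r).degree + r = b.degree := by
  have h1 : b - Finsupp.single k r + Finsupp.single k r = b :=
    tsub_add_cancel_of_le (Finsupp.single_le_iff.2 h)
  conv_rhs => rw [← h1, map_add, Finsupp.degree_single]

lemma isHomogeneous_lower {C : Coef N} {d : ℕ} (hC : C.IsHomogeneous d) (r : ℕ) :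
    (lower r C).IsHomogeneous (d - r) := by
  refine mem_of_isHomogeneous hC ((homogeneousSubmodule (Fin N) ℝ (d - r)).comap (lower r))
    fun b hb => ?_
  rw [Submodule.mem_comap, lower_monomial]
  refine Submodule.sum_mem _ fun k _ => ?_
  split_ifs with h
  · refine isHomogeneous_monomial _ ?_
    have := degree_sub_single h
    omega
  · exact Submodule.zero_mem _

lemma lower_eq_zero {C : Coef N} {d : ℕ} (hC : C.IsHomogeneous d) {r : ℕ} (hr : d < r) :
    lower r C = 0 := by
  refine mem_of_isHomogeneous hC (LinearMap.ker (lower r)) fun b hb => ?_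
  rw [LinearMap.mem_ker, lower_monomial]
  refine Finset.sum_eq_zero fun k _ => if_neg fun h => ?_
  have := degree_sub_single h
  omega

/-- An exponent vector as an integer vector. -/
def expVec (b : Fin N →₀ ℕ) : IntVec N := fun k => (b k : ℤ)

/-- The linear map with `x^b ↦ ∏_k g_{b_k}`. -/
def smear (κ : ℝ) : Coef N →ₗ[ℝ] Coef N :=
  (basisMonomials (Fin N) ℝ).constr ℝ fun b => gprod κ (expVec b)

lemma smear_monomial (κ : ℝ) (b : Fin N →₀ ℕ) :
    smear κ (monomial b 1 : Coef N) = gprod κ (expVec b) := by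
  have := (basisMonomials (Fin N) ℝ).constr_basis ℝ (fun b => gprod κ (expVec b)) b
  rwa [coe_basisMonomials] at this

/-- The condition `r ≤ b k` in `lower` can be dropped on the right, because `g` vanishes at negative
indices. -/
lemma smear_lower_monomial (κ : ℝ) (r : ℕ) (b : Fin N →₀ ℕ) :
    smear κ (lower r (monomial b 1 : Coef N)) =
      ∑ k, gprod κ (expVec b - (r : ℤ) • Pi.single k 1) := by
  rw [lower_monomial, map_sum]
  refine Finset.sum_congr rfl fun k _ => ?_
  split_ifs with h
  · rw [smear_monomial]
    congr 1
    funext l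
    rcases eq_or_ne l k with rfl | hl
    · simp [expVec, h]
    · simp [expVec, hl]
  · rw [map_zero, gprod_of_neg κ (k := k)]
    simp [expVec]
    omega

/-- On `x^b` write `d = ∑ b_k` and apply Newton's recursion to the `k`-th factor; summing over `k`
assembles the adjoint `lower`. -/
lemma smul_smear (κ : ℝ) {C : Coef N} {d : ℕ} (hC : C.IsHomogeneous d) :
    (d : ℝ) • smear κ C =
      κ • ∑ i ∈ Finset.range d, psum (Fin N) ℝ (i + 1) * smear κ (lower (i + 1) C) := by
  have := mem_of_isHomogeneous hC (LinearMap.ker ((d : ℝ) • smear κ -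
    κ • ∑ i ∈ Finset.range d, LinearMap.mulLeft ℝ (psum (Fin N) ℝ (i + 1)) ∘ₗ smear κ ∘ₗ
      lower (i + 1))) fun b hb => ?_
  · rw [LinearMap.mem_ker] at this
    simpa [sub_eq_zero, LinearMap.sum_apply] using this
  · rw [LinearMap.mem_ker]
    simp only [LinearMap.sub_apply, LinearMap.smul_apply, LinearMap.sum_apply,
      LinearMap.comp_apply, LinearMap.mulLeft_apply, smear_lower_monomial, sub_eq_zero,
      smear_monomial]
    have hd : (d : ℝ) = ∑ k, (expVec b k : ℝ) := by
      rw [← hb, Finsupp.degree_eq_sum]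
      simp [expVec]
    rw [hd, Finset.sum_smul]
    simp only [Finset.mul_sum]
    rw [Finset.sum_comm, Finset.smul_sum]
    refine Finset.sum_congr rfl fun k _ => ?_
    rw [smul_gprod κ (expVec b) k d]
    · push_cast
      rfl
    · rw [← hb, expVec]
      exact_mod_cast Finsupp.le_degree k b

/-- Pairing `smul_smear` with `C` and moving the power sums across yields `d ⟨C, T C⟩` as `κ` times
a sum of forms of smaller degree. If it vanishes, each summand does; by induction `C` is then
orthogonal to every `p_i z` with `z` symmetric, and by degree to the constants, hence to the algebra
generated by power sums. -/
lemma pairing_smear {κ : ℝ} (hκ : 0 < κ) (d : ℕ) : ∀ C : Coef N, C.IsHomogeneous d →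
    0 ≤ pairing C (smear κ C) ∧
      (pairing C (smear κ C) = 0 → ∀ h : Coef N, h.IsSymmetric → pairing C h = 0) := by
  induction d using Nat.strong_induction_on with
  | _ d ih =>
    intro C hC
    rcases Nat.eq_zero_or_pos d with rfl | hd
    · have h1 : smear κ C = C := by
        have := mem_of_isHomogeneous hC (LinearMap.ker (smear κ - LinearMap.id)) fun b hb => ?_
        · simpa [sub_eq_zero] using this
        · rw [Finsupp.degree_eq_zero_iff] at hb
          subst hb
          rw [LinearMap.mem_ker, LinearMap.sub_apply, smear_monomial, LinearMap.id_apply]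
          simp [gprod, expVec, gInt_zero]
      rw [h1]
      refine ⟨pairing_self_nonneg C, fun h0 h _ => ?_⟩
      rw [eq_zero_of_pairing_self h0, map_zero, LinearMap.zero_apply]
    · have hd' : (0 : ℝ) < d := by exact_mod_cast hd
      have key : (d : ℝ) * pairing C (smear κ C) = κ * ∑ i ∈ Finset.range d,
          pairing (lower (i + 1) C) (smear κ (lower (i + 1) C)) := by
        rw [← smul_eq_mul, ← map_smul, smul_smear κ hC, map_smul, map_sum, smul_eq_mul]
        simp only [pairing_lower]
      have hi : ∀ i ∈ Finset.range d,
          0 ≤ pairing (lower (i + 1) C) (smear κ (lower (i + 1) C)) := fun i _ =>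
        (ih _ (by omega) _ (isHomogeneous_lower hC (i + 1))).1
      constructor
      · have : 0 ≤ (d : ℝ) * pairing C (smear κ C) := by
          rw [key]; exact mul_nonneg hκ.le (Finset.sum_nonneg hi)
        exact nonneg_of_mul_nonneg_right this hd'
      · intro h0 h hh
        rw [h0, mul_zero, eq_comm, mul_eq_zero, or_iff_right hκ.ne',
          Finset.sum_eq_zero_iff_of_nonneg hi] at key
        have hp : ∀ (i : ℕ) (z : Coef N), z.IsSymmetric →
            pairing C (psum (Fin N) ℝ (i + 1) * z) = 0 := by
          intro i z hz
          rw [← pairing_lower]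
          rcases lt_or_ge i d with hid | hid
          · exact (ih _ (by omega) _ (isHomogeneous_lower hC (i + 1))).2
              (key i (Finset.mem_range.2 hid)) z hz
          -- Power sums of degree above `d` have zero adjoint on `C`, so no equality information is
          -- needed for them.
          · rw [lower_eq_zero hC (by omega), map_zero, LinearMap.zero_apply]
        have h2 := mem_adjoin_psum hh
        rw [← Subalgebra.mem_toSubmodule, Algebra.adjoin_eq_span] at h2
        have h3 : Submodule.span ℝ (Submonoid.closure
            (Set.range fun i : ℕ => psum (Fin N) ℝ (i + 1)) : Set (Coef N)) ≤
            LinearMap.ker (pairing C) := by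
          rw [Submodule.span_le]
          intro z hz
          have hsym : ∀ y ∈ Submonoid.closure (Set.range fun i : ℕ => psum (Fin N) ℝ (i + 1)),
              y.IsSymmetric := by
            intro y hy
            have : Submonoid.closure (Set.range fun i : ℕ => psum (Fin N) ℝ (i + 1)) ≤
                (symmetricSubalgebra (Fin N) ℝ).toSubmonoid := by
              rw [Submonoid.closure_le]
              rintro _ ⟨i, rfl⟩
              exact psum_isSymmetric (Fin N) ℝ (i + 1)
            exact this hy
          change pairing C z = 0
          induction hz using Submonoid.closure_induction_left with
          | one =>
            have := mem_of_isHomogeneous hC (LinearMap.ker (pairing.flip 1)) fun b hb => ?_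
            · simpa using this
            · have hb0 : (0 : Fin N →₀ ℕ) ≠ b := by
                rintro rfl
                simp at hb
                omega
              rw [LinearMap.mem_ker, LinearMap.flip_apply, pairing_monomial, coeff_one, if_neg hb0]
          | mul_left x hx y hy _ =>
            obtain ⟨i, rfl⟩ := hx
            exact hp i y (hsym y hy)
        exact h3 h2

lemma isSymmetric_gNat (κ : ℝ) (r : ℕ) : (gNat κ N r).IsSymmetric := by
  induction r using Nat.strong_induction_on with
  | _ r ih =>
    cases r with
    | zero => rw [gNat]; exact (symmetricSubalgebra (Fin N) ℝ).one_mem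
    | succ r =>
      have h1 : ∀ i : Fin (r + 1), psum (Fin N) ℝ (i + 1) * gNat κ N (r - i) ∈
          symmetricSubalgebra (Fin N) ℝ := fun i =>
        Subalgebra.mul_mem _ (psum_isSymmetric (Fin N) ℝ (i + 1)) (ih _ (by omega))
      have h2 := Subalgebra.sum_mem (symmetricSubalgebra (Fin N) ℝ) (t := Finset.univ)
        fun i _ => h1 i
      rw [gNat]
      exact Subalgebra.smul_mem (symmetricSubalgebra (Fin N) ℝ) h2 _

lemma isHomogeneous_gNat (κ : ℝ) (r : ℕ) : (gNat κ N r).IsHomogeneous r := by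
  induction r using Nat.strong_induction_on with
  | _ r ih =>
    cases r with
    | zero => rw [gNat]; exact isHomogeneous_one (Fin N) ℝ
    | succ r =>
      rw [gNat]
      refine Submodule.smul_mem (homogeneousSubmodule (Fin N) ℝ (r + 1)) _
        (Submodule.sum_mem _ fun i _ => ?_)
      have h1 : (psum (Fin N) ℝ (i + 1)).IsHomogeneous ((i : ℕ) + 1) :=
        IsHomogeneous.sum _ _ _ fun k _ => isHomogeneous_X_pow k _
      have h2 := h1.mul (ih (r - i) (by omega))
      rwa [show (i : ℕ) + 1 + (r - i) = r + 1 by omega] at h2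

lemma isSymmetric_gprod (κ : ℝ) (n : IntVec N) : (gprod κ n).IsSymmetric := by
  refine (symmetricSubalgebra (Fin N) ℝ).prod_mem fun k _ => ?_
  rw [gInt]
  split_ifs
  · exact (symmetricSubalgebra (Fin N) ℝ).zero_mem
  · exact isSymmetric_gNat κ _

lemma isHomogeneous_gprod (κ : ℝ) (b : Fin N →₀ ℕ) :
    (gprod κ (expVec b)).IsHomogeneous b.degree := by
  rw [Finsupp.degree_eq_sum]
  refine IsHomogeneous.prod _ _ _ fun k _ => ?_
  rw [expVec, gInt_natCast]
  exact isHomogeneous_gNat κ _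

lemma isSymmetric_smear (κ : ℝ) (C : Coef N) : (smear κ C).IsSymmetric := by
  have : C ∈ (Subalgebra.toSubmodule (symmetricSubalgebra (Fin N) ℝ)).comap (smear κ) := by
    rw [C.as_sum]
    refine Submodule.sum_mem _ fun b _ => ?_
    have : monomial b (coeff b C) = coeff b C • (monomial b 1 : Coef N) := by simp [smul_monomial]
    rw [this]
    refine Submodule.smul_mem _ _ ?_
    rw [Submodule.mem_comap, smear_monomial]
    exact isSymmetric_gprod κ _
  exact this

lemma isHomogeneous_smear (κ : ℝ) {C : Coef N} {d : ℕ} (hC : C.IsHomogeneous d) :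
    (smear κ C).IsHomogeneous d := by
  refine mem_of_isHomogeneous hC ((homogeneousSubmodule (Fin N) ℝ d).comap (smear κ)) fun b hb => ?_
  rw [Submodule.mem_comap, smear_monomial, ← hb]
  exact isHomogeneous_gprod κ b

lemma homogeneousComponent_smear (κ : ℝ) (d : ℕ) (C : Coef N) :
    homogeneousComponent d (smear κ C) = smear κ (homogeneousComponent d C) := by
  have h : homogeneousComponent d ∘ₗ smear κ =
      smear κ ∘ₗ (homogeneousComponent d : Coef N →ₗ[ℝ] Coef N) := by
    refine (basisMonomials (Fin N) ℝ).ext fun b => ?_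
    rw [coe_basisMonomials, LinearMap.comp_apply, LinearMap.comp_apply, smear_monomial,
      homogeneousComponent_of_mem (isHomogeneous_gprod κ b),
      homogeneousComponent_of_mem (isHomogeneous_monomial (1 : ℝ) rfl)]
    split_ifs
    · rw [smear_monomial]
    · rw [map_zero]
  exact congrArg (fun φ : Coef N →ₗ[ℝ] Coef N => φ C) h

lemma isSymmetric_homogeneousComponent {C : Coef N} (hC : C.IsSymmetric) (d : ℕ) :
    (homogeneousComponent d C).IsSymmetric := fun e => by
  rw [rename_homogeneousComponent, hC e]

/-- Each homogeneous component of `C` is a null vector of the form, hence orthogonal to all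
symmetric polynomials; being symmetric itself, it is orthogonal to itself. -/
theorem eq_zero_of_smear_eq_zero {κ : ℝ} (hκ : 0 < κ) {C : Coef N} (hC : C.IsSymmetric)
    (h : smear κ C = 0) : C = 0 := by
  rw [← sum_homogeneousComponent C]
  refine Finset.sum_eq_zero fun d _ => eq_zero_of_pairing_self ?_
  refine (pairing_smear hκ d _ (homogeneousComponent_isHomogeneous d C)).2 ?_ _
    (isSymmetric_homogeneousComponent hC d)
  rw [← homogeneousComponent_smear, h, map_zero, map_zero]

/-- On the finite-dimensional space of symmetric polynomials homogeneous of degree `d`, the map is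
an injective endomorphism and therefore surjective. -/
theorem exists_smear_eq {κ : ℝ} (hκ : 0 < κ) {h : Coef N} (hh : h.IsSymmetric) :
    ∃ C, smear κ C = h := by
  suffices H : h ∈ LinearMap.range (smear (N := N) κ) from H
  rw [← sum_homogeneousComponent h]
  refine Submodule.sum_mem _ fun d _ => ?_
  let V : Submodule ℝ (Coef N) :=
    homogeneousSubmodule (Fin N) ℝ d ⊓ Subalgebra.toSubmodule (symmetricSubalgebra (Fin N) ℝ)
  have hV : ∀ C ∈ V, smear κ C ∈ V := fun C hC =>
    ⟨isHomogeneous_smear κ hC.1, isSymmetric_smear κ C⟩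
  have h1 : FiniteDimensional ℝ (homogeneousSubmodule (Fin N) ℝ d) :=
    Module.Finite.of_fg (homogeneousSubmodule_fg (Fin N) ℝ d)
  have h2 : FiniteDimensional ℝ V := Submodule.finiteDimensional_inf_left _ _
  have h3 : Function.Injective ((smear κ).restrict hV) := by
    rw [← LinearMap.ker_eq_bot, LinearMap.ker_eq_bot']
    intro C hC
    exact Subtype.ext (eq_zero_of_smear_eq_zero hκ C.2.2 (congrArg Subtype.val hC))
  obtain ⟨C, hC⟩ := LinearMap.injective_iff_surjective.1 h3
    ⟨homogeneousComponent d h, homogeneousComponent_isHomogeneous d h,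
      isSymmetric_homogeneousComponent hh d⟩
  exact ⟨C.1, congrArg Subtype.val hC⟩

theorem mem_span_gprod {κ : ℝ} (hκ : 0 < κ) {h : Coef N} (hh : h.IsSymmetric) :
    h ∈ Submodule.span ℝ (Set.range fun l : Part N => gprod κ l.1) := by
  obtain ⟨C, rfl⟩ := exists_smear_eq hκ hh
  rw [C.as_sum, map_sum]
  refine Submodule.sum_mem _ fun b _ => ?_
  have : monomial b (coeff b C) = coeff b C • (monomial b 1 : Coef N) := by simp [smul_monomial]
  rw [this, map_smul, smear_monomial]
  refine Submodule.smul_mem _ _ ?_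
  rcases gprod_eq_zero_or κ (expVec b) with h | ⟨l, h1, -⟩
  · rw [h]; exact Submodule.zero_mem _
  · rw [h1]; exact Submodule.subset_span ⟨l, rfl⟩

/-- The exponent vector of a partition. -/
def partExp (l : Part N) : Fin N →₀ ℕ := Finsupp.equivFunOnFinite.symm fun k => (l.1 k).toNat

lemma expVec_partExp (l : Part N) : expVec (partExp l) = l.1 := by
  funext k
  simp [expVec, partExp, l.2.2 k]

/-- The orbit sum `∑_σ x^{σ λ}`. -/
def orbitSum (l : Part N) : Coef N :=
  ∑ σ : Equiv.Perm (Fin N), rename σ (monomial (partExp l) 1)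

lemma isSymmetric_orbitSum (l : Part N) : (orbitSum l).IsSymmetric := fun τ => by
  rw [orbitSum, map_sum]
  exact Fintype.sum_equiv (Equiv.mulLeft τ) _ _ fun σ => by rw [rename_rename]; rfl

lemma expVec_mapDomain (b : Fin N →₀ ℕ) (σ : Equiv.Perm (Fin N)) :
    expVec (b.mapDomain σ) = expVec b ∘ σ.symm := by
  funext k
  rw [expVec, Finsupp.mapDomain_equiv_apply]
  rfl

lemma smear_orbitSum (κ : ℝ) (l : Part N) :
    smear κ (orbitSum l) = (N.factorial : ℝ) • gprod κ l.1 := by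
  rw [orbitSum, map_sum, Finset.sum_congr rfl (g := fun _ => gprod κ l.1)]
  · rw [Finset.sum_const, Finset.card_univ, Fintype.card_perm, Fintype.card_fin, Nat.cast_smul_eq_nsmul]
  · intro σ _
    rw [rename_monomial, smear_monomial, expVec_mapDomain, gprod_comp, expVec_partExp]

/-- The weakly decreasing rearrangement of a vector is unique, so distinct partitions have disjoint
orbits. -/
lemma coeff_orbitSum_of_ne {l m : Part N} (h : l ≠ m) : coeff (partExp m) (orbitSum l) = 0 := by
  rw [orbitSum, coeff_sum]
  refine Finset.sum_eq_zero fun σ _ => ?_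
  rw [rename_monomial, coeff_monomial, if_neg]
  intro he
  apply h
  have h1 := congrArg expVec he
  rw [expVec_mapDomain, expVec_partExp, expVec_partExp] at h1
  have h2 := Tuple.unique_antitone (f := l.1) (σ := σ.symm) (τ := 1) (h1 ▸ m.2.1) l.2.1
  exact Subtype.ext (h2.symm.trans h1)

lemma coeff_orbitSum_self_pos (l : Part N) : 0 < coeff (partExp l) (orbitSum l) := by
  rw [orbitSum, coeff_sum]
  refine Finset.sum_pos' (fun σ _ => ?_) ⟨1, Finset.mem_univ _, ?_⟩
  · rw [rename_monomial, coeff_monomial]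
    split_ifs <;> simp
  · simp [coeff_monomial]

/-- A relation among the `g_λ` is, up to `N!`, the image of the same combination of orbit sums. By
injectivity that combination is zero, and the coefficient at `x^λ` isolates a single term. -/
theorem linearIndependent_gprod {κ : ℝ} (hκ : 0 < κ) :
    LinearIndependent ℝ fun l : Part N => gprod κ l.1 := by
  rw [linearIndependent_iff']
  intro s a hs m hm
  have hC : ∑ l ∈ s, a l • orbitSum l = 0 := by
    refine eq_zero_of_smear_eq_zero hκ ?_ ?_
    · exact Subalgebra.sum_mem (symmetricSubalgebra (Fin N) ℝ) fun l _ =>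
        Subalgebra.smul_mem _ (isSymmetric_orbitSum l) _
    · simp only [map_sum, map_smul, smear_orbitSum]
      simp only [smul_comm _ (N.factorial : ℝ), ← Finset.smul_sum, hs, smul_zero]
  have h1 := congrArg (coeff (partExp m)) hC
  rw [coeff_sum, Finset.sum_eq_single_of_mem m hm, coeff_smul, coeff_zero, smul_eq_mul] at h1
  · exact (mul_eq_zero.1 h1).resolve_right (coeff_orbitSum_self_pos m).ne'
  · intro l _ hl
    rw [coeff_smul, coeff_orbitSum_of_ne hl, smul_zero]

end PowerSums

end Calogero
end

/-! ### The `P_λ` form a basis, and the theorem. -/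

noncomputable section

namespace Calogero

variable {N : ℕ}

theorem linearIndependent_P {κ : ℝ} (hκ : 0 < κ) :
    LinearIndependent ℝ fun l : Part N => P κ (fcoef κ) l.1 :=
  linearIndependent_of_triangular (linearIndependent_gprod hκ) (P_sub_gprod_mem_span_rank κ)

theorem span_P {κ : ℝ} (hκ : 0 < κ) :
    Submodule.span ℝ (Set.range fun l : Part N => P κ (fcoef κ) l.1) =
      Subalgebra.toSubmodule (MvPolynomial.symmetricSubalgebra (Fin N) ℝ) := by
  refine le_antisymm (Submodule.span_le.2 ?_) fun h hh => ?_
  · rintro _ ⟨l, rfl⟩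
    exact isSymmetric_P κ l.1
  · refine Submodule.span_le.2 ?_ (mem_span_gprod hκ hh)
    rintro _ ⟨l, rfl⟩
    exact mem_span_of_triangular (v := fun l : Part N => gprod κ l.1)
      (P_sub_gprod_mem_span_rank κ) l

end Calogero
end

theorem theorem1 (N : ℕ) (κ : ℝ) (hκ : 0 < κ) :
    -- the expansion of the generating function determines the polynomials `f_n`
    (∃! f : Calogero.IntVec N → MvPolynomial (Fin N) ℝ, Calogero.IsExpansion κ f) ∧
    -- the sums that define the coefficients `u_n(m)` are finite
    (∀ n m : Calogero.IntVec N,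
      (Function.support
        (fun c : Calogero.Chain N => Calogero.chainTerm κ n m c.1.1 c.2)).Finite) ∧
    ∀ f : Calogero.IntVec N → MvPolynomial (Fin N) ℝ, Calogero.IsExpansion κ f →
      -- the `f_n` are symmetric
      (∀ n, (f n).IsSymmetric) ∧
      -- the sums that define the `P_n` are finite
      (∀ n : Calogero.IntVec N,
        (Function.support
          (fun m : Calogero.Below n => Calogero.u κ n m.1 • f m.1)).Finite) ∧
      -- every `P_n` is a reduced eigenfunction with eigenvalue `E_n`
      (∀ n : Calogero.IntVec N,
        Calogero.IsReducedEigenfunction κ (Calogero.energy κ n) (Calogero.P κ f n)) ∧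
      -- the `P_λ` form a basis of the space of symmetric polynomials
      LinearIndependent ℝ (fun l : Calogero.Part N => Calogero.P κ f l.1) ∧
      Submodule.span ℝ (Set.range (fun l : Calogero.Part N => Calogero.P κ f l.1)) =
        Subalgebra.toSubmodule (MvPolynomial.symmetricSubalgebra (Fin N) ℝ) := by
  refine ⟨⟨Calogero.fcoef κ, Calogero.isExpansion_fcoef κ, fun f hf =>
    Calogero.isExpansion_unique hf (Calogero.isExpansion_fcoef κ)⟩,
    Calogero.finite_support_chainTerm κ, fun f hf => ?_⟩
  obtain rfl := Calogero.isExpansion_unique hf (Calogero.isExpansion_fcoef κ)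
  exact ⟨Calogero.isSymmetric_fcoef κ, Calogero.finite_support_u_smul κ,
    Calogero.isReducedEigenfunction_P hκ, Calogero.linearIndependent_P hκ, Calogero.span_P hκ⟩
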